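/- **Theorem (Infinite to finite approximation error).** *Infinite program.* Let $(\mathbb X,\mathbb C,\|\cdot\|)$ and $(\mathbb B,\mathbb Y,\|\cdot\|)$ be dual pairs of real normed spaces: $\mathbb X,\mathbb B$ are normed (not necessarily complete), the bilinear forms $\langle\cdot,\cdot\rangle$ separate points on both sides, and the dual norms $\|c\|_*=\sup_{\|x\|\le1}\langle x,c\rangle$, $\|y\|_*=\sup_{\|v\|\le1}\langle v,y\rangle$ are finite. Let $\mathcal A:\mathbb X\to\mathbb B$ be linear, weakly continuous and of finite norm $\|\mathcal A\|$, let $\mathbb K\subset\mathbb B$ be a weakly closed convex cone with dual cone $\mathbb K^*=\{y:\langle v,y\rangle\ge0\ \forall v\in\mathbb K\}$, and let $c\in\mathbb C$, $b\in\mathbb B$. Let $J=\inf\{\langle x,c\rangle:\mathcal Ax-b\in\mathbb K\}$, and assume the infimum is attained at $x^\star$. *Semi-infinite program.* Let $x_1,x_2,\dots\in\mathbb X$ be linearly independent with $\|x_i\|=1$; for each $n$ let $\|\cdot\|_{\mathfrak R}$ be a norm on $\mathbb R^n$ with dual norm $\|\cdot\|_{\mathfrak R^*}$, and let $\theta_P\in\mathbb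 R$. Put $\mathcal A_n\alpha=\sum_i\alpha_i\mathcal Ax_i$, $\mathcal A_n^*y=(\langle\mathcal Ax_i,y\rangle)_{i\le n}$, $\mathbf c=(\langle x_i,c\rangle)_{i\le n}$, $\mathscr A=\{\alpha\in\mathbb R^n:\|\alpha\|_{\mathfrak R}\le\theta_P\}$, $\varrho_n=\sup_{\|\alpha\|_{\mathfrak R}\le1}\|\alpha\|_{\ell_1}$ and $J_n=\inf\{\alpha^\top\mathbf c:\alpha\in\mathscr A,\ \mathcal A_n\alpha-b\in\mathbb K\}$. Suppose there are $d>0$ and $D$ such that for every $m\ge1$ a projection residual $r_m$ (that is, $x^\star$ minus a nearest point) of $x^\star$ onto $\{\sum_{i\le m}\alpha_ix_i:\|\alpha\|_{\mathfrak R}\le\theta_P\}$ satisfies $\|r_m\|\le Dm^{-1/d}$. Fix $n\ge1$ such that the program defining $J_n$ is feasible and, for some $\gamma>0$, $\|\mathcal A_n^*y\|_{\mathfrak R^*}\ge\gamma\|y\|_*$ for all $y\in\mathbb K^*$ and $\gamma\theta_P>\|b\|$. For a lower bound $J_n^{\rm LB}\le J_n$ put $$\theta_D=\frac{\theta_P\|\mathbf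 c\|_{\mathfrak R^*}-J_n^{\rm LB}}{\gamma\theta_P-\|b\|}.$$ *Scenario program.* Let $\mathcal K$ be the set of extreme points of $\{y\in\mathbb K^*:\|y\|_*=1\}$, and assume that the weakly closed convex hull of $\mathcal K$ contains this set. Let $\mathds P$ be a Borel probability measure supported on $\mathcal K$, let $y_1,\dots,y_N$ be i.i.d. samples from $\mathds P$, and let $J_{n,N}=\min\{\alpha^\top\mathbf c:\alpha\in\mathscr A,\ \alpha^\top\mathcal A_n^*y_j\ge\langle b,y_j\rangle,\ j\le N\}$; assume that its minimizer $\alpha_N^\star$ is almost surely unique. A *tail bound* is a function $h\ge0$ on $\mathbb R^n\times[0,1)$ with $h(\alpha,\varepsilon)\ge\sup\{\zeta\ge0:\mathds P[y:\sigma_{\mathcal K}(b-\mathcal A_n\alpha)<\langle b-\mathcal A_n\alpha,y\rangle+\zeta]\le\varepsilon\}$ for all $\alpha,\varepsilon$, where $\sigma_{\mathcal K}(v)=\sup_{y\in\mathcal K}\langle v,y\rangle$. Let $\mathsf N(n,\varepsilon,\beta)=\min\{N:\sum_{i=0}^{n-1}\binom Ni\varepsilon^i(1-\varepsilon)^{N-i}\le\beta\}$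 ($=\infty$ if there is no such $N$). *Smoothing algorithm.* Let $\mathscr Y=\{y\in\mathbb K^*:\|y\|_*\le\theta_D\}$, let $\mathsf d:\mathscr Y\to\mathbb R_+$ be strongly convex with respect to $\|\cdot\|_*$, and assume that for all $s>0$, $\alpha\in\mathscr A$ a maximizer $y_s^\star(\alpha)$ of $\langle b-\mathcal A_n\alpha,y\rangle-s\,\mathsf d(y)$ over $y\in\mathscr Y$ exists. Let $\eta,L>0$ be such that $\|\mathcal A_n^*y^\star_\eta(\alpha)-\mathcal A_n^*y^\star_\eta(\alpha')\|_{\mathfrak R^*}\le\frac L\eta\|\alpha-\alpha'\|_{\mathfrak R}$ on $\mathscr A$, let $\vartheta>0$ be a strong convexity parameter of $\frac12\|\cdot\|_{\mathfrak R}^2$ with respect to $\|\cdot\|_{\mathfrak R}$, and let $\mathds T(q,\alpha)=\arg\min_{v\in\mathscr A}\{q^\top v+\frac1{2\vartheta}\|v-\alpha\|_{\mathfrak R}^2\}$. Starting from any $w^{(0)}\in\mathscr A$, the algorithm sets, for $k=0,1,\dots$, $r^{(k)}=\frac\eta L(\mathbf c-\mathcal A_n^*y_\eta^\star(w^{(k)}))$,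 $z^{(k)}=\mathds T(\sum_{j\le k}\frac{j+1}2r^{(j)},0)$, $\alpha^{(k)}=\mathds T(\frac1\vartheta r^{(k)},w^{(k)})$, $w^{(k+1)}=\frac2{k+3}z^{(k)}+\frac{k+1}{k+3}\alpha^{(k)}$. With $\widehat y_\eta=\sum_{j=0}^k\frac{2(j+1)}{(k+1)(k+2)}y_\eta^\star(w^{(j)})$ put $$J^{\rm LB}_{n,\eta}=\langle b,\widehat y_\eta\rangle-\theta_P\|\mathcal A_n^*\widehat y_\eta-\mathbf c\|_{\mathfrak R^*},\qquad J^{\rm UB}_{n,\eta}=\mathbf c^\top\alpha^{(k)}+\sup_{y\in\mathscr Y}\langle b-\mathcal A_n\alpha^{(k)},y\rangle.$$ *Conclusion.* Let $\beta\in(0,1)$. (1) For every tail bound $h$, every $\varepsilon\in(0,1)$, every $N\ge\mathsf N(n,\varepsilon,\beta)$ and all $\eta,k$ as above, with probability at least $1-\beta$, $$\max\{J_{n,N},J^{\rm LB}_{n,\eta}\}-D(\|c\|_*+\theta_D\|\mathcal A\|)n^{-1/d}\le J\le\min\{J^{\rm UB}_{n,\eta},\ J_{n,N}+\theta_Dh(\alpha^\star_N,\varepsilon)\}.$$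 (2) Let $\varepsilon>0$ and $n\ge\big(D(\|c\|_*+\theta_D\|\mathcal A\|)\varepsilon^{-1}\big)^d$. Suppose that **either** $N\ge\mathsf N(n,g(z_n\varepsilon),\beta)$, where $z_n=\big(\theta_D(\theta_P\varrho_n\|\mathcal A\|+\|b\|)\big)^{-1}$ and $g:\mathbb R_+\to[0,1]$ is a non-decreasing function such that every open $\|\cdot\|_*$-ball of radius $r$ centred in $\mathcal K$ has $\mathds P$-probability at least $g(r)$; **or** there are $c_0,C_0>0$ with $\mathsf d(y_s^\star(\alpha))\le C_0\max\{\log(c_0s^{-1}),1\}$ for all $s>0$, $\alpha\in\mathscr A$, and $$\eta\le\frac{\varepsilon}{2C_0\max\{2\log(2c_0C_0\varepsilon^{-1}),1\}},\qquad k\ge5\,\theta_P\sqrt{\frac{L}{\vartheta\,\eta\,\varepsilon}}.$$ Then with probability at least $1-\beta$, $$\min\big\{|J-J_{n,N}|,\ |J-J^{\rm LB}_{n,\eta}|\big\}\le\varepsilon.$$ -/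

import Mathlib

open MeasureTheory Set

noncomputable section

namespace InfLP

/-- The dual norm `sup {ℓ v : ν v ≤ 1}` of a functional `ℓ` with respect to a norm `ν`. -/
def dualNorm {V : Type*} (ν : V → ℝ) (ℓ : V → ℝ) : ℝ :=
  sSup (ℓ '' {v | ν v ≤ 1})

/-- The support function `σ_S(ℓ) = sup_{y ∈ S} ℓ y`. -/
def supportFun {V : Type*} (S : Set V) (ℓ : V → ℝ) : ℝ :=
  sSup (ℓ '' S)

/-- `f` is strongly convex on `S` with parameter `m`, with respect to the norm `ν`. -/
def StronglyConvex {V : Type*} [AddCommGroup V] [Module ℝ V] (ν : V → ℝ) (S : Set V) (m : ℝ)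
    (f : V → ℝ) : Prop :=
  ∀ u ∈ S, ∀ v ∈ S, ∀ s t : ℝ, 0 ≤ s → 0 ≤ t → s + t = 1 →
    f (s • u + t • v) ≤ s * f u + t * f v - m / 2 * (s * t) * ν (u - v) ^ 2

/-- A dual pair of normed vector spaces: the bilinear form separates points on both sides, and
the dual norm it induces on the second space is finite. -/
structure IsDualPair {X C : Type*} [NormedAddCommGroup X] [NormedSpace ℝ X]
    [AddCommGroup C] [Module ℝ C] (p : X →ₗ[ℝ] C →ₗ[ℝ] ℝ) : Prop where
  separatingLeft : p.SeparatingLeft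
  separatingRight : p.SeparatingRight
  bounded : ∀ c : C, BddAbove ((fun x => p x c) '' {x : X | ‖x‖ ≤ 1})

/-- The data of the conic linear program `inf {⟨x, c⟩ : 𝒜 x - b ∈ K}`. -/
structure Program (X C B Y : Type*) [NormedAddCommGroup X] [NormedSpace ℝ X]
    [AddCommGroup C] [Module ℝ C] [NormedAddCommGroup B] [NormedSpace ℝ B]
    [AddCommGroup Y] [Module ℝ Y] where
  /-- the bilinear form on `X × C` -/
  pX : X →ₗ[ℝ] C →ₗ[ℝ] ℝ
  /-- the bilinear form on `B × Y` -/
  pB : B →ₗ[ℝ] Y →ₗ[ℝ] ℝ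
  /-- the linear operator, with finite operator norm -/
  A : X →L[ℝ] B
  /-- the cone defining the conic inequality -/
  K : PointedCone ℝ B
  /-- the cost vector -/
  c : C
  /-- the right-hand side -/
  b : B

/-- The basis elements, the norms `‖·‖_ℜ` on `ℝⁿ` and the radius `θ_P` of the feasible set. The
basis is indexed from `0`, so that `𝕏ₙ` is spanned by `x 0, …, x (n - 1)`. -/
structure Scheme (X : Type*) where
  /-- the basis elements -/
  x : ℕ → X
  /-- the norm on `ℝⁿ` (definiteness is part of `Scheme.Standing`) -/
  R : (n : ℕ) → Seminorm ℝ (Fin n → ℝ)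
  /-- the radius of the norm constraint -/
  θP : ℝ

section

variable {X C B Y : Type*} [NormedAddCommGroup X] [NormedSpace ℝ X]
  [AddCommGroup C] [Module ℝ C] [NormedAddCommGroup B] [NormedSpace ℝ B]
  [AddCommGroup Y] [Module ℝ Y]

/-- The standing assumptions on the program: two dual pairs of normed spaces, a weakly closed
cone and a weakly continuous operator. -/
structure Program.Standing (P : Program X C B Y) : Prop where
  dualPairX : IsDualPair P.pX
  dualPairB : IsDualPair P.pB
  closedCone : IsClosed (X := WeakBilin P.pB) (P.K : Set B)
  weaklyContinuous : Continuous (X := WeakBilin P.pX) (Y := WeakBilin P.pB) (fun x => P.A x)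

/-- The standing assumptions on the basis and on the norms on `ℝⁿ`. -/
structure Scheme.Standing (S : Scheme X) : Prop where
  linearIndependent : LinearIndependent ℝ S.x
  normalized : ∀ i, ‖S.x i‖ = 1
  definite : ∀ n α, S.R n α = 0 → α = 0

namespace Program

variable (P : Program X C B Y) (S : Scheme X)

/-- `‖c‖_*` -/
def normC : ℝ := dualNorm (fun x : X => ‖x‖) (fun x => P.pX x P.c)

/-- `‖y‖_*` -/
def normY (y : Y) : ℝ := dualNorm (fun v : B => ‖v‖) (fun v => P.pB v y)

/-- The dual cone `K^*`. -/
def Kstar : PointedCone ℝ Y := PointedCone.dual P.pB (P.K : Set B)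

/-! The infinite program. -/

/-- The feasible set of the infinite program. -/
def feas : Set X := {x | P.A x - P.b ∈ P.K}

/-- The value `J` of the infinite program. -/
def J : ℝ := sInf ((fun x => P.pX x P.c) '' P.feas)

/-- `x` is an optimizer of the infinite program. -/
def IsOptimizer (x : X) : Prop :=
  x ∈ P.feas ∧ ∀ x' ∈ P.feas, P.pX x P.c ≤ P.pX x' P.c

/-! The semi-infinite program. -/

/-- `𝒜ₙ α = ∑ αᵢ 𝒜 xᵢ` -/
def An (n : ℕ) (α : Fin n → ℝ) : B := ∑ i, α i • P.A (S.x i)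

/-- `𝒜ₙ^* y = (⟨𝒜 x₁, y⟩, …, ⟨𝒜 xₙ, y⟩)` -/
def AnStar (n : ℕ) (y : Y) : Fin n → ℝ := fun i => P.pB (P.A (S.x i)) y

/-- The cost vector `(⟨x₁, c⟩, …, ⟨xₙ, c⟩)`. -/
def cvec (n : ℕ) : Fin n → ℝ := fun i => P.pX (S.x i) P.c

end Program

/-- The dual norm `‖·‖_ℜ*` on `ℝⁿ`. -/
def Scheme.normRStar (S : Scheme X) (n : ℕ) (v : Fin n → ℝ) : ℝ :=
  dualNorm (S.R n) (fun α => α ⬝ᵥ v)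

/-- `ϱₙ = sup {‖α‖_{ℓ₁} : ‖α‖_ℜ ≤ 1}` -/
def Scheme.rho (S : Scheme X) (n : ℕ) : ℝ :=
  sSup ((fun α : Fin n → ℝ => ∑ i, |α i|) '' {α | S.R n α ≤ 1})

/-- The set of `α ∈ ℝⁿ` with `‖α‖_ℜ ≤ θ_P`. -/
def Scheme.ballR (S : Scheme X) (n : ℕ) : Set (Fin n → ℝ) := {α | S.R n α ≤ S.θP}

/-- The image in `𝕏ₙ` of the ball of radius `θ_P`. -/
def Scheme.ballX (S : Scheme X) (n : ℕ) : Set X :=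
  (fun α : Fin n → ℝ => ∑ i, α i • S.x i) '' S.ballR n

/-- `z` is a projection of `x` onto the set `T`. -/
def IsProjection (T : Set X) (x z : X) : Prop :=
  z ∈ T ∧ ∀ z' ∈ T, ‖z - x‖ ≤ ‖z' - x‖

namespace Program

variable (P : Program X C B Y) (S : Scheme X)

/-- The feasible set of the semi-infinite program. -/
def feasN (n : ℕ) : Set (Fin n → ℝ) := {α | P.An S n α - P.b ∈ P.K ∧ α ∈ S.ballR n}

/-- The value `Jₙ` of the semi-infinite program. -/
def Jn (n : ℕ) : ℝ := sInf ((fun α => α ⬝ᵥ P.cvec S n) '' P.feasN S n)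

/-- Semi-infinite regularity with constant `γ`. -/
structure Regular (n : ℕ) (γ : ℝ) : Prop where
  feasible : (P.feasN S n).Nonempty
  pos : 0 < γ
  infSup : ∀ y ∈ P.Kstar, γ * P.normY y ≤ S.normRStar n (P.AnStar S n y)
  large : ‖P.b‖ < γ * S.θP

/-- The dual optimizer bound `θ_D` obtained from a lower bound `JLB` of `Jₙ`. -/
def θD (n : ℕ) (γ JLB : ℝ) : ℝ :=
  (S.θP * S.normRStar n (P.cvec S n) - JLB) / (γ * S.θP - ‖P.b‖)

/-! The scenario program. -/

/-- The part of the dual unit sphere that lies in the dual cone. -/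
def sphere : Set Y := {y | y ∈ P.Kstar ∧ P.normY y = 1}

/-- The set `𝒦` of extreme points of `sphere`. -/
def ext : Set Y := P.sphere.extremePoints ℝ

/-- The weakly closed convex hull of `𝒦` contains `sphere`, so that restricting the conic
constraint to `𝒦` loses nothing. -/
def ExtGenerates : Prop :=
  P.sphere ⊆ closure (X := WeakBilin P.pB.flip) (convexHull ℝ P.ext)

/-- The feasible set of the scenario program with samples `y`. -/
def scenarioFeas (n : ℕ) {N : ℕ} (y : Fin N → Y) : Set (Fin n → ℝ) :=
  {α | (∀ j, P.pB P.b (y j) ≤ α ⬝ᵥ P.AnStar S n (y j)) ∧ α ∈ S.ballR n}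

/-- The value `J_{n,N}` of the scenario program. -/
def JnN (n : ℕ) {N : ℕ} (y : Fin N → Y) : ℝ :=
  sInf ((fun α => α ⬝ᵥ P.cvec S n) '' P.scenarioFeas S n y)

/-- `α` is an optimizer of the scenario program. -/
def IsScenarioOptimizer (n : ℕ) {N : ℕ} (y : Fin N → Y) (α : Fin n → ℝ) : Prop :=
  α ∈ P.scenarioFeas S n y ∧
    ∀ α' ∈ P.scenarioFeas S n y, α ⬝ᵥ P.cvec S n ≤ α' ⬝ᵥ P.cvec S n

/-- `p(α, ζ) = ℙ[y : σ_𝒦(b - 𝒜ₙ α) < ⟨b - 𝒜ₙ α, y⟩ + ζ]` -/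
def tailProb [MeasurableSpace Y] (ℙ : Measure Y) (n : ℕ) (α : Fin n → ℝ) (ζ : ℝ) : ℝ :=
  ℙ.real {y | supportFun P.ext (P.pB (P.b - P.An S n α)) < P.pB (P.b - P.An S n α) y + ζ}

/-- `h` is a tail bound: `h(α, ε) ≥ sup {ζ ≥ 0 : p(α, ζ) ≤ ε}` and `h(α, ε) ≥ 0`. The level
`ε = 1` is left out, because there the supremum is infinite. -/
def IsTailBound [MeasurableSpace Y] (ℙ : Measure Y) (n : ℕ) (h : (Fin n → ℝ) → ℝ → ℝ) : Prop :=
  ∀ α, ∀ ε ∈ Ico (0 : ℝ) 1, 0 ≤ h α ε ∧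
    h α ε ∈ upperBounds {ζ | 0 ≤ ζ ∧ P.tailProb S ℙ n α ζ ≤ ε}

/-- `g : ℝ₊ → [0, 1]` is non-decreasing and bounds from below the probability of the open balls,
in the dual norm, that are centred in `𝒦`. -/
structure IsBallLowerBound [MeasurableSpace Y] (ℙ : Measure Y) (g : ℝ → ℝ) : Prop where
  mono : MonotoneOn g (Ici 0)
  mem : ∀ r, 0 ≤ r → g r ∈ Icc (0 : ℝ) 1
  le : ∀ κ ∈ P.ext, ∀ r, 0 ≤ r → g r ≤ ℙ.real {y | P.normY (y - κ) < r}

end Program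

/-- `𝖭(n, ε, β)`: the least `N` whose binomial tail is at most `β` (`⊤` if there is none). -/
def sampleBound (n : ℕ) (ε β : ℝ) : ℕ∞ :=
  sInf ((fun N : ℕ => (N : ℕ∞)) ''
    {N | ∑ i ∈ Finset.range n, (N.choose i : ℝ) * ε ^ i * (1 - ε) ^ (N - i) ≤ β})

namespace Program

variable (P : Program X C B Y) (S : Scheme X)

/-- `zₙ = (θ_D (θ_P ϱₙ ‖𝒜‖ + ‖b‖))⁻¹` -/
def zn (n : ℕ) (θD : ℝ) : ℝ := (θD * (S.θP * S.rho n * ‖P.A‖ + ‖P.b‖))⁻¹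

/-- A sufficient number `N` of samples for the precision `ε` with confidence `1 - β`. -/
def EnoughSamples [MeasurableSpace Y] (ℙ : Measure Y) (n : ℕ) (θD ε β : ℝ) (N : ℕ) : Prop :=
  ∃ g, P.IsBallLowerBound ℙ g ∧ sampleBound n (g (P.zn S n θD * ε)) β ≤ N

/-! The smoothing algorithm. -/

/-- The set of `y ∈ K^*` with `‖y‖_* ≤ θ_D`. -/
def ballY (θD : ℝ) : Set Y := {y | y ∈ P.Kstar ∧ P.normY y ≤ θD}

/-- `d` is a prox-function on `ballY θD`: non-negative and strongly convex. -/
def IsProxFun (θD : ℝ) (d : Y → ℝ) : Prop :=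
  (∀ y ∈ P.ballY θD, 0 ≤ d y) ∧ ∃ m > 0, StronglyConvex P.normY (P.ballY θD) m d

/-- `ystar η α` maximizes `⟨b - 𝒜ₙ α, y⟩ - η d(y)` over `ballY θD`. -/
def IsProxMaximizer (n : ℕ) (θD : ℝ) (d : Y → ℝ) (ystar : ℝ → (Fin n → ℝ) → Y) : Prop :=
  ∀ η > 0, ∀ α ∈ S.ballR n, ystar η α ∈ P.ballY θD ∧ ∀ y ∈ P.ballY θD,
    P.pB (P.b - P.An S n α) y - η * d y ≤
      P.pB (P.b - P.An S n α) (ystar η α) - η * d (ystar η α)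

/-- The map `α ↦ 𝒜ₙ^* y_η^*(α)` is Lipschitz with constant `L / η`. -/
def LipschitzGradient (n : ℕ) (ystar : ℝ → (Fin n → ℝ) → Y) (L η : ℝ) : Prop :=
  ∀ α ∈ S.ballR n, ∀ α' ∈ S.ballR n,
    S.normRStar n (P.AnStar S n (ystar η α) - P.AnStar S n (ystar η α')) ≤
      L / η * S.R n (α - α')

end Program

/-- The averaged dual point `ŷ_η` after `k` iterations. -/
def yhat {n : ℕ} (ystar : ℝ → (Fin n → ℝ) → Y) (η : ℝ) (w : ℕ → Fin n → ℝ) (k : ℕ) : Y :=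
  ∑ j ∈ Finset.range (k + 1),
    (2 * ((j : ℝ) + 1) / (((k : ℝ) + 1) * ((k : ℝ) + 2))) • ystar η (w j)

/-- `v = 𝕋(q, a)`: the vector `v` minimizes `qᵀ v + ‖v - a‖_ℜ² / (2ϑ)` over the `θ_P`-ball. -/
def Scheme.IsProxStep (S : Scheme X) (n : ℕ) (ϑ : ℝ) (q a v : Fin n → ℝ) : Prop :=
  v ∈ S.ballR n ∧ ∀ v' ∈ S.ballR n,
    q ⬝ᵥ v + 1 / (2 * ϑ) * S.R n (v - a) ^ 2 ≤ q ⬝ᵥ v' + 1 / (2 * ϑ) * S.R n (v' - a) ^ 2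

namespace Program

variable (P : Program X C B Y) (S : Scheme X)

/-- `r⁽ᵏ⁾ = (η / L) (c - 𝒜ₙ^* y_η^*(w⁽ᵏ⁾))` -/
def stepVec (n : ℕ) (ystar : ℝ → (Fin n → ℝ) → Y) (η L : ℝ) (w : ℕ → Fin n → ℝ) (k : ℕ) :
    Fin n → ℝ :=
  (η / L) • (P.cvec S n - P.AnStar S n (ystar η (w k)))

/-- The sequences `w`, `z`, `α` are generated by the optimal scheme for smooth convex
optimization. -/
structure IsRun (n : ℕ) (ystar : ℝ → (Fin n → ℝ) → Y) (η L ϑ : ℝ) (w z α : ℕ → Fin n → ℝ) :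
    Prop where
  init : w 0 ∈ S.ballR n
  stepZ : ∀ k, S.IsProxStep n ϑ
    (∑ j ∈ Finset.range (k + 1), (((j : ℝ) + 1) / 2) • P.stepVec S n ystar η L w j) 0 (z k)
  stepA : ∀ k, S.IsProxStep n ϑ ((1 / ϑ) • P.stepVec S n ystar η L w k) (w k) (α k)
  stepW : ∀ k : ℕ, w (k + 1) =
    (2 / ((k : ℝ) + 3)) • z k + (((k : ℝ) + 1) / ((k : ℝ) + 3)) • α k

/-- The lower bound `⟨b, y⟩ - θ_P ‖𝒜ₙ^* y - c‖_ℜ*` at a dual point `y`. -/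
def lowerVal (n : ℕ) (y : Y) : ℝ :=
  P.pB P.b y - S.θP * S.normRStar n (P.AnStar S n y - P.cvec S n)

/-- The upper bound `αᵀ c + sup {⟨b - 𝒜ₙ α, y⟩ : y ∈ ballY θD}` at a primal point `α`. -/
def upperVal (n : ℕ) (θD : ℝ) (α : Fin n → ℝ) : ℝ :=
  α ⬝ᵥ P.cvec S n + supportFun (P.ballY θD) (P.pB (P.b - P.An S n α))

end Program

/-- A sufficient choice of the regularization parameter `η` and of the number `k` of iterations
for the precision `ε`, under a logarithmic growth bound on the prox-function at the maximizers. -/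
def Scheme.EnoughIterations (S : Scheme X) (n : ℕ) (d : Y → ℝ)
    (ystar : ℝ → (Fin n → ℝ) → Y) (L ϑ ε η : ℝ) (k : ℕ) : Prop :=
  ∃ c₀ C₀ : ℝ, 0 < c₀ ∧ 0 < C₀ ∧
    (∀ s > 0, ∀ α ∈ S.ballR n, d (ystar s α) ≤ C₀ * max (Real.log (c₀ * s⁻¹)) 1) ∧
    η ≤ ε / (2 * C₀ * max (2 * Real.log (2 * c₀ * C₀ * ε⁻¹)) 1) ∧
    5 * S.θP * √(L / (ϑ * η * ε)) ≤ k

end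

end InfLP

end

/-!
Semi-infinite regularity bounds the multipliers: by Sion's minimax theorem `Jₙ` is the supremum of
the dual function, and a multiplier that is optimal up to a small error has norm at most `θ_D` up to
a small error. Hence the constraint may be replaced by the penalty `θ_D · σ(b - 𝒜ₙ α)`, where `σ` is
the support function of the unit ball of the dual cone, and evaluating the penalized objective at
the projection of `x⋆` gives `Jₙ - J ≤ (‖c‖ + θ_D ‖𝒜‖) ‖r_n‖`. The penalized objective is also what
the upper bound of the smoothing algorithm evaluates; Nesterov's estimate functions bound the
duality gap of the algorithm.

By hypothesis the support function is a supremum over the extreme points, so that the penalty at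
the scenario optimizer `α` is controlled by the tail probability of `y ↦ ⟨b - 𝒜ₙ α, y⟩`, and it
remains to show that `α` violates a random constraint with probability at least `ε` only on an event
whose probability is a binomial tail (Campi and Garatti). Suppose first that the objective is
strictly convex and the constraints are in general position. Then exactly one set of `n` constraints
out of `n + k` independent ones has an optimizer that all others are compatible with; if `u` is the
probability that a random constraint is compatible with `n` given ones, this says
`C(n + k, n) 𝔼[uᵏ] = 1` for all `k`. These moments determine the law of `u`, which is that of the
minimum of `n` uniform variables, and the binomial tail follows. The general case is reached by
regularizing the objective and relaxing each constraint by a random amount: the optimizers converge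
by uniqueness, and the violation probability is semicontinuous.
-/

namespace InfLP

/-! ### Dual norms -/

section DualNorm

variable {V : Type*} [AddCommGroup V] [Module ℝ V] {p : Seminorm ℝ V} {ℓ ℓ' : V →ₗ[ℝ] ℝ}

theorem dualNorm_le {f : V → ℝ} {M : ℝ} (h : ∀ v, p v ≤ 1 → f v ≤ M) : dualNorm p f ≤ M :=
  csSup_le ⟨_, 0, by simp, rfl⟩ (by rintro _ ⟨v, hv, rfl⟩; exact h v hv)

theorem dualNorm_nonneg (hℓ : BddAbove (ℓ '' {v | p v ≤ 1})) : 0 ≤ dualNorm p ℓ :=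
  le_csSup hℓ ⟨0, by simp, map_zero ℓ⟩

theorem apply_le_mul_dualNorm (hℓ : BddAbove (ℓ '' {v | p v ≤ 1})) (v : V) :
    ℓ v ≤ p v * dualNorm p ℓ := by
  have apply_le : ∀ u, p u ≤ 1 → ℓ u ≤ dualNorm p ℓ := fun u hu => le_csSup hℓ ⟨u, hu, rfl⟩
  rcases (apply_nonneg p v).eq_or_lt with hv | hv
  · rw [← hv, zero_mul]
    by_contra! hpos
    have h := apply_le (((dualNorm p ℓ + 1) / ℓ v) • v) (by simp [map_smul_eq_mul, ← hv])
    rw [map_smul, smul_eq_mul, div_mul_cancel₀ _ hpos.ne'] at h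
    linarith
  · have h := apply_le ((p v)⁻¹ • v) (by
      rw [map_smul_eq_mul, Real.norm_of_nonneg (inv_nonneg.2 hv.le), inv_mul_cancel₀ hv.ne'])
    rwa [map_smul, smul_eq_mul, inv_mul_le_iff₀ hv] at h

theorem apply_le_mul_dualNorm_of_le (hℓ : BddAbove (ℓ '' {v | p v ≤ 1})) {v : V} {r : ℝ}
    (hv : p v ≤ r) : ℓ v ≤ r * dualNorm p ℓ :=
  (apply_le_mul_dualNorm hℓ v).trans (mul_le_mul_of_nonneg_right hv (dualNorm_nonneg hℓ))

theorem mul_dualNorm_le {r M : ℝ} (hr : 0 < r) (h : ∀ v, p v ≤ r → ℓ v ≤ M) :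
    r * dualNorm p ℓ ≤ M := by
  rw [← le_div_iff₀' hr]
  refine dualNorm_le fun v hv => ?_
  rw [le_div_iff₀' hr, ← smul_eq_mul, ← map_smul]
  refine h _ ?_
  rw [map_smul_eq_mul, Real.norm_of_nonneg hr.le]
  exact mul_le_of_le_one_right hr.le hv

theorem dualNorm_add_le (hℓ : BddAbove (ℓ '' {v | p v ≤ 1}))
    (hℓ' : BddAbove (ℓ' '' {v | p v ≤ 1})) :
    dualNorm p ⇑(ℓ + ℓ') ≤ dualNorm p ℓ + dualNorm p ℓ' :=
  dualNorm_le fun _ hv => add_le_add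
    ((apply_le_mul_dualNorm_of_le hℓ hv).trans_eq (one_mul _))
    ((apply_le_mul_dualNorm_of_le hℓ' hv).trans_eq (one_mul _))

theorem dualNorm_smul_le (hℓ : BddAbove (ℓ '' {v | p v ≤ 1})) {t : ℝ} (ht : 0 ≤ t) :
    dualNorm p ⇑(t • ℓ) ≤ t * dualNorm p ℓ :=
  dualNorm_le fun _ hv => mul_le_mul_of_nonneg_left
    ((apply_le_mul_dualNorm_of_le hℓ hv).trans_eq (one_mul _)) ht

end DualNorm

section FiniteDimensional

variable {V : Type*} [NormedAddCommGroup V] [NormedSpace ℝ V] [FiniteDimensional ℝ V]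
  {p : Seminorm ℝ V}

theorem continuous_seminorm (p : Seminorm ℝ V) : Continuous p :=
  continuousOn_univ.1 (p.convexOn.continuousOn isOpen_univ)

theorem exists_norm_le_mul_seminorm (hp : ∀ v, p v = 0 → v = 0) :
    ∃ M > 0, ∀ v, ‖v‖ ≤ M * p v := by
  rcases subsingleton_or_nontrivial V with _ | _
  · exact ⟨1, one_pos, fun v => by simp [Subsingleton.elim v 0]⟩
  have : ProperSpace V := FiniteDimensional.proper_real V
  obtain ⟨u, hu, hmin⟩ := (isCompact_sphere (0 : V) 1).exists_isMinOn
    (NormedSpace.sphere_nonempty.2 zero_le_one) (continuous_seminorm p).continuousOn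
  have hpu : 0 < p u := (apply_nonneg p u).lt_of_ne fun h =>
    ne_zero_of_mem_unit_sphere ⟨u, hu⟩ (hp u h.symm)
  refine ⟨(p u)⁻¹, inv_pos.2 hpu, fun v => ?_⟩
  rcases eq_or_ne v 0 with rfl | hv
  · simp
  have h : p u ≤ p (‖v‖⁻¹ • v) := hmin (by simp [norm_smul, norm_ne_zero_iff.2 hv])
  rw [map_smul_eq_mul, norm_inv, norm_norm, ← div_eq_inv_mul,
    le_div_iff₀ (norm_pos_iff.2 hv)] at h
  rwa [le_inv_mul_iff₀ hpu]

theorem isCompact_setOf_seminorm_le (hp : ∀ v, p v = 0 → v = 0) (r : ℝ) :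
    IsCompact {v | p v ≤ r} := by
  have : ProperSpace V := FiniteDimensional.proper_real V
  obtain ⟨M, hM, hle⟩ := exists_norm_le_mul_seminorm hp
  refine Metric.isCompact_of_isClosed_isBounded
    (isClosed_le (continuous_seminorm p) continuous_const) ?_
  refine (Metric.isBounded_closedBall (x := (0 : V)) (r := M * r)).subset fun v hv => ?_
  exact mem_closedBall_zero_iff.2 ((hle v).trans (mul_le_mul_of_nonneg_left hv hM.le))

theorem bddAbove_image_seminorm_le (hp : ∀ v, p v = 0 → v = 0) {f : V → ℝ} (hf : Continuous f)
    (r : ℝ) : BddAbove (f '' {v | p v ≤ r}) :=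
  (isCompact_setOf_seminorm_le hp r).bddAbove_image hf.continuousOn

end FiniteDimensional

section Scheme

variable {X : Type*} {S : Scheme X} {n : ℕ}

theorem Scheme.convex_ballR (S : Scheme X) (n : ℕ) : Convex ℝ (S.ballR n) := by
  simpa [Scheme.ballR] using (S.R n).convexOn.convex_le S.θP

theorem Scheme.mul_normRStar_le (hθ : 0 < S.θP) {v : Fin n → ℝ} {M : ℝ}
    (h : ∀ α ∈ S.ballR n, α ⬝ᵥ v ≤ M) : S.θP * S.normRStar n v ≤ M :=
  mul_dualNorm_le (ℓ := (dotProductBilin ℝ ℝ).flip v) hθ h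

variable (hR : ∀ α, S.R n α = 0 → α = 0)
include hR

theorem Scheme.bddAbove_dotProduct (v : Fin n → ℝ) :
    BddAbove ((dotProductBilin ℝ ℝ).flip v '' {α | S.R n α ≤ 1}) :=
  bddAbove_image_seminorm_le hR (continuous_id.dotProduct continuous_const) 1

theorem Scheme.dotProduct_le (α v : Fin n → ℝ) : α ⬝ᵥ v ≤ S.R n α * S.normRStar n v :=
  apply_le_mul_dualNorm (Scheme.bddAbove_dotProduct hR v) α

theorem Scheme.dotProduct_le_of_mem {α : Fin n → ℝ} (hα : α ∈ S.ballR n) (v : Fin n → ℝ) :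
    α ⬝ᵥ v ≤ S.θP * S.normRStar n v :=
  apply_le_mul_dualNorm_of_le (Scheme.bddAbove_dotProduct hR v) hα

theorem Scheme.normRStar_add_le (u v : Fin n → ℝ) :
    S.normRStar n (u + v) ≤ S.normRStar n u + S.normRStar n v := by
  have h := dualNorm_add_le (Scheme.bddAbove_dotProduct hR u) (Scheme.bddAbove_dotProduct hR v)
  rwa [← map_add] at h

theorem Scheme.isCompact_ballR : IsCompact (S.ballR n) := isCompact_setOf_seminorm_le hR S.θP

theorem Scheme.bddBelow_dotProduct {T : Set (Fin n → ℝ)} (hT : T ⊆ S.ballR n) (v : Fin n → ℝ) :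
    BddBelow ((fun α => α ⬝ᵥ v) '' T) :=
  ((Scheme.isCompact_ballR hR).bddBelow_image
    (continuous_id.dotProduct continuous_const).continuousOn).mono (image_mono hT)

theorem Scheme.sum_abs_le {α : Fin n → ℝ} (hα : α ∈ S.ballR n) (hθ : 0 < S.θP) :
    ∑ i, |α i| ≤ S.θP * S.rho n := by
  have hb : BddAbove ((fun α : Fin n → ℝ => ∑ i, |α i|) '' {α | S.R n α ≤ 1}) :=
    bddAbove_image_seminorm_le hR (by fun_prop) 1
  have hmem : S.R n (S.θP⁻¹ • α) ≤ 1 := by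
    rwa [map_smul_eq_mul, Real.norm_of_nonneg (inv_nonneg.2 hθ.le), inv_mul_le_iff₀ hθ, mul_one]
  have h : ∑ i, |(S.θP⁻¹ • α) i| ≤ S.rho n := le_csSup hb ⟨_, hmem, rfl⟩
  simp only [Pi.smul_apply, smul_eq_mul, abs_mul, abs_of_pos (inv_pos.2 hθ)] at h
  rwa [← Finset.mul_sum, inv_mul_le_iff₀ hθ] at h

end Scheme

section Pairing

variable {X C B Y : Type*} [NormedAddCommGroup X] [NormedSpace ℝ X]
  [AddCommGroup C] [Module ℝ C] [NormedAddCommGroup B] [NormedSpace ℝ B]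
  [AddCommGroup Y] [Module ℝ Y] {P : Program X C B Y} {S : Scheme X} {n : ℕ}

/-- The part of `Program.Standing` on which the error bounds rest: the dual norms that occur are
finite and the cone is weakly closed. -/
structure Program.Admissible (P : Program X C B Y) : Prop where
  boundedX : BddAbove ((fun x => P.pX x P.c) '' {x : X | ‖x‖ ≤ 1})
  boundedB : ∀ y : Y, BddAbove ((fun v => P.pB v y) '' {v : B | ‖v‖ ≤ 1})
  closedCone : IsClosed (X := WeakBilin P.pB) (P.K : Set B)

theorem Program.Standing.admissible (hP : P.Standing) : P.Admissible where
  boundedX := hP.dualPairX.bounded P.c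
  boundedB := hP.dualPairB.bounded
  closedCone := hP.closedCone

namespace Program

theorem Admissible.pX_le (hP : P.Admissible) (x : X) : P.pX x P.c ≤ ‖x‖ * P.normC :=
  apply_le_mul_dualNorm (p := normSeminorm ℝ X) (ℓ := P.pX.flip P.c) hP.boundedX x

theorem Admissible.normC_nonneg (hP : P.Admissible) : 0 ≤ P.normC :=
  dualNorm_nonneg (p := normSeminorm ℝ X) (ℓ := P.pX.flip P.c) hP.boundedX

theorem Admissible.pB_le (hP : P.Admissible) (v : B) (y : Y) : P.pB v y ≤ ‖v‖ * P.normY y :=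
  apply_le_mul_dualNorm (p := normSeminorm ℝ B) (ℓ := P.pB.flip y) (hP.boundedB y) v

theorem Admissible.normY_nonneg (hP : P.Admissible) (y : Y) : 0 ≤ P.normY y :=
  dualNorm_nonneg (p := normSeminorm ℝ B) (ℓ := P.pB.flip y) (hP.boundedB y)

theorem Admissible.normY_add_le (hP : P.Admissible) (y y' : Y) :
    P.normY (y + y') ≤ P.normY y + P.normY y' := by
  have h := dualNorm_add_le (p := normSeminorm ℝ B) (ℓ := P.pB.flip y) (ℓ' := P.pB.flip y')
    (hP.boundedB y) (hP.boundedB y')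
  rwa [← map_add] at h

theorem Admissible.normY_smul_le (hP : P.Admissible) {t : ℝ} (ht : 0 ≤ t) (y : Y) :
    P.normY (t • y) ≤ t * P.normY y := by
  have h := dualNorm_smul_le (p := normSeminorm ℝ B) (ℓ := P.pB.flip y) (hP.boundedB y) ht
  rwa [← map_smul] at h

theorem mem_Kstar {y : Y} : y ∈ P.Kstar ↔ ∀ v ∈ P.K, 0 ≤ P.pB v y :=
  PointedCone.mem_dual

theorem Admissible.zero_mem_ballY (hP : P.Admissible) {θ : ℝ} (hθ : 0 ≤ θ) :
    (0 : Y) ∈ P.ballY θ := by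
  have h := hP.normY_smul_le le_rfl (0 : Y)
  rw [zero_smul, zero_mul] at h
  exact ⟨P.Kstar.zero_mem, h.trans hθ⟩

theorem Admissible.convex_ballY (hP : P.Admissible) (θ : ℝ) : Convex ℝ (P.ballY θ) := by
  rintro y ⟨hy, hyθ⟩ z ⟨hz, hzθ⟩ s t hs ht hst
  refine ⟨P.Kstar.add_mem (P.Kstar.smul_mem hs hy) (P.Kstar.smul_mem ht hz), ?_⟩
  calc P.normY (s • y + t • z)
      ≤ P.normY (s • y) + P.normY (t • z) := hP.normY_add_le _ _
    _ ≤ s * P.normY y + t * P.normY z :=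
        add_le_add (hP.normY_smul_le hs y) (hP.normY_smul_le ht z)
    _ ≤ s * θ + t * θ := by gcongr
    _ = θ := by rw [← add_mul, hst, one_mul]

theorem Admissible.bddAbove_pB_ballY (hP : P.Admissible) (θ : ℝ) (v : B) :
    BddAbove (P.pB v '' P.ballY θ) := by
  refine ⟨‖v‖ * θ, ?_⟩
  rintro _ ⟨y, hy, rfl⟩
  exact (hP.pB_le v y).trans (mul_le_mul_of_nonneg_left hy.2 (norm_nonneg v))

theorem Admissible.pB_le_supportFun_ballY (hP : P.Admissible) {θ : ℝ} (v : B) {y : Y}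
    (hy : y ∈ P.ballY θ) : P.pB v y ≤ supportFun (P.ballY θ) (P.pB v) :=
  le_csSup (hP.bddAbove_pB_ballY θ v) ⟨y, hy, rfl⟩

theorem Admissible.supportFun_ballY_le (hP : P.Admissible) {θ M : ℝ} (hθ : 0 ≤ θ) {v : B}
    (h : ∀ y ∈ P.ballY θ, P.pB v y ≤ M) : supportFun (P.ballY θ) (P.pB v) ≤ M :=
  csSup_le ⟨_, 0, hP.zero_mem_ballY hθ, rfl⟩ (by rintro _ ⟨y, hy, rfl⟩; exact h y hy)

theorem Admissible.pB_le_supportFun_ballY_add (hP : P.Admissible) {θ δ : ℝ} (hθ : 0 ≤ θ)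
    (hδ : 0 ≤ δ) (v : B) {y : Y} (hy : y ∈ P.Kstar) (hyθ : P.normY y ≤ θ + δ) :
    P.pB v y ≤ supportFun (P.ballY θ) (P.pB v) + ‖v‖ * δ := by
  rcases le_or_gt (P.normY y) θ with hle | hlt
  · exact le_add_of_le_of_nonneg (hP.pB_le_supportFun_ballY v ⟨hy, hle⟩) (by positivity)
  have hpos : 0 < P.normY y := hθ.trans_lt hlt
  set t := θ / P.normY y
  have htθ : t * P.normY y = θ := div_mul_cancel₀ _ hpos.ne'
  have ht : 0 ≤ t := by positivity
  have ht1 : t ≤ 1 := (div_le_one hpos).2 hlt.le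
  have hscaled : t • y ∈ P.ballY θ :=
    ⟨P.Kstar.smul_mem ht hy, (hP.normY_smul_le ht y).trans_eq htθ⟩
  calc P.pB v y
      = P.pB v (t • y) + (1 - t) * P.pB v y := by rw [map_smul, smul_eq_mul]; ring
    _ ≤ supportFun (P.ballY θ) (P.pB v) + (1 - t) * (‖v‖ * P.normY y) :=
        add_le_add (hP.pB_le_supportFun_ballY v hscaled)
          (mul_le_mul_of_nonneg_left (hP.pB_le v y) (sub_nonneg.2 ht1))
    _ = supportFun (P.ballY θ) (P.pB v) + ‖v‖ * (P.normY y - θ) := by rw [← htθ]; ring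
    _ ≤ supportFun (P.ballY θ) (P.pB v) + ‖v‖ * δ := by gcongr; linarith

theorem pB_An (α : Fin n → ℝ) (y : Y) : P.pB (P.An S n α) y = α ⬝ᵥ P.AnStar S n y := by
  simp [An, AnStar, dotProduct]

theorem pX_sum (α : Fin n → ℝ) : P.pX (∑ i, α i • S.x i) P.c = α ⬝ᵥ P.cvec S n := by
  simp [cvec, dotProduct]

theorem An_eq_map_sum (α : Fin n → ℝ) : P.An S n α = P.A (∑ i, α i • S.x i) := by
  simp [An]

theorem norm_An_le (hS : ∀ i < n, ‖S.x i‖ ≤ 1) (α : Fin n → ℝ) :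
    ‖P.An S n α‖ ≤ ‖P.A‖ * ∑ i, |α i| := by
  rw [An, Finset.mul_sum]
  refine (norm_sum_le _ _).trans (Finset.sum_le_sum fun i _ => ?_)
  rw [norm_smul, Real.norm_eq_abs, mul_comm]
  exact mul_le_mul_of_nonneg_right (P.A.unit_le_opNorm _ (hS i i.2)) (abs_nonneg _)

theorem norm_b_sub_An_le (hR : ∀ α, S.R n α = 0 → α = 0) (hS : ∀ i < n, ‖S.x i‖ ≤ 1)
    (hθ : 0 < S.θP) {α : Fin n → ℝ} (hα : α ∈ S.ballR n) :
    ‖P.b - P.An S n α‖ ≤ S.θP * S.rho n * ‖P.A‖ + ‖P.b‖ :=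
  calc ‖P.b - P.An S n α‖ ≤ ‖P.b‖ + ‖P.An S n α‖ := norm_sub_le _ _
    _ ≤ ‖P.b‖ + ‖P.A‖ * (S.θP * S.rho n) := by
        gcongr
        exact (norm_An_le hS α).trans
          (mul_le_mul_of_nonneg_left (Scheme.sum_abs_le hR hα hθ) (norm_nonneg _))
    _ = S.θP * S.rho n * ‖P.A‖ + ‖P.b‖ := by ring

/-- The bipolar theorem, through the weak Hahn–Banach separation of a point from `K`. -/
theorem exists_mem_Kstar_pB_neg (hK : IsClosed (X := WeakBilin P.pB) (P.K : Set B)) {v : B}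
    (hv : v ∉ P.K) : ∃ y ∈ P.Kstar, P.pB v y < 0 := by
  have hconv : Convex ℝ (E := WeakBilin P.pB) (P.K : Set B) := P.K.convex
  obtain ⟨f, u, hfu, hf⟩ :=
    geometric_hahn_banach_point_closed (E := WeakBilin P.pB) (x := v) hconv hK hv
  obtain ⟨y, rfl⟩ := LinearMap.dualEmbedding_surjective P.pB f
  have hvu : P.pB v y < u := hfu
  have hKu : ∀ w ∈ P.K, u < P.pB w y := hf
  have hu : u < 0 := by simpa using hKu 0 P.K.zero_mem
  refine ⟨y, mem_Kstar.2 fun w hw => ?_, hvu.trans hu⟩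
  by_contra! hneg
  have h := hKu ((u / P.pB w y) • w) (P.K.smul_mem (div_pos_of_neg_of_neg hu hneg).le hw)
  rw [map_smul, LinearMap.smul_apply, smul_eq_mul, div_mul_cancel₀ _ hneg.ne] at h
  exact lt_irrefl _ h

end Program

end Pairing

/-! ### Duality of the semi-infinite program -/

section Duality

variable {X C B Y : Type*} [NormedAddCommGroup X] [NormedSpace ℝ X]
  [AddCommGroup C] [Module ℝ C] [NormedAddCommGroup B] [NormedSpace ℝ B]
  [AddCommGroup Y] [Module ℝ Y] {P : Program X C B Y} {S : Scheme X} {n : ℕ}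

namespace Program

/-- The Lagrangian `L(α, y) = αᵀ c + ⟨b - 𝒜ₙ α, y⟩` of the semi-infinite program. -/
noncomputable def lagrangian (P : Program X C B Y) (S : Scheme X) (n : ℕ) (α : Fin n → ℝ)
    (y : Y) : ℝ :=
  α ⬝ᵥ P.cvec S n + P.pB (P.b - P.An S n α) y

theorem lagrangian_eq (α : Fin n → ℝ) (y : Y) :
    P.lagrangian S n α y = P.pB P.b y - α ⬝ᵥ (P.AnStar S n y - P.cvec S n) := by
  rw [lagrangian, map_sub, LinearMap.sub_apply, pB_An, dotProduct_sub]
  ring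

theorem lagrangian_affine_left (u v : Fin n → ℝ) (y : Y) {s t : ℝ} (hst : s + t = 1) :
    P.lagrangian S n (s • u + t • v) y =
      s * P.lagrangian S n u y + t * P.lagrangian S n v y := by
  simp only [lagrangian_eq, add_dotProduct, smul_dotProduct, smul_eq_mul]
  linear_combination -P.pB P.b y * hst

theorem lagrangian_affine_right (α : Fin n → ℝ) (u v : Y) {s t : ℝ} (hst : s + t = 1) :
    P.lagrangian S n α (s • u + t • v) =
      s * P.lagrangian S n α u + t * P.lagrangian S n α v := by
  simp only [lagrangian, map_add, map_smul, smul_eq_mul]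
  linear_combination -(α ⬝ᵥ P.cvec S n) * hst

theorem continuous_lagrangian (y : Y) : Continuous fun α => P.lagrangian S n α y := by
  simp only [lagrangian_eq]
  exact continuous_const.sub (continuous_id.dotProduct continuous_const)

theorem le_lowerVal (hθ : 0 < S.θP) {M : ℝ} {y : Y}
    (h : ∀ α ∈ S.ballR n, M ≤ P.lagrangian S n α y) : M ≤ P.lowerVal S n y := by
  have hle : S.θP * S.normRStar n (P.AnStar S n y - P.cvec S n) ≤ P.pB P.b y - M :=
    Scheme.mul_normRStar_le hθ fun α hα => le_sub_comm.1 ((h α hα).trans_eq (lagrangian_eq α y))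
  exact le_sub_comm.1 hle

theorem Regular.θP_pos {γ : ℝ} (hreg : P.Regular S n γ) : 0 < S.θP :=
  pos_of_mul_pos_right ((norm_nonneg _).trans_lt hreg.large) hreg.pos.le

section Definite

variable (hR : ∀ α, S.R n α = 0 → α = 0)
include hR

theorem Jn_le {α : Fin n → ℝ} (hα : α ∈ P.feasN S n) : P.Jn S n ≤ α ⬝ᵥ P.cvec S n :=
  csInf_le (Scheme.bddBelow_dotProduct hR (fun _ h => h.2) _) ⟨α, hα, rfl⟩

theorem lowerVal_le_lagrangian {α : Fin n → ℝ} (hα : α ∈ S.ballR n) (y : Y) :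
    P.lowerVal S n y ≤ P.lagrangian S n α y := by
  rw [lagrangian_eq, lowerVal]
  exact sub_le_sub_left (Scheme.dotProduct_le_of_mem hR hα _) _

theorem lowerVal_le_Jn (hf : (P.feasN S n).Nonempty) {y : Y} (hy : y ∈ P.Kstar) :
    P.lowerVal S n y ≤ P.Jn S n := by
  refine le_csInf (hf.image _) ?_
  rintro _ ⟨α, hα, rfl⟩
  have hslack : 0 ≤ P.pB (P.An S n α - P.b) y := mem_Kstar.1 hy _ hα.1
  calc P.lowerVal S n y ≤ P.lagrangian S n α y := lowerVal_le_lagrangian hR hα.2 y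
    _ = α ⬝ᵥ P.cvec S n - P.pB (P.An S n α - P.b) y := by
        simp only [lagrangian, map_sub, LinearMap.sub_apply]; ring
    _ ≤ α ⬝ᵥ P.cvec S n := sub_le_self _ hslack

theorem exists_lt_lagrangian (hK : IsClosed (X := WeakBilin P.pB) (P.K : Set B)) {M : ℝ}
    (hM : M < P.Jn S n) {α : Fin n → ℝ} (hα : α ∈ S.ballR n) :
    ∃ y ∈ P.Kstar, M < P.lagrangian S n α y := by
  by_cases hfeas : P.An S n α - P.b ∈ P.K
  · refine ⟨0, P.Kstar.zero_mem, ?_⟩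
    rw [lagrangian, map_zero, add_zero]
    exact hM.trans_le (Jn_le hR ⟨hfeas, hα⟩)
  · obtain ⟨y, hy, hneg⟩ := exists_mem_Kstar_pB_neg hK hfeas
    have hpos : 0 < P.pB (P.b - P.An S n α) y := by
      rwa [← neg_sub, map_neg, LinearMap.neg_apply, neg_pos]
    obtain ⟨t, ht⟩ := exists_nat_gt ((M - α ⬝ᵥ P.cvec S n) / P.pB (P.b - P.An S n α) y)
    refine ⟨(t : ℝ) • y, P.Kstar.smul_mem (Nat.cast_nonneg t) hy, ?_⟩
    rw [lagrangian, map_smul, smul_eq_mul]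
    exact sub_lt_iff_lt_add'.1 ((div_lt_iff₀ hpos).1 ht)

/-- Sion's theorem is applied over a finite set of multipliers, which suffices by compactness of
the ball. -/
theorem exists_forall_lt_lagrangian (hK : IsClosed (X := WeakBilin P.pB) (P.K : Set B))
    (hf : (P.feasN S n).Nonempty) {M : ℝ} (hM : M < P.Jn S n) :
    ∃ y ∈ P.Kstar, ∀ α ∈ S.ballR n, M < P.lagrangian S n α y := by
  obtain ⟨s, hsK, hsfin, hs⟩ := (Scheme.isCompact_ballR hR).elim_finite_subcover_image
    (b := (P.Kstar : Set Y)) (c := fun y => {α | M < P.lagrangian S n α y})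
    (fun y _ => isOpen_lt continuous_const (continuous_lagrangian y))
    (fun α hα => by
      obtain ⟨y, hy, h⟩ := exists_lt_lagrangian hR hK hM hα
      exact mem_biUnion hy h)
  have hconv : Convex ℝ (E := WeakBilin P.pB.flip) (P.Kstar : Set Y) := P.Kstar.convex
  refine Sion.exists_lt_iInf_of_lt_iInf_of_finite (F := WeakBilin P.pB.flip) (s := s)
    (f := fun α y => P.lagrangian S n α y) (hf.mono fun _ h => h.2) (Scheme.isCompact_ballR hR)
    (fun y _ => (continuous_lagrangian y).lowerSemicontinuous.lowerSemicontinuousOn _)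
    (fun y _ => ConvexOn.quasiconvexOn ⟨S.convex_ballR n, fun u _ v _ _ _ _ _ hst =>
      (lagrangian_affine_left u v y hst).le⟩)
    hconv (fun α _ => ?_)
    (fun α _ => ConcaveOn.quasiconcaveOn ⟨hconv, fun u _ v _ _ _ _ _ hst =>
      (lagrangian_affine_right α u v hst).ge⟩)
    (S.convex_ballR n) hsfin hsK (fun α hα => by
      obtain ⟨y, hy, h⟩ := mem_iUnion₂.1 (hs hα)
      exact ⟨y, hy, h⟩)
  have heval : Continuous fun y : WeakBilin P.pB.flip => P.pB.flip y (P.b - P.An S n α) :=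
    WeakBilin.eval_continuous P.pB.flip _
  exact (continuous_const.add heval).upperSemicontinuous.upperSemicontinuousOn _

variable {γ JLB : ℝ}

theorem Regular.θD_nonneg (hreg : P.Regular S n γ) (hJ : JLB ≤ P.Jn S n) :
    0 ≤ P.θD S n γ JLB := by
  obtain ⟨α, hα⟩ := hreg.feasible
  have hle : JLB ≤ S.θP * S.normRStar n (P.cvec S n) :=
    hJ.trans ((Jn_le hR hα).trans (Scheme.dotProduct_le_of_mem hR hα.2 _))
  exact div_nonneg (sub_nonneg.2 hle) (sub_nonneg.2 hreg.large.le)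

theorem Regular.mul_normY_le (hreg : P.Regular S n γ) (hP : P.Admissible) {y : Y}
    (hy : y ∈ P.Kstar) {M : ℝ} (hM : M ≤ P.lowerVal S n y) :
    (γ * S.θP - ‖P.b‖) * P.normY y ≤ S.θP * S.normRStar n (P.cvec S n) - M := by
  have hnorm : γ * P.normY y ≤
      S.normRStar n (P.AnStar S n y - P.cvec S n) + S.normRStar n (P.cvec S n) :=
    calc γ * P.normY y ≤ S.normRStar n (P.AnStar S n y) := hreg.infSup y hy
      _ = S.normRStar n (P.AnStar S n y - P.cvec S n + P.cvec S n) := by rw [sub_add_cancel]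
      _ ≤ _ := Scheme.normRStar_add_le hR _ _
  rw [lowerVal] at hM
  linarith [mul_le_mul_of_nonneg_left hnorm hreg.θP_pos.le, hP.pB_le P.b y]

/-- An almost optimal multiplier has norm at most `θD` up to a small error, so that the conic
constraint can be replaced by an exact penalty. -/
theorem Regular.Jn_le_upperVal (hreg : P.Regular S n γ) (hP : P.Admissible)
    (hJ : JLB ≤ P.Jn S n) {α : Fin n → ℝ} (hα : α ∈ S.ballR n) :
    P.Jn S n ≤ P.upperVal S n (P.θD S n γ JLB) α := by
  have hgap : 0 < γ * S.θP - ‖P.b‖ := sub_pos.2 hreg.large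
  have hθ := hreg.θD_nonneg hR hJ
  have hgap_mul : (γ * S.θP - ‖P.b‖) * P.θD S n γ JLB =
      S.θP * S.normRStar n (P.cvec S n) - JLB := mul_div_cancel₀ _ hgap.ne'
  have approx : ∀ δ > 0, P.Jn S n ≤ P.upperVal S n (P.θD S n γ JLB) α +
      δ * (γ * S.θP - ‖P.b‖ + ‖P.b - P.An S n α‖) := by
    intro δ hδ
    obtain ⟨y, hyK, hy⟩ := exists_forall_lt_lagrangian hR hP.closedCone hreg.feasible
      (sub_lt_self (P.Jn S n) (mul_pos hδ hgap))
    have hnorm : P.normY y ≤ P.θD S n γ JLB + δ := by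
      refine le_of_mul_le_mul_left ?_ hgap
      linarith [hreg.mul_normY_le hR hP hyK (le_lowerVal hreg.θP_pos fun α hα => (hy α hα).le)]
    have hpair := hP.pB_le_supportFun_ballY_add hθ hδ.le (P.b - P.An S n α) hyK hnorm
    have hlag := hy α hα
    rw [lagrangian] at hlag
    rw [upperVal]
    linarith
  have hpos : 0 < γ * S.θP - ‖P.b‖ + ‖P.b - P.An S n α‖ := by positivity
  refine le_of_forall_pos_le_add fun ε hε => ?_
  simpa only [div_mul_cancel₀ ε hpos.ne'] using approx _ (div_pos hε hpos)

end Definite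

theorem IsOptimizer.J_eq {x : X} (hx : P.IsOptimizer x) : P.J = P.pX x P.c :=
  IsLeast.csInf_eq ⟨⟨x, hx.1, rfl⟩, by rintro _ ⟨x', hx', rfl⟩; exact hx.2 x' hx'⟩

theorem IsOptimizer.J_le_Jn {x : X} (hx : P.IsOptimizer x) (hf : (P.feasN S n).Nonempty) :
    P.J ≤ P.Jn S n := by
  refine le_csInf (hf.image _) ?_
  rintro _ ⟨α, ⟨hα, -⟩, rfl⟩
  rw [An_eq_map_sum] at hα
  simpa only [hx.J_eq, pX_sum] using hx.2 _ hα

theorem IsOptimizer.supportFun_ballY_le {x : X} (hx : P.IsOptimizer x) (hP : P.Admissible)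
    {θ : ℝ} (hθ : 0 ≤ θ) (z : X) :
    supportFun (P.ballY θ) (P.pB (P.b - P.A z)) ≤ θ * ‖P.A‖ * ‖x - z‖ := by
  refine hP.supportFun_ballY_le hθ fun y hy => ?_
  have hslack : 0 ≤ P.pB (P.A x - P.b) y := mem_Kstar.1 hy.1 _ hx.1
  calc P.pB (P.b - P.A z) y = P.pB (P.A (x - z)) y - P.pB (P.A x - P.b) y := by
        simp only [map_sub, LinearMap.sub_apply]; ring
    _ ≤ ‖P.A (x - z)‖ * P.normY y := (sub_le_self _ hslack).trans (hP.pB_le _ y)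
    _ ≤ ‖P.A‖ * ‖x - z‖ * θ :=
        mul_le_mul (P.A.le_opNorm _) hy.2 (hP.normY_nonneg y) (by positivity)
    _ = θ * ‖P.A‖ * ‖x - z‖ := by ring

theorem Regular.Jn_sub_le_J (hR : ∀ α, S.R n α = 0 → α = 0) {γ JLB : ℝ}
    (hreg : P.Regular S n γ) (hP : P.Admissible) (hJ : JLB ≤ P.Jn S n) {x z : X} {r : ℝ}
    (hx : P.IsOptimizer x) (hz : z ∈ S.ballX n) (hr : ‖x - z‖ ≤ r) :
    P.Jn S n - (P.normC + P.θD S n γ JLB * ‖P.A‖) * r ≤ P.J := by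
  have hθD := hreg.θD_nonneg hR hJ
  obtain ⟨α, hα, rfl⟩ := hz
  set z := ∑ i, α i • S.x i with hz
  have hpenalty := hreg.Jn_le_upperVal hR hP hJ hα
  rw [upperVal, ← pX_sum, An_eq_map_sum, ← hz] at hpenalty
  have hcost : P.pX z P.c - P.J ≤ ‖x - z‖ * P.normC := by
    rw [hx.J_eq, ← LinearMap.sub_apply, ← map_sub, norm_sub_rev]
    exact hP.pX_le _
  have hresidual : (P.normC + P.θD S n γ JLB * ‖P.A‖) * ‖x - z‖ ≤
      (P.normC + P.θD S n γ JLB * ‖P.A‖) * r :=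
    mul_le_mul_of_nonneg_left hr (add_nonneg hP.normC_nonneg (mul_nonneg hθD (norm_nonneg _)))
  linarith [hx.supportFun_ballY_le hP hθD z]

end Program

end Duality

/-! ### The optimal first-order scheme -/

section FirstOrderMethod

open Filter Topology

/-- The increments of `H` over `N + 1` equal pieces of `[a, b]` add up to at most
`(b - a) / (N + 1) * (ω b - ω a)`. -/
theorem le_of_forall_sub_le_mul_sub {H ω : ℝ → ℝ} {a b : ℝ} (hab : a ≤ b)
    (h : ∀ s t, a ≤ s → s ≤ t → t ≤ b → H t - H s ≤ (t - s) * (ω t - ω s)) : H b ≤ H a := by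
  have hpartition : ∀ N : ℕ, H b ≤ H a + (b - a) * (ω b - ω a) * (1 / ((N : ℝ) + 1)) := by
    intro N
    set δ := (b - a) / ((N : ℝ) + 1) with hδ
    have hδ_nonneg : 0 ≤ δ := div_nonneg (sub_nonneg.2 hab) (by positivity)
    have hδ_mul : ((N : ℝ) + 1) * δ = b - a := by rw [hδ]; field_simp
    have hpartial : ∀ i : ℕ, i ≤ N + 1 → H (a + i * δ) ≤ H a + δ * (ω (a + i * δ) - ω a) := by
      intro i hi
      induction i with
      | zero => simp
      | succ i ih =>
        have hi' : ((i : ℝ) + 1) * δ ≤ (N + 1) * δ := by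
          gcongr
          exact_mod_cast Nat.le_of_succ_le_succ hi
        have hle := h (a + i * δ) (a + (i + 1 : ℕ) * δ)
          (le_add_of_nonneg_right (by positivity)) (by push_cast; linarith)
          (by push_cast; linarith)
        rw [show a + (i + 1 : ℕ) * δ - (a + i * δ) = δ by push_cast; ring] at hle
        linarith [ih (Nat.le_of_succ_le hi)]
    have hlast := hpartial (N + 1) le_rfl
    rw [Nat.cast_add_one, hδ_mul, add_sub_cancel] at hlast
    exact hlast.trans_eq (by rw [hδ]; ring)
  have hlim := ((tendsto_one_div_add_atTop_nhds_zero_nat (𝕜 := ℝ)).const_mul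
    ((b - a) * (ω b - ω a))).const_add (H a)
  rw [mul_zero, add_zero] at hlim
  exact ge_of_tendsto' hlim hpartition

variable {E : Type*} [AddCommGroup E] [Module ℝ E]

section StronglyConvex

theorem StronglyConvex.const_mul_add {ν : E → ℝ} {m : ℝ} {f : E → ℝ}
    (hf : StronglyConvex ν univ m f) {c : ℝ} (hc : 0 ≤ c) (ℓ : E →ₗ[ℝ] ℝ) (r : ℝ) (K : Set E) :
    StronglyConvex ν K (c * m) fun x => c * f x + (ℓ x + r) := by
  intro u _ v _ s t hs ht hst
  have h := mul_le_mul_of_nonneg_left (hf u (mem_univ u) v (mem_univ v) s t hs ht hst) hc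
  simp only [map_add, map_smul, smul_eq_mul]
  linear_combination h - r * hst

theorem StronglyConvex.add_le_of_isMinOn {ν : E → ℝ} {K : Set E} {m : ℝ} {f : E → ℝ}
    (hf : StronglyConvex ν K m f) (hK : Convex ℝ K) {x z : E} (hx : x ∈ K) (hz : z ∈ K)
    (hmin : IsMinOn f K z) : f z + m / 2 * ν (x - z) ^ 2 ≤ f x := by
  have hsegment : ∀ t ∈ Ioo (0 : ℝ) 1, f z + m / 2 * (1 - t) * ν (x - z) ^ 2 ≤ f x := by
    rintro t ⟨ht0, ht1⟩
    have ht1' : 0 ≤ 1 - t := sub_nonneg.2 ht1.le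
    have hle := (hmin (hK hx hz ht0.le ht1' (by ring))).trans
      (hf x hx z hz t (1 - t) ht0.le ht1' (by ring))
    refine le_of_mul_le_mul_left ?_ ht0
    linarith
  have hlim : Tendsto (fun t : ℝ => f z + m / 2 * (1 - t) * ν (x - z) ^ 2) (𝓝[>] 0)
      (𝓝 (f z + m / 2 * (1 - 0) * ν (x - z) ^ 2)) :=
    ((by fun_prop : Continuous fun t : ℝ => f z + m / 2 * (1 - t) * ν (x - z) ^ 2).tendsto
      0).mono_left nhdsWithin_le_nhds
  rw [sub_zero, mul_one] at hlim
  exact le_of_tendsto hlim (mem_of_superset (Ioo_mem_nhdsGT one_pos) hsegment)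

theorem StronglyConvex.le_one_of_sq_seminorm {p : Seminorm ℝ E} {ϑ : ℝ}
    (h : StronglyConvex p univ ϑ fun x => p x ^ 2 / 2) {u : E} (hu : p u ≠ 0) : ϑ ≤ 1 := by
  have hmid := h u (mem_univ u) 0 (mem_univ 0) (1 / 2) (1 / 2) (by norm_num) (by norm_num)
    (by norm_num)
  simp only [smul_zero, add_zero, sub_zero, map_smul_eq_mul, map_zero,
    Real.norm_of_nonneg (one_half_pos (α := ℝ)).le] at hmid
  have hsq : 0 < p u ^ 2 := by positivity
  nlinarith

end StronglyConvex

/-- `g` selects subgradients of `φ` on `K`, with Lipschitz constant `M` for the dual norm of the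
seminorm `p`. The dual norm is not formed: its bound is spelled out against every direction. -/
structure IsLipschitzSubgradient (p : Seminorm ℝ E) (K : Set E) (φ : E → ℝ)
    (g : E → E →ₗ[ℝ] ℝ) (M : ℝ) : Prop where
  subgradient : ∀ u ∈ K, ∀ v ∈ K, φ v + g v (u - v) ≤ φ u
  lipschitz : ∀ u ∈ K, ∀ v ∈ K, ∀ x, g u x - g v x ≤ M * p (u - v) * p x

/-- `v` is a proximal point: it minimizes `ℓ + m / 2 * p (· - a) ^ 2` over `K`. -/
def IsProxPoint (p : Seminorm ℝ E) (K : Set E) (m : ℝ) (ℓ : E →ₗ[ℝ] ℝ) (a v : E) : Prop :=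
  v ∈ K ∧ IsMinOn (fun v => ℓ v + m / 2 * p (v - a) ^ 2) K v

/-- The iterates of Nesterov's optimal scheme for a gradient map `g` with Lipschitz constant `M`,
where `p ^ 2 / 2` has the strong convexity parameter `ϑ`. -/
structure IsOptimalScheme (p : Seminorm ℝ E) (K : Set E) (g : E → E →ₗ[ℝ] ℝ) (M ϑ : ℝ)
    (w z a : ℕ → E) : Prop where
  init : w 0 ∈ K
  aggregate : ∀ k, IsProxPoint p K (M / ϑ)
    (∑ j ∈ Finset.range (k + 1), (((j : ℝ) + 1) / 2) • g (w j)) 0 (z k)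
  descend : ∀ k, IsProxPoint p K M (g (w k)) (w k) (a k)
  average : ∀ k : ℕ, w (k + 1) =
    (2 / ((k : ℝ) + 3)) • z k + (((k : ℝ) + 1) / ((k : ℝ) + 3)) • a k

/-- The estimate function of the optimal scheme: the squared seminorm plus a weighted sum of the
linear minorants of `φ` found so far. -/
noncomputable def estimate (p : Seminorm ℝ E) (φ : E → ℝ) (g : E → E →ₗ[ℝ] ℝ) (m : ℝ)
    (w : ℕ → E) (k : ℕ) (x : E) : ℝ :=
  m / 2 * p x ^ 2 +
    ∑ j ∈ Finset.range (k + 1), ((j : ℝ) + 1) / 2 * (φ (w j) + g (w j) (x - w j))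

variable {p : Seminorm ℝ E} {K : Set E} {φ : E → ℝ} {g : E → E →ₗ[ℝ] ℝ} {M ϑ : ℝ}

theorem IsLipschitzSubgradient.descent (hg : IsLipschitzSubgradient p K φ g M)
    (hK : Convex ℝ K) {u v : E} (hu : u ∈ K) (hv : v ∈ K) :
    φ v ≤ φ u + g u (v - u) + M / 2 * p (v - u) ^ 2 := by
  have hmem : ∀ r ∈ Icc (0 : ℝ) 1, u + r • (v - u) ∈ K := fun r hr =>
    hK.add_smul_sub_mem hu hv hr
  have hsegment := le_of_forall_sub_le_mul_sub zero_le_one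
    (H := fun t => φ (u + t • (v - u)) - t * g u (v - u) - t ^ 2 * (M / 2 * p (v - u) ^ 2))
    (ω := fun t => t * (M / 2 * p (v - u) ^ 2)) fun s t hs hst ht => by
      have hsub := hg.subgradient _ (hmem s ⟨hs, hst.trans ht⟩) _ (hmem t ⟨hs.trans hst, ht⟩)
      have hlip := hg.lipschitz _ (hmem t ⟨hs.trans hst, ht⟩) u hu (v - u)
      rw [add_sub_add_left_eq_sub, ← sub_smul, map_smul, smul_eq_mul] at hsub
      rw [add_sub_cancel_left, map_smul_eq_mul, Real.norm_of_nonneg (hs.trans hst)] at hlip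
      linarith [mul_le_mul_of_nonneg_left hlip (sub_nonneg.2 hst)]
  simp only [one_smul, add_sub_cancel, zero_smul, add_zero] at hsegment
  linarith

theorem IsLipschitzSubgradient.le_of_isProxPoint (hg : IsLipschitzSubgradient p K φ g M)
    (hK : Convex ℝ K) {u a x : E} (hu : u ∈ K) (ha : IsProxPoint p K M (g u) u a) (hx : x ∈ K) :
    φ a ≤ φ u + g u (x - u) + M / 2 * p (x - u) ^ 2 := by
  have hmin : g u a + M / 2 * p (a - u) ^ 2 ≤ g u x + M / 2 * p (x - u) ^ 2 := ha.2 hx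
  have hdescent := hg.descent hK hu ha.1
  rw [map_sub] at hdescent ⊢
  linarith

namespace IsOptimalScheme

variable {w z a : ℕ → E}

theorem mem (hrun : IsOptimalScheme p K g M ϑ w z a) (hK : Convex ℝ K) : ∀ k, w k ∈ K
  | 0 => hrun.init
  | k + 1 => by
    rw [hrun.average]
    refine hK (hrun.aggregate k).1 (hrun.descend k).1 (by positivity) (by positivity) ?_
    field_simp
    ring

theorem estimate_add_le (hrun : IsOptimalScheme p K g M ϑ w z a) (hK : Convex ℝ K)
    (hM : 0 ≤ M) (hϑ : 0 < ϑ) (hconv : StronglyConvex p univ ϑ fun x => p x ^ 2 / 2) (φ : E → ℝ)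
    (k : ℕ) {x : E} (hx : x ∈ K) :
    estimate p φ g (M / ϑ) w k (z k) + M / 2 * p (x - z k) ^ 2 ≤
      estimate p φ g (M / ϑ) w k x := by
  set ℓ := ∑ j ∈ Finset.range (k + 1), (((j : ℝ) + 1) / 2) • g (w j) with hℓ
  set r := ∑ j ∈ Finset.range (k + 1), ((j : ℝ) + 1) / 2 * (φ (w j) - g (w j) (w j)) with hr
  have hestimate : estimate p φ g (M / ϑ) w k =
      fun x => M / ϑ * (p x ^ 2 / 2) + (ℓ x + r) := by
    funext x
    simp only [estimate, hℓ, hr, LinearMap.sum_apply, LinearMap.smul_apply, smul_eq_mul,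
      ← Finset.sum_add_distrib, map_sub]
    congr 1
    · ring
    · exact Finset.sum_congr rfl fun j _ => by ring
  have hstrong := hconv.const_mul_add (div_nonneg hM hϑ.le) ℓ r K
  rw [div_mul_cancel₀ M hϑ.ne'] at hstrong
  rw [hestimate]
  refine hstrong.add_le_of_isMinOn hK hx (hrun.aggregate k).1 fun v hv => ?_
  have hmin : ℓ (z k) + M / ϑ / 2 * p (z k - 0) ^ 2 ≤ ℓ v + M / ϑ / 2 * p (v - 0) ^ 2 :=
    (hrun.aggregate k).2 hv
  rw [sub_zero, sub_zero] at hmin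
  change M / ϑ * (p (z k) ^ 2 / 2) + (ℓ (z k) + r) ≤ M / ϑ * (p v ^ 2 / 2) + (ℓ v + r)
  linarith

theorem le_estimate_zero (hrun : IsOptimalScheme p K g M ϑ w z a)
    (hg : IsLipschitzSubgradient p K φ g M) (hK : Convex ℝ K) (hM : 0 ≤ M) (hϑ : 0 < ϑ)
    (hϑ1 : ϑ ≤ 1) {x : E} (hx : x ∈ K) :
    1 / 2 * φ (a 0) ≤ estimate p φ g (M / ϑ) w 0 x + M / 2 * p (w 0) ^ 2 := by
  have hle := hg.le_of_isProxPoint hK hrun.init (hrun.descend 0) hx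
  have hsq : p (x - w 0) ^ 2 ≤ 2 * p x ^ 2 + 2 * p (w 0) ^ 2 :=
    calc p (x - w 0) ^ 2 ≤ (p x + p (w 0)) ^ 2 :=
          pow_le_pow_left₀ (apply_nonneg p _) (map_sub_le_add p x (w 0)) 2
      _ ≤ 2 * p x ^ 2 + 2 * p (w 0) ^ 2 := by nlinarith [sq_nonneg (p x - p (w 0))]
  have hMϑ : M ≤ M / ϑ := le_div_self hM hϑ hϑ1
  simp only [estimate, zero_add, Finset.sum_range_one, Nat.cast_zero]
  linarith [mul_le_mul_of_nonneg_left hsq hM, mul_le_mul_of_nonneg_right hMϑ (sq_nonneg (p x))]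

theorem le_estimate_succ (hrun : IsOptimalScheme p K g M ϑ w z a)
    (hg : IsLipschitzSubgradient p K φ g M) (hK : Convex ℝ K) (hM : 0 ≤ M) (hϑ : 0 < ϑ)
    (hconv : StronglyConvex p univ ϑ fun x => p x ^ 2 / 2) {k : ℕ} {C : ℝ}
    (ih : ((k : ℝ) + 1) * (k + 2) / 4 * φ (a k) ≤ estimate p φ g (M / ϑ) w k (z k) + C)
    {x : E} (hx : x ∈ K) :
    ((k : ℝ) + 2) * (k + 3) / 4 * φ (a (k + 1)) ≤
      estimate p φ g (M / ϑ) w (k + 1) x + C := by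
  set u := w (k + 1)
  set τ : ℝ := 2 / (k + 3) with hτ
  have hτ_pos : 0 < τ := by positivity
  have hτ_sub : 1 - τ = (k + 1) / (k + 3) := by rw [hτ]; field_simp; ring
  have hτ_nonneg : 0 ≤ 1 - τ := by rw [hτ_sub]; positivity
  set v := τ • x + (1 - τ) • a k with hv
  have hvu : v - u = τ • (x - z k) := by
    rw [hv, hτ_sub, show u = _ from hrun.average k]; module
  have hvu' : v - u = τ • (x - u) + (1 - τ) • (a k - u) := by rw [hv]; module
  have hdescend := hg.le_of_isProxPoint hK (hrun.mem hK (k + 1)) (hrun.descend (k + 1))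
    (hK hx (hrun.descend k).1 hτ_pos.le hτ_nonneg (by ring) : v ∈ K)
  have hgrad : g u (v - u) = τ * g u (x - u) + (1 - τ) * g u (a k - u) := by
    rw [hvu', map_add, map_smul, map_smul, smul_eq_mul, smul_eq_mul]
  have hp : p (v - u) = τ * p (x - z k) := by
    rw [hvu, map_smul_eq_mul, Real.norm_of_nonneg hτ_pos.le]
  rw [hgrad, hp] at hdescend
  have hsub := hg.subgradient _ (hrun.descend k).1 _ (hrun.mem hK (k + 1))
  have hstrong := hrun.estimate_add_le hK hM hϑ hconv φ k hx
  have hestimate : estimate p φ g (M / ϑ) w (k + 1) x = estimate p φ g (M / ϑ) w k x +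
      (k + 2) / 2 * (φ u + g u (x - u)) := by
    rw [estimate, estimate, Finset.sum_range_succ _ (k + 1), ← add_assoc]
    push_cast
    ring
  have hcurvature : ((k : ℝ) + 2) * (k + 3) / 4 * τ ^ 2 ≤ 1 := by
    rw [hτ, div_pow, div_mul_div_comm, div_le_one (by positivity)]
    nlinarith
  have hweight : ((k : ℝ) + 2) * (k + 3) / 4 * τ = (k + 2) / 2 := by
    rw [hτ]
    field_simp
    norm_num
  have hweight' : ((k : ℝ) + 2) * (k + 3) / 4 * (1 - τ) = (k + 1) * (k + 2) / 4 := by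
    rw [hτ_sub]; field_simp
  calc ((k : ℝ) + 2) * (k + 3) / 4 * φ (a (k + 1))
      ≤ (k + 2) * (k + 3) / 4 * (φ u + (τ * g u (x - u) + (1 - τ) * g u (a k - u)) +
          M / 2 * (τ * p (x - z k)) ^ 2) := by gcongr
    _ = (k + 2) / 2 * (φ u + g u (x - u)) + (k + 1) * (k + 2) / 4 * (φ u + g u (a k - u)) +
          (k + 2) * (k + 3) / 4 * τ ^ 2 * (M / 2 * p (x - z k) ^ 2) := by
        rw [← hweight, ← hweight']; ring
    _ ≤ (k + 2) / 2 * (φ u + g u (x - u)) + (k + 1) * (k + 2) / 4 * φ (a k) +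
          M / 2 * p (x - z k) ^ 2 := by
        exact add_le_add (by gcongr) (mul_le_of_le_one_left (by positivity) hcurvature)
    _ ≤ estimate p φ g (M / ϑ) w (k + 1) x + C := by linarith

theorem le_estimate (hrun : IsOptimalScheme p K g M ϑ w z a)
    (hg : IsLipschitzSubgradient p K φ g M) (hK : Convex ℝ K) (hM : 0 ≤ M) (hϑ : 0 < ϑ)
    (hϑ1 : ϑ ≤ 1) (hconv : StronglyConvex p univ ϑ fun x => p x ^ 2 / 2) (k : ℕ) {x : E}
    (hx : x ∈ K) :
    ((k : ℝ) + 1) * (k + 2) / 4 * φ (a k) ≤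
      estimate p φ g (M / ϑ) w k x + M / 2 * p (w 0) ^ 2 := by
  induction k generalizing x with
  | zero => simpa [show (2 : ℝ) / 4 = 1 / 2 by norm_num] using
      hrun.le_estimate_zero hg hK hM hϑ hϑ1 hx
  | succ k ih =>
    have h := hrun.le_estimate_succ hg hK hM hϑ hconv (ih (hrun.aggregate k).1) hx
    convert h using 2
    push_cast
    ring

end IsOptimalScheme

end FirstOrderMethod

section LogPrimitive

/-- The primitive of `s ↦ max (log (c₀ / s)) 1` that vanishes at `0`. -/
noncomputable def logPrimitive (c₀ s : ℝ) : ℝ :=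
  s * max (Real.log (c₀ * s⁻¹)) 1 + min s (c₀ / Real.exp 1)

variable {c₀ s t : ℝ}

theorem logPrimitive_nonneg (hc : 0 < c₀) (hs : 0 < s) : 0 ≤ logPrimitive c₀ s := by
  unfold logPrimitive
  positivity

theorem max_log_eq (hc : 0 < c₀) (hs : 0 < s) :
    max (Real.log (c₀ * s⁻¹)) 1 = Real.log c₀ - Real.log (min s (c₀ / Real.exp 1)) := by
  have hlog : Real.log (c₀ / Real.exp 1) = Real.log c₀ - 1 := by
    rw [Real.log_div hc.ne' (Real.exp_ne_zero 1), Real.log_exp]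
  rw [← div_eq_mul_inv, Real.log_div hc.ne' hs.ne']
  rcases le_total s (c₀ / Real.exp 1) with h | h
  · have hle := Real.log_le_log hs h
    rw [min_eq_left h, max_eq_left (by linarith)]
  · have hle := Real.log_le_log (by positivity) h
    rw [min_eq_right h, max_eq_right (by linarith), hlog, sub_sub_cancel]

theorem mul_log_sub_log_min_le {q : ℝ} (hs : 0 < s) (hst : s ≤ t) (hq : 0 < q) :
    s * (Real.log (min t q) - Real.log (min s q)) ≤ min t q - min s q := by
  rcases le_total s q with hsq | hqs
  · have hm : 0 < min t q := lt_min (hs.trans_le hst) hq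
    rw [min_eq_left hsq, ← Real.log_div hm.ne' hs.ne']
    calc s * Real.log (min t q / s) ≤ s * (min t q / s - 1) := by
          gcongr
          exact Real.log_le_sub_one_of_pos (div_pos hm hs)
      _ = min t q - s := by field_simp
  · rw [min_eq_right hqs, min_eq_right (hqs.trans hst), sub_self, sub_self, mul_zero]

theorem mul_le_logPrimitive_sub (hc : 0 < c₀) (hs : 0 < s) (hst : s ≤ t) :
    (t - s) * max (Real.log (c₀ * t⁻¹)) 1 ≤ logPrimitive c₀ t - logPrimitive c₀ s := by
  have hmin := mul_log_sub_log_min_le hs hst (div_pos hc (Real.exp_pos 1))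
  rw [logPrimitive, logPrimitive, max_log_eq hc hs, max_log_eq hc (hs.trans_le hst)]
  linarith

theorem logPrimitive_mono (hc : 0 < c₀) (hs : 0 < s) (hst : s ≤ t) :
    logPrimitive c₀ s ≤ logPrimitive c₀ t := by
  have hle : 0 ≤ (t - s) * max (Real.log (c₀ * t⁻¹)) 1 :=
    mul_nonneg (sub_nonneg.2 hst) (zero_le_one.trans (le_max_right _ _))
  exact sub_nonneg.1 (hle.trans (mul_le_logPrimitive_sub hc hs hst))

theorem div_exp_one_le {u : ℝ} (hu : u ≤ Real.exp (3 / 5)) : u / Real.exp 1 ≤ 17 / 25 := by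
  rw [div_le_iff₀ (Real.exp_pos 1)]
  have hexp : 1 ≤ 17 / 25 * Real.exp (2 / 5) := by
    linarith [Real.quadratic_le_exp_of_nonneg (x := 2 / 5) (by norm_num)]
  calc u ≤ Real.exp (3 / 5) := hu
    _ ≤ Real.exp (3 / 5) * (17 / 25 * Real.exp (2 / 5)) :=
        le_mul_of_one_le_right (Real.exp_pos _).le hexp
    _ = 17 / 25 * Real.exp (3 / 5 + 2 / 5) := by rw [Real.exp_add]; ring
    _ = 17 / 25 * Real.exp 1 := by norm_num

theorem inv_mul_max_log_add_min_le {u m : ℝ} (hu : 0 < u) (hm : 1 ≤ m)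
    (hlog : Real.log u ≤ m / 2) :
    m⁻¹ * max (Real.log (u * m)) 1 + min m⁻¹ (u / Real.exp 1) ≤ 42 / 25 := by
  have hm_pos : 0 < m := one_pos.trans_le hm
  have hinv : m⁻¹ ≤ 1 := inv_le_one_of_one_le₀ hm
  have hmin := min_le_left m⁻¹ (u / Real.exp 1)
  rcases le_total 1 (Real.log (u * m)) with hmax | hmax
  · have hle : m⁻¹ * Real.log (u * m) ≤ 3 / 2 - m⁻¹ :=
      calc m⁻¹ * Real.log (u * m) = m⁻¹ * (Real.log u + Real.log m) := by
            rw [Real.log_mul hu.ne' hm_pos.ne']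
        _ ≤ m⁻¹ * (m / 2 + (m - 1)) := by gcongr; exact Real.log_le_sub_one_of_pos hm_pos
        _ = 3 / 2 - m⁻¹ := by field_simp; ring
    rw [max_eq_left hmax]
    linarith
  · rw [max_eq_right hmax, mul_one]
    rcases le_total (6 / 5) m with hm_large | hm_small
    · have hinv' : m⁻¹ ≤ (6 / 5 : ℝ)⁻¹ := by gcongr
      norm_num at hinv'
      linarith
    · have hu' : u ≤ Real.exp (3 / 5) := (Real.log_le_iff_le_exp hu).1 (by linarith)
      linarith [min_le_right m⁻¹ (u / Real.exp 1), div_exp_one_le hu']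

theorem mul_logPrimitive_le {C₀ ε η : ℝ} (hc : 0 < c₀) (hC : 0 < C₀) (hε : 0 < ε) (hη : 0 < η)
    (hle : η ≤ ε / (2 * C₀ * max (2 * Real.log (2 * c₀ * C₀ * ε⁻¹)) 1)) :
    C₀ * logPrimitive c₀ η ≤ 21 / 25 * ε := by
  set u := 2 * c₀ * C₀ * ε⁻¹ with hu
  set m := max (2 * Real.log u) 1
  have hm_pos : 0 < m := one_pos.trans_le (le_max_right _ _)
  have hscale : C₀ * logPrimitive c₀ (ε / (2 * C₀ * m)) =
      ε / 2 * (m⁻¹ * max (Real.log (u * m)) 1 + min m⁻¹ (u / Real.exp 1)) := by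
    have harg : c₀ * (ε / (2 * C₀ * m))⁻¹ = u * m := by rw [hu]; field_simp
    rw [logPrimitive, harg, mul_add, mul_add, ← mul_assoc, ← mul_assoc,
      mul_min_of_nonneg _ _ hC.le, mul_min_of_nonneg _ _ (half_pos hε).le]
    congr 2
    · field_simp
    · field_simp
    · rw [hu]; field_simp
  calc C₀ * logPrimitive c₀ η ≤ C₀ * logPrimitive c₀ (ε / (2 * C₀ * m)) :=
        mul_le_mul_of_nonneg_left (logPrimitive_mono hc hη hle) hC.le
    _ ≤ ε / 2 * (42 / 25) := by
        rw [hscale]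
        gcongr
        exact inv_mul_max_log_add_min_le (by positivity) (le_max_right _ _)
          (by linarith [le_max_left (2 * Real.log u) 1])
    _ = 21 / 25 * ε := by ring

end LogPrimitive

section Smoothing

open Filter Topology

variable {X C B Y : Type*} [NormedAddCommGroup X] [NormedSpace ℝ X]
  [AddCommGroup C] [Module ℝ C] [NormedAddCommGroup B] [NormedSpace ℝ B]
  [AddCommGroup Y] [Module ℝ Y] {P : Program X C B Y} {S : Scheme X} {n : ℕ}
  {θ η L ϑ : ℝ} {d : Y → ℝ} {ystar : ℝ → (Fin n → ℝ) → Y}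

namespace Program

/-- The objective `α ↦ max_y (L(α, y) - η d(y))` smoothed by the prox-function `d`, where the
maximum is read off at its maximizer `ystar η α`. -/
noncomputable def smoothed (P : Program X C B Y) (S : Scheme X) (n : ℕ) (d : Y → ℝ)
    (ystar : ℝ → (Fin n → ℝ) → Y) (η : ℝ) (α : Fin n → ℝ) : ℝ :=
  P.lagrangian S n α (ystar η α) - η * d (ystar η α)

/-- The gradient `c - 𝒜ₙ^* y_η^*(α)` of the smoothed objective. -/
noncomputable def smoothedGrad (P : Program X C B Y) (S : Scheme X) (n : ℕ)
    (ystar : ℝ → (Fin n → ℝ) → Y) (η : ℝ) (α : Fin n → ℝ) : (Fin n → ℝ) →ₗ[ℝ] ℝ :=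
  (dotProductBilin ℝ ℝ).flip (P.cvec S n - P.AnStar S n (ystar η α))

theorem smoothed_add_smoothedGrad (u v : Fin n → ℝ) :
    P.smoothed S n d ystar η v + P.smoothedGrad S n ystar η v (u - v) =
      P.lagrangian S n u (ystar η v) - η * d (ystar η v) := by
  simp only [smoothed, smoothedGrad, lagrangian_eq, LinearMap.flip_apply,
    dotProductBilin_apply_apply, sub_dotProduct, dotProduct_sub]
  ring

namespace IsProxMaximizer

theorem le_smoothed (hy : P.IsProxMaximizer S n θ d ystar) (hη : 0 < η) {α : Fin n → ℝ}
    (hα : α ∈ S.ballR n) {y : Y} (hyθ : y ∈ P.ballY θ) :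
    P.lagrangian S n α y - η * d y ≤ P.smoothed S n d ystar η α := by
  rw [smoothed, lagrangian, lagrangian, add_sub_assoc, add_sub_assoc]
  exact add_le_add_right ((hy η hη α hα).2 y hyθ) _

theorem smoothed_sub_le (hy : P.IsProxMaximizer S n θ d ystar) {s t : ℝ} (hs : 0 < s)
    (ht : 0 < t) {α : Fin n → ℝ} (hα : α ∈ S.ballR n) :
    P.smoothed S n d ystar s α - P.smoothed S n d ystar t α ≤ (t - s) * d (ystar s α) := by
  have hle := hy.le_smoothed ht hα (hy s hs α hα).1
  rw [smoothed]
  linarith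

theorem smoothed_le_add_logPrimitive (hy : P.IsProxMaximizer S n θ d ystar) {c₀ C₀ : ℝ}
    (hc : 0 < c₀) (hC : 0 < C₀)
    (hgrowth : ∀ s > 0, ∀ α ∈ S.ballR n, d (ystar s α) ≤ C₀ * max (Real.log (c₀ * s⁻¹)) 1)
    {α : Fin n → ℝ} (hα : α ∈ S.ballR n) {s : ℝ} (hs : 0 < s) (hsη : s ≤ η) :
    P.smoothed S n d ystar s α ≤ P.smoothed S n d ystar η α + C₀ * logPrimitive c₀ η := by
  have hmono := le_of_forall_sub_le_mul_sub hsη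
    (H := fun t => -P.smoothed S n d ystar t α - C₀ * logPrimitive c₀ t)
    (ω := fun t => -(C₀ * max (Real.log (c₀ * t⁻¹)) 1)) fun r t hsr hrt _ => by
      have hr : 0 < r := hs.trans_le hsr
      have hsub := hy.smoothed_sub_le hr (hr.trans_le hrt) hα
      have hd := mul_le_mul_of_nonneg_left (hgrowth r hr α hα) (sub_nonneg.2 hrt)
      have hΛ := mul_le_mul_of_nonneg_left (mul_le_logPrimitive_sub hc hr hrt) hC.le
      linarith
  have hnonneg := mul_nonneg hC.le (logPrimitive_nonneg hc hs)
  linarith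

theorem upperVal_le_smoothed_add (hy : P.IsProxMaximizer S n θ d ystar) (hP : P.Admissible)
    (hθ : 0 ≤ θ) (hη : 0 < η) {c₀ C₀ : ℝ} (hc : 0 < c₀) (hC : 0 < C₀)
    (hgrowth : ∀ s > 0, ∀ α ∈ S.ballR n, d (ystar s α) ≤ C₀ * max (Real.log (c₀ * s⁻¹)) 1)
    {α : Fin n → ℝ} (hα : α ∈ S.ballR n) :
    P.upperVal S n θ α ≤ P.smoothed S n d ystar η α + C₀ * logPrimitive c₀ η := by
  rw [upperVal, ← le_sub_iff_add_le']
  refine hP.supportFun_ballY_le hθ fun y hyθ => le_sub_iff_add_le'.2 ?_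
  have hlim : Tendsto (fun s => P.lagrangian S n α y - s * d y) (𝓝[>] 0)
      (𝓝 (P.lagrangian S n α y - 0 * d y)) :=
    ((by fun_prop : Continuous fun s => P.lagrangian S n α y - s * d y).tendsto 0).mono_left
      nhdsWithin_le_nhds
  rw [zero_mul, sub_zero] at hlim
  refine le_of_tendsto hlim (mem_of_superset (Ioc_mem_nhdsGT hη) fun s hs => ?_)
  exact (hy.le_smoothed hs.1 hα hyθ).trans
    (hy.smoothed_le_add_logPrimitive hc hC hgrowth hα hs.1 hs.2)

theorem isLipschitzSubgradient (hy : P.IsProxMaximizer S n θ d ystar)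
    (hR : ∀ α, S.R n α = 0 → α = 0) (hη : 0 < η) (hLip : P.LipschitzGradient S n ystar L η) :
    IsLipschitzSubgradient (S.R n) (S.ballR n) (P.smoothed S n d ystar η)
      (P.smoothedGrad S n ystar η) (L / η) where
  subgradient u hu v hv := by
    rw [smoothed_add_smoothedGrad]
    exact hy.le_smoothed hη hu (hy η hη v hv).1
  lipschitz u hu v hv x := by
    set δ := P.AnStar S n (ystar η v) - P.AnStar S n (ystar η u) with hδ
    calc P.smoothedGrad S n ystar η u x - P.smoothedGrad S n ystar η v x = x ⬝ᵥ δ := by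
          simp only [smoothedGrad, LinearMap.flip_apply, dotProductBilin_apply_apply, hδ,
            dotProduct_sub]
          ring
      _ ≤ S.R n x * S.normRStar n δ := Scheme.dotProduct_le hR x δ
      _ ≤ S.R n x * (L / η * S.R n (v - u)) :=
          mul_le_mul_of_nonneg_left (hLip v hv u hu) (apply_nonneg _ _)
      _ = L / η * S.R n (u - v) * S.R n x := by rw [map_sub_rev]; ring

end IsProxMaximizer

end Program

omit [NormedAddCommGroup X] [NormedSpace ℝ X] in
theorem Scheme.IsProxStep.isProxPoint {q a v : Fin n → ℝ} (h : S.IsProxStep n ϑ q a v) {m : ℝ}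
    (hm : 0 ≤ m) :
    IsProxPoint (S.R n) (S.ballR n) (m / ϑ) ((dotProductBilin ℝ ℝ).flip (m • q)) a v := by
  have hscale : ∀ u, (dotProductBilin ℝ ℝ).flip (m • q) u + m / ϑ / 2 * S.R n (u - a) ^ 2 =
      m * (q ⬝ᵥ u + 1 / (2 * ϑ) * S.R n (u - a) ^ 2) := by
    intro u
    rw [LinearMap.flip_apply, dotProductBilin_apply_apply, dotProduct_smul, dotProduct_comm,
      smul_eq_mul]
    ring
  refine ⟨h.1, fun u hu => ?_⟩
  simp only [mem_ofPred_eq, hscale]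
  exact mul_le_mul_of_nonneg_left (h.2 u hu) hm

theorem sum_weights (k : ℕ) :
    ∑ j ∈ Finset.range (k + 1), 2 * ((j : ℝ) + 1) / (((k : ℝ) + 1) * ((k : ℝ) + 2)) = 1 := by
  rw [← Finset.sum_div, div_eq_one_iff_eq (by positivity)]
  induction k with
  | zero => norm_num
  | succ k ih =>
    rw [Finset.sum_range_succ, ih]
    push_cast
    ring

namespace Program

theorem IsProxMaximizer.yhat_mem_ballY (hy : P.IsProxMaximizer S n θ d ystar)
    (hP : P.Admissible) (hη : 0 < η) {w : ℕ → Fin n → ℝ} (hw : ∀ k, w k ∈ S.ballR n) (k : ℕ) :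
    yhat ystar η w k ∈ P.ballY θ :=
  (hP.convex_ballY θ).sum_mem (fun _ _ => by positivity) (sum_weights k)
    fun j _ => (hy η hη _ (hw j)).1

theorem lagrangian_yhat (x : Fin n → ℝ) (w : ℕ → Fin n → ℝ) (k : ℕ) :
    P.lagrangian S n x (yhat ystar η w k) =
      ∑ j ∈ Finset.range (k + 1), 2 * ((j : ℝ) + 1) / (((k : ℝ) + 1) * ((k : ℝ) + 2)) *
        P.lagrangian S n x (ystar η (w j)) := by
  simp only [lagrangian, yhat, map_sum, map_smul, smul_eq_mul]
  rw [Finset.sum_congr rfl fun (j : ℕ) _ => mul_add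
      (2 * ((j : ℝ) + 1) / (((k : ℝ) + 1) * ((k : ℝ) + 2))) (x ⬝ᵥ P.cvec S n) _,
    Finset.sum_add_distrib, ← Finset.sum_mul, sum_weights, one_mul]

theorem estimate_smoothed_le {M : ℝ} (hM : 0 ≤ M) (hη : 0 ≤ η) {x : Fin n → ℝ}
    (hx : x ∈ S.ballR n) {w : ℕ → Fin n → ℝ} (hd : ∀ k, 0 ≤ d (ystar η (w k))) (k : ℕ) :
    estimate (S.R n) (P.smoothed S n d ystar η) (P.smoothedGrad S n ystar η) M w k x ≤
      M / 2 * S.θP ^ 2 +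
        ((k : ℝ) + 1) * (k + 2) / 4 * P.lagrangian S n x (yhat ystar η w k) := by
  rw [lagrangian_yhat, Finset.mul_sum]
  refine add_le_add (mul_le_mul_of_nonneg_left
    (pow_le_pow_left₀ (apply_nonneg _ _) hx 2) (by positivity)) (Finset.sum_le_sum fun j _ => ?_)
  calc ((j : ℝ) + 1) / 2 *
        (P.smoothed S n d ystar η (w j) + P.smoothedGrad S n ystar η (w j) (x - w j))
      ≤ ((j : ℝ) + 1) / 2 * P.lagrangian S n x (ystar η (w j)) := by
        rw [smoothed_add_smoothedGrad]
        gcongr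
        exact sub_le_self _ (mul_nonneg hη (hd j))
    _ = _ := by field_simp; ring

namespace IsRun

variable {w z a : ℕ → Fin n → ℝ}

theorem isOptimalScheme (hrun : P.IsRun S n ystar η L ϑ w z a) (hη : 0 < η) (hL : 0 < L)
    (hϑ : 0 < ϑ) :
    IsOptimalScheme (S.R n) (S.ballR n) (P.smoothedGrad S n ystar η) (L / η) ϑ w z a where
  init := hrun.init
  aggregate k := by
    have hgrad : ∑ j ∈ Finset.range (k + 1),
        (((j : ℝ) + 1) / 2) • P.smoothedGrad S n ystar η (w j) =
        (dotProductBilin ℝ ℝ).flip ((L / η) • ∑ j ∈ Finset.range (k + 1),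
          (((j : ℝ) + 1) / 2) • P.stepVec S n ystar η L w j) := by
      simp only [smoothedGrad, stepVec, Finset.smul_sum, map_sum, map_smul, smul_smul]
      exact Finset.sum_congr rfl fun j _ => by congr 1; field_simp
    rw [hgrad]
    exact (hrun.stepZ k).isProxPoint (by positivity)
  descend k := by
    have hstep := (hrun.stepA k).isProxPoint (m := L / η * ϑ) (by positivity)
    rw [mul_div_cancel_right₀ _ hϑ.ne', stepVec, smul_smul, smul_smul,
      show L / η * ϑ * (1 / ϑ) * (η / L) = 1 by field_simp, one_smul] at hstep
    exact hstep
  average := hrun.stepW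

theorem lowerVal_le_Jn (hrun : P.IsRun S n ystar η L ϑ w z a) (hP : P.Admissible)
    (hR : ∀ α, S.R n α = 0 → α = 0) (hf : (P.feasN S n).Nonempty)
    (hy : P.IsProxMaximizer S n θ d ystar) (hη : 0 < η) (hL : 0 < L) (hϑ : 0 < ϑ) (k : ℕ) :
    P.lowerVal S n (yhat ystar η w k) ≤ P.Jn S n :=
  Program.lowerVal_le_Jn hR hf (hy.yhat_mem_ballY hP hη
    ((hrun.isOptimalScheme hη hL hϑ).mem (S.convex_ballR n)) k).1

theorem smoothed_le_lowerVal_add (hrun : P.IsRun S n ystar η L ϑ w z a)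
    (hR : ∀ α, S.R n α = 0 → α = 0) (hn : 1 ≤ n) (hθP : 0 < S.θP)
    (hd : ∀ y ∈ P.ballY θ, 0 ≤ d y) (hy : P.IsProxMaximizer S n θ d ystar)
    (hη : 0 < η) (hL : 0 < L) (hLip : P.LipschitzGradient S n ystar L η) (hϑ : 0 < ϑ)
    (hconv : StronglyConvex (S.R n) Set.univ ϑ (fun α => S.R n α ^ 2 / 2)) (k : ℕ) :
    P.smoothed S n d ystar η (a k) ≤ P.lowerVal S n (yhat ystar η w k) +
      4 * L * S.θP ^ 2 / (ϑ * η * (((k : ℝ) + 1) * ((k : ℝ) + 2))) := by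
  have hK := S.convex_ballR n
  have hM : 0 ≤ L / η := by positivity
  have hscheme := hrun.isOptimalScheme hη hL hϑ
  have hw := hscheme.mem hK
  have hϑ1 : ϑ ≤ 1 := hconv.le_one_of_sq_seminorm (u := Pi.single ⟨0, hn⟩ 1) fun h0 => by
    simpa using congrFun (hR _ h0) ⟨0, hn⟩
  rw [← sub_le_iff_le_add]
  refine le_lowerVal hθP fun x hx => ?_
  have hest := hscheme.le_estimate (hy.isLipschitzSubgradient hR hη hLip) hK hM hϑ hϑ1 hconv k hx
  have hlag := estimate_smoothed_le (M := L / η / ϑ) (div_nonneg hM hϑ.le) hη.le hx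
    (fun j => hd _ (hy η hη _ (hw j)).1) k (P := P) (d := d) (ystar := ystar)
  have hinit : L / η / 2 * S.R n (w 0) ^ 2 ≤ L / η / ϑ / 2 * S.θP ^ 2 :=
    mul_le_mul (by linarith [le_div_self hM hϑ hϑ1])
      (pow_le_pow_left₀ (apply_nonneg _ _) hrun.init 2) (by positivity) (by positivity)
  have hgap : ((k : ℝ) + 1) * (k + 2) / 4 *
      (4 * L * S.θP ^ 2 / (ϑ * η * (((k : ℝ) + 1) * ((k : ℝ) + 2)))) =
      2 * (L / η / ϑ / 2 * S.θP ^ 2) := by field_simp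
  refine le_of_mul_le_mul_left ?_ (by positivity : 0 < ((k : ℝ) + 1) * (k + 2) / 4)
  rw [mul_sub, hgap]
  linarith

theorem upperVal_le_lowerVal_add (hrun : P.IsRun S n ystar η L ϑ w z a) (hP : P.Admissible)
    (hR : ∀ α, S.R n α = 0 → α = 0) (hn : 1 ≤ n) (hθP : 0 < S.θP) (hθ : 0 ≤ θ)
    (hd : ∀ y ∈ P.ballY θ, 0 ≤ d y) (hy : P.IsProxMaximizer S n θ d ystar)
    (hη : 0 < η) (hL : 0 < L) (hLip : P.LipschitzGradient S n ystar L η) (hϑ : 0 < ϑ)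
    (hconv : StronglyConvex (S.R n) Set.univ ϑ (fun α => S.R n α ^ 2 / 2)) {k : ℕ} {ε : ℝ}
    (hε : 0 < ε) (hit : S.EnoughIterations n d ystar L ϑ ε η k) :
    P.upperVal S n θ (a k) ≤ P.lowerVal S n (yhat ystar η w k) + ε := by
  obtain ⟨c₀, C₀, hc, hC, hgrowth, hηle, hk⟩ := hit
  have hoptimization := hrun.smoothed_le_lowerVal_add hR hn hθP hd hy hη hL hLip hϑ hconv k
  have hsmoothing := hy.upperVal_le_smoothed_add hP hθ hη hc hC hgrowth (hrun.stepA k).1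
  have hΛ := mul_logPrimitive_le hc hC hε hη hηle
  have hk_sq : 25 * S.θP ^ 2 * (L / (ϑ * η * ε)) ≤ ((k : ℝ) + 1) * (k + 2) :=
    calc 25 * S.θP ^ 2 * (L / (ϑ * η * ε)) = (5 * S.θP * √(L / (ϑ * η * ε))) ^ 2 := by
          rw [mul_pow, Real.sq_sqrt (by positivity)]; ring
      _ ≤ (k : ℝ) ^ 2 := pow_le_pow_left₀ (by positivity) hk 2
      _ ≤ ((k : ℝ) + 1) * (k + 2) := by nlinarith [(Nat.cast_nonneg k : (0 : ℝ) ≤ k)]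
  have hgap : 4 * L * S.θP ^ 2 / (ϑ * η * (((k : ℝ) + 1) * ((k : ℝ) + 2))) ≤ 4 / 25 * ε := by
    rw [div_le_iff₀ (by positivity)]
    calc 4 * L * S.θP ^ 2
        = 4 / 25 * ε * (ϑ * η) * (25 * S.θP ^ 2 * (L / (ϑ * η * ε))) := by field_simp
      _ ≤ 4 / 25 * ε * (ϑ * η) * (((k : ℝ) + 1) * (k + 2)) := by gcongr
      _ = _ := by ring
  linarith

end IsRun

end Program

end Smoothing

/-! ### The binomial tail and the moment problem -/

/-- The probability that a binomial variable with parameters `N` and `ε` is less than `n`. -/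
noncomputable def binTail (n N : ℕ) (ε : ℝ) : ℝ :=
  ∑ i ∈ Finset.range n, (N.choose i : ℝ) * ε ^ i * (1 - ε) ^ (N - i)

theorem continuous_binTail (n N : ℕ) : Continuous (binTail n N) := by
  unfold binTail
  fun_prop

theorem binTail_succ (n N : ℕ) (ε : ℝ) :
    binTail (n + 1) N ε = binTail n N ε + (N.choose n : ℝ) * ε ^ n * (1 - ε) ^ (N - n) :=
  Finset.sum_range_succ _ n

theorem binTail_zero {n : ℕ} (hn : 1 ≤ n) (N : ℕ) : binTail n N 0 = 1 := by
  obtain ⟨m, rfl⟩ := Nat.exists_eq_add_of_le' hn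
  rw [binTail, Finset.sum_range_succ']
  simp

theorem binTail_one {n N : ℕ} (hnN : n ≤ N) : binTail n N 1 = 0 := by
  refine Finset.sum_eq_zero fun i hi => ?_
  have hi' := Finset.mem_range.1 hi
  rw [sub_self, zero_pow (by omega), mul_zero]

theorem binTail_of_lt {n N : ℕ} (h : N < n) (ε : ℝ) : binTail n N ε = 1 := by
  calc binTail n N ε
      = ∑ i ∈ Finset.range (N + 1), (N.choose i : ℝ) * ε ^ i * (1 - ε) ^ (N - i) := by
        refine (Finset.sum_subset (Finset.range_mono h) fun i _ hi => ?_).symm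
        rw [Nat.choose_eq_zero_of_lt (by simpa using hi)]
        simp
    _ = ∑ i ∈ Finset.range (N + 1), ε ^ i * (1 - ε) ^ (N - i) * N.choose i :=
        Finset.sum_congr rfl fun i _ => by ring
    _ = 1 := by rw [← add_pow, add_sub_cancel, one_pow]

theorem binTail_succ_succ {n N : ℕ} (h : n ≤ N) (ε : ℝ) :
    binTail (n + 1) (N + 1) ε =
      binTail (n + 1) N ε - (N.choose n : ℝ) * ε ^ (n + 1) * (1 - ε) ^ (N - n) := by
  induction n with
  | zero =>
    simp [binTail]
    ring
  | succ n ih =>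
    rw [binTail_succ (n + 1) (N + 1), binTail_succ (n + 1) N, ih (by omega),
      Nat.choose_succ_succ, show N + 1 - (n + 1) = N - n by omega,
      show N - n = N - (n + 1) + 1 by omega]
    push_cast
    ring

theorem binTail_antitone {ε : ℝ} (h0 : 0 ≤ ε) (h1 : ε ≤ 1) (n : ℕ) :
    Antitone fun N => binTail n N ε := by
  refine antitone_nat_of_succ_le fun N => ?_
  cases n with
  | zero => simp [binTail]
  | succ n =>
    rcases lt_or_ge N n with hN | hN
    · rw [binTail_of_lt (by omega), binTail_of_lt (by omega)]
    · have : 0 ≤ 1 - ε := sub_nonneg.2 h1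
      rw [binTail_succ_succ hN]
      exact sub_le_self _ (by positivity)

theorem binTail_le_of_sampleBound_le {n N : ℕ} {ε β : ℝ} (h0 : 0 ≤ ε) (h1 : ε ≤ 1)
    (h : sampleBound n ε β ≤ N) : binTail n N ε ≤ β := by
  have hs : sInf ((fun N : ℕ => (N : ℕ∞)) '' {N | binTail n N ε ≤ β}) ≤ N := h
  have hne : ((fun N : ℕ => (N : ℕ∞)) '' {N | binTail n N ε ≤ β}).Nonempty := by
    by_contra hne
    rw [not_nonempty_iff_eq_empty.1 hne, sInf_empty] at hs
    exact absurd hs (by simp)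
  obtain ⟨N₀, hN₀, he : (N₀ : ℕ∞) = _⟩ := csInf_mem hne
  have hle : N₀ ≤ N := by exact_mod_cast he.trans_le hs
  exact (binTail_antitone h0 h1 n hle).trans hN₀

theorem hasDerivAt_binTail {n N : ℕ} (hnN : n ≤ N) (ε : ℝ) :
    HasDerivAt (binTail n N)
      (-((n : ℝ) * (N.choose n : ℝ) * ε ^ (n - 1) * (1 - ε) ^ (N - n))) ε := by
  induction n with
  | zero =>
    rw [show binTail 0 N = fun _ => 0 from funext fun _ => by simp [binTail]]
    simpa using hasDerivAt_const ε (0 : ℝ)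
  | succ n ih =>
    rw [show binTail (n + 1) N = _ from funext (binTail_succ n N)]
    have hleft : HasDerivAt (fun x : ℝ => (N.choose n : ℝ) * x ^ n)
        ((N.choose n : ℝ) * ((n : ℝ) * ε ^ (n - 1))) ε := (hasDerivAt_pow n ε).const_mul _
    have hright : HasDerivAt (fun x : ℝ => (1 - x) ^ (N - n))
        (((N - n : ℕ) : ℝ) * (1 - ε) ^ (N - n - 1) * -1) ε :=
      ((hasDerivAt_id ε).const_sub 1).pow (N - n)
    have habsorb : ((n + 1 : ℕ) : ℝ) * (N.choose (n + 1) : ℝ) =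
        ((N - n : ℕ) : ℝ) * N.choose n := by
      rw [mul_comm, mul_comm ((N - n : ℕ) : ℝ)]
      exact_mod_cast Nat.choose_succ_right_eq N n
    refine ((ih (by omega)).add (hleft.mul hright)).congr_deriv ?_
    rw [habsorb, Nat.add_sub_cancel, show N - (n + 1) = N - n - 1 by omega]
    ring

theorem integral_eq_binTail {n N : ℕ} (hnN : n ≤ N) (ε : ℝ) :
    ∫ v in ε..1, (n : ℝ) * (N.choose n : ℝ) * v ^ (n - 1) * (1 - v) ^ (N - n) =
      binTail n N ε := by
  have h := intervalIntegral.integral_eq_sub_of_hasDerivAt (a := ε) (b := 1)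
    (fun x _ => (hasDerivAt_binTail hnN x).neg)
    (Continuous.intervalIntegrable (by fun_prop) _ _)
  simp only [neg_neg, Pi.neg_apply, binTail_one hnN] at h
  rw [h]
  ring

theorem integrable_of_ae_mem_Icc {κ : Measure ℝ} [IsFiniteMeasure κ] {a b : ℝ}
    (hκ : ∀ᵐ u ∂κ, u ∈ Icc a b) {f : ℝ → ℝ} (hf : Continuous f) : Integrable f κ := by
  obtain ⟨M, hM⟩ := isCompact_Icc.exists_bound_of_continuousOn hf.continuousOn
  exact Integrable.of_bound hf.aestronglyMeasurable M (hκ.mono fun u hu => hM u hu)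

theorem integral_polynomial_eq_of_moments {ν ρ : Measure ℝ} [IsFiniteMeasure ν]
    [IsFiniteMeasure ρ] {a b : ℝ} (hν : ∀ᵐ u ∂ν, u ∈ Icc a b) (hρ : ∀ᵐ u ∂ρ, u ∈ Icc a b)
    (h : ∀ k : ℕ, ∫ u, u ^ k ∂ν = ∫ u, u ^ k ∂ρ) (p : Polynomial ℝ) :
    ∫ u, p.eval u ∂ν = ∫ u, p.eval u ∂ρ := by
  simp only [Polynomial.eval_eq_sum_range]
  rw [integral_finsetSum _ fun i _ => integrable_of_ae_mem_Icc hν (by fun_prop),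
    integral_finsetSum _ fun i _ => integrable_of_ae_mem_Icc hρ (by fun_prop)]
  exact Finset.sum_congr rfl fun i _ => by rw [integral_const_mul, integral_const_mul, h]

theorem measure_ext_of_moments {ν ρ : Measure ℝ} [IsFiniteMeasure ν] [IsFiniteMeasure ρ]
    {a b : ℝ} (hν : ∀ᵐ u ∂ν, u ∈ Icc a b) (hρ : ∀ᵐ u ∂ρ, u ∈ Icc a b)
    (h : ∀ k : ℕ, ∫ u, u ^ k ∂ν = ∫ u, u ^ k ∂ρ) : ν = ρ := by
  refine ext_of_forall_integral_eq_of_IsFiniteMeasure fun f => eq_of_forall_dist_le fun ε hε => ?_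
  have hm : 0 < ν.real univ + ρ.real univ + 1 := by positivity
  set m := ν.real univ + ρ.real univ + 1
  obtain ⟨p, hp⟩ := exists_polynomial_near_of_continuousOn a b f f.continuous.continuousOn (ε / m)
    (by positivity)
  have hclose : ∀ (κ : Measure ℝ) [IsFiniteMeasure κ], (∀ᵐ u ∂κ, u ∈ Icc a b) →
      |∫ u, p.eval u ∂κ - ∫ u, f u ∂κ| ≤ ε / m * κ.real univ := fun κ _ hκ => by
    rw [← integral_sub (integrable_of_ae_mem_Icc hκ p.continuous)
      (integrable_of_ae_mem_Icc hκ f.continuous)]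
    exact norm_integral_le_of_norm_le_const (f := fun u => p.eval u - f u)
      (hκ.mono fun u hu => (hp u hu).le)
  have htotal : ε / m * (ν.real univ + ρ.real univ) ≤ ε := by
    rw [div_mul_eq_mul_div, div_le_iff₀ hm]
    exact mul_le_mul_of_nonneg_left (le_add_of_nonneg_right zero_le_one) hε.le
  calc dist (∫ u, f u ∂ν) (∫ u, f u ∂ρ)
      ≤ |∫ u, f u ∂ν - ∫ u, p.eval u ∂ν| + |∫ u, p.eval u ∂ν - ∫ u, f u ∂ρ| :=
        abs_sub_le _ _ _
    _ ≤ ε / m * ν.real univ + ε / m * ρ.real univ := by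
        refine add_le_add ((abs_sub_comm _ _).trans_le (hclose ν hν)) ?_
        rw [integral_polynomial_eq_of_moments hν hρ h]
        exact hclose ρ hρ
    _ ≤ ε := by rwa [← mul_add]

/-- The law of the minimum of `n` independent uniform variables on the unit interval. -/
noncomputable def uniformMinLaw (n : ℕ) : Measure ℝ :=
  (volume.restrict (Icc 0 1)).withDensity fun u => ENNReal.ofReal (n * (1 - u) ^ (n - 1))

instance (n : ℕ) : IsFiniteMeasure (uniformMinLaw n) :=
  isFiniteMeasure_withDensity_ofReal
    (Continuous.integrableOn_Icc (μ := volume) (a := 0) (b := 1)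
      (f := fun u : ℝ => (n : ℝ) * (1 - u) ^ (n - 1)) (by fun_prop)).2

theorem uniformMinLaw_absolutelyContinuous (n : ℕ) :
    uniformMinLaw n ≪ volume.restrict (Icc 0 1) :=
  withDensity_absolutelyContinuous _ _

theorem setIntegral_uniformMinLaw (n : ℕ) {b : ℝ} (hb : 0 ≤ b) (hb1 : b ≤ 1) (k : ℕ) :
    ∫ u in Iio b, u ^ k ∂uniformMinLaw n =
      ∫ u in (0 : ℝ)..b, (n : ℝ) * (1 - u) ^ (n - 1) * u ^ k := by
  have hset : Iio b ∩ Icc 0 1 = Ico 0 b := by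
    ext u
    simp only [mem_inter_iff, mem_Iio, mem_Icc, mem_Ico]
    exact ⟨fun h => ⟨h.2.1, h.1⟩, fun h => ⟨h.2, h.1, (h.2.trans_le hb1).le⟩⟩
  rw [uniformMinLaw, restrict_withDensity measurableSet_Iio,
    integral_withDensity_eq_integral_toReal_smul (by fun_prop)
      (Filter.Eventually.of_forall fun _ => ENNReal.ofReal_lt_top),
    Measure.restrict_restrict measurableSet_Iio, hset, intervalIntegral.integral_of_le hb,
    integral_Ico_eq_integral_Ioo, integral_Ioc_eq_integral_Ioo]
  refine setIntegral_congr_fun measurableSet_Ioo fun u hu => ?_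
  have hpos : 0 ≤ (n : ℝ) * (1 - u) ^ (n - 1) :=
    mul_nonneg n.cast_nonneg (pow_nonneg (by linarith [hu.2]) _)
  simp only [smul_eq_mul, ENNReal.toReal_ofReal hpos]

theorem integral_uniformMinLaw (n k : ℕ) :
    ∫ u, u ^ k ∂uniformMinLaw n = ∫ u in Iio 1, u ^ k ∂uniformMinLaw n := by
  have hone : ∀ᵐ u ∂uniformMinLaw n, u ≠ 1 :=
    (uniformMinLaw_absolutelyContinuous n).ae_le (ae_restrict_of_ae (Measure.ae_ne volume 1))
  have hIcc : ∀ᵐ u ∂uniformMinLaw n, u ∈ Icc (0 : ℝ) 1 :=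
    (uniformMinLaw_absolutelyContinuous n).ae_le (ae_restrict_mem measurableSet_Icc)
  rw [Measure.restrict_eq_self_of_ae_mem]
  filter_upwards [hIcc, hone] with u hu hu1
  exact lt_of_le_of_ne hu.2 hu1

theorem choose_mul_setIntegral_uniformMinLaw {n N : ℕ} (hnN : n ≤ N) {ε : ℝ} (hε : 0 ≤ ε)
    (hε1 : ε ≤ 1) :
    (N.choose n : ℝ) * ∫ u in Iio (1 - ε), u ^ (N - n) ∂uniformMinLaw n = binTail n N ε := by
  have hsubst := intervalIntegral.integral_comp_sub_left (a := ε) (b := 1)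
    (fun u => (N.choose n : ℝ) * ((n : ℝ) * (1 - u) ^ (n - 1) * u ^ (N - n))) 1
  rw [sub_self] at hsubst
  rw [setIntegral_uniformMinLaw n (by linarith) (by linarith), ← integral_eq_binTail hnN ε,
    ← intervalIntegral.integral_const_mul, ← hsubst]
  exact intervalIntegral.integral_congr fun v _ => by ring

theorem eq_uniformMinLaw_of_moments {ν : Measure ℝ} [IsFiniteMeasure ν]
    (hν : ∀ᵐ u ∂ν, u ∈ Icc (0 : ℝ) 1) {n : ℕ} (hn : 1 ≤ n)
    (h : ∀ k : ℕ, ((n + k).choose n : ℝ) * ∫ u, u ^ k ∂ν = 1) : ν = uniformMinLaw n := by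
  refine measure_ext_of_moments hν ((uniformMinLaw_absolutelyContinuous n).ae_le
    (ae_restrict_mem measurableSet_Icc)) fun k => ?_
  have hmoment := choose_mul_setIntegral_uniformMinLaw (Nat.le_add_right n k) le_rfl zero_le_one
  rw [binTail_zero hn, sub_zero, Nat.add_sub_cancel_left, ← integral_uniformMinLaw] at hmoment
  have hchoose : ((n + k).choose n : ℝ) ≠ 0 := by
    exact_mod_cast (Nat.choose_pos (Nat.le_add_right n k)).ne'
  exact mul_left_cancel₀ hchoose ((h k).trans hmoment.symm)

theorem choose_mul_setIntegral_eq_binTail_of_moments {ν : Measure ℝ} [IsFiniteMeasure ν]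
    (hν : ∀ᵐ u ∂ν, u ∈ Icc (0 : ℝ) 1) {n : ℕ} (hn : 1 ≤ n)
    (h : ∀ k : ℕ, ((n + k).choose n : ℝ) * ∫ u, u ^ k ∂ν = 1) {N : ℕ} (hnN : n ≤ N) {ε : ℝ}
    (hε : 0 ≤ ε) (hε1 : ε ≤ 1) :
    (N.choose n : ℝ) * ∫ u in Iio (1 - ε), u ^ (N - n) ∂ν = binTail n N ε := by
  rw [eq_uniformMinLaw_of_moments hν hn h, choose_mul_setIntegral_uniformMinLaw hnN hε hε1]

/-! ### Convex programs with random half-space constraints -/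

theorem exists_subset_card_le_finrank_disjoint {𝕜 E ι : Type*} [Field 𝕜] [LinearOrder 𝕜]
    [IsStrictOrderedRing 𝕜] [AddCommGroup E] [Module 𝕜 E] [FiniteDimensional 𝕜 E] {C : Set E}
    {F : ι → Set E} {s : Finset ι} (hC : Convex 𝕜 C) (hF : ∀ i ∈ s, Convex 𝕜 (F i))
    (hne : (⋂ i ∈ s, F i).Nonempty) (hdisj : Disjoint C (⋂ i ∈ s, F i)) :
    ∃ t ⊆ s, t.card ≤ Module.finrank 𝕜 E ∧ Disjoint C (⋂ i ∈ t, F i) := by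
  classical
  have hiInter : ∀ I : Finset (Option ι), none ∈ I →
      ⋂ o ∈ I, o.elim C F = C ∩ ⋂ i ∈ Finset.eraseNone I, F i := by
    intro I hI
    ext z
    simp only [mem_iInter, mem_inter_iff, Finset.mem_eraseNone, Option.forall, Option.elim_none,
      Option.elim_some]
    exact ⟨fun h => ⟨h.1 hI, h.2⟩, fun h => ⟨fun _ => h.1, h.2⟩⟩
  have hconvex : ∀ o ∈ Finset.insertNone s, Convex 𝕜 (o.elim C F) := by
    rintro (_ | i) hi
    · exact hC
    · exact hF i (by simpa using hi)
  have hempty : ¬ (⋂ o ∈ Finset.insertNone s, o.elim C F).Nonempty := by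
    rwa [hiInter _ (Finset.none_mem_insertNone), Finset.eraseNone_insertNone,
      not_nonempty_iff_eq_empty, ← disjoint_iff_inter_eq_empty]
  have hhelly := mt (Convex.helly_theorem' hconvex) hempty
  push Not at hhelly
  obtain ⟨I, hIs, hIcard, hI⟩ := hhelly
  have hsub : Finset.eraseNone I ⊆ s := fun i hi => by
    simpa using hIs (Finset.mem_eraseNone.1 hi)
  have hnone : none ∈ I := by
    by_contra hnone
    obtain ⟨z, hz⟩ := hne
    refine (hI ▸ notMem_empty z) (mem_iInter₂.2 ?_)
    rintro (_ | i) hi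
    · exact absurd hi hnone
    · exact mem_iInter₂.1 hz i (hsub (Finset.mem_eraseNone.2 hi))
  refine ⟨Finset.eraseNone I, hsub, ?_, ?_⟩
  · have hlt : (Finset.eraseNone I).card < I.card := by
      rw [← Finset.card_map Function.Embedding.some, Finset.map_some_eraseNone]
      exact Finset.card_lt_card (Finset.erase_ssubset hnone)
    omega
  · rw [disjoint_iff_inter_eq_empty, ← hiInter I hnone, hI]

theorem exists_lowest_superset {ι κ : Type*} [Fintype ι] [LinearOrder κ] (ℓ : ι → κ)
    (A : Finset ι) {m : ℕ} (hAm : A.card ≤ m) (hm : m ≤ Fintype.card ι) :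
    ∃ I, A ⊆ I ∧ I.card = m ∧ ∀ i ∈ I, i ∉ A → ∀ j, j ∉ I → ℓ i ≤ ℓ j := by
  classical
  induction m, hAm using Nat.le_induction with
  | base => exact ⟨A, subset_rfl, rfl, fun i hi hi' => absurd hi hi'⟩
  | succ m _ ih =>
    obtain ⟨I, hAI, hcard, hI⟩ := ih (by omega)
    have hne : Iᶜ.Nonempty := by
      rw [← Finset.card_pos, Finset.card_compl]
      omega
    obtain ⟨i₀, hi₀, hmin⟩ := Finset.exists_min_image Iᶜ ℓ hne
    rw [Finset.mem_compl] at hi₀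
    refine ⟨insert i₀ I, hAI.trans (Finset.subset_insert _ _), ?_, fun i hi hiA j hj => ?_⟩
    · rw [Finset.card_insert_of_notMem hi₀, hcard]
    · rw [Finset.mem_insert, not_or] at hj
      rcases Finset.mem_insert.1 hi with rfl | hi
      · exact hmin j (Finset.mem_compl.2 hj.2)
      · exact hI i hi hiA j hj.2

/-- A random convex program: minimize `f` over `K` subject to random constraints
`t ω ≤ α ⬝ᵥ s ω`. The label `label ω` breaks ties between inactive constraints, so that exactly
`n` constraints can be singled out even when fewer are active. -/
structure RandomProgram (Ω : Type*) (n : ℕ) where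
  /-- the domain -/
  K : Set (Fin n → ℝ)
  /-- the objective function -/
  f : (Fin n → ℝ) → ℝ
  /-- the normal vector of the half-space -/
  s : Ω → Fin n → ℝ
  /-- the offset of the half-space -/
  t : Ω → ℝ
  /-- the label of the constraint -/
  label : Ω → ℝ

namespace RandomProgram

variable {Ω ι : Type*} {n : ℕ} (R : RandomProgram Ω n)

/-- The standing assumptions on a random program: a compact convex domain, a strictly convex
objective, and a point that satisfies all constraints at once. -/
structure Standing : Prop where
  compact : IsCompact R.K
  convex : Convex ℝ R.K
  strictConvex : StrictConvexOn ℝ univ R.f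
  feasible : ∃ α ∈ R.K, ∀ ω, R.t ω ≤ α ⬝ᵥ R.s ω

/-- The points of the domain that satisfy the constraints in `A`. -/
def feasSet (A : Set Ω) : Set (Fin n → ℝ) :=
  {α | α ∈ R.K ∧ ∀ ω ∈ A, R.t ω ≤ α ⬝ᵥ R.s ω}

/-- The optimizer for the constraints in `A`; a junk value if there is none. -/
noncomputable def sol (A : Set Ω) : Fin n → ℝ :=
  Classical.epsilon fun α => α ∈ R.feasSet A ∧ IsMinOn R.f (R.feasSet A) α

/-- The constraint `ω` is compatible with `A`: it is satisfied by the optimizer for `A`, and its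
label is not smaller than that of any inactive constraint in `A`. -/
def Compatible (A : Set Ω) (ω : Ω) : Prop :=
  R.t ω ≤ R.sol A ⬝ᵥ R.s ω ∧
    ∀ ω' ∈ A, R.t ω' < R.sol A ⬝ᵥ R.s ω' → R.label ω' ≤ R.label ω

/-- The constraints `x` are in general position: none of them is active at an optimizer it does
not enter, and their labels are distinct. -/
structure Nondegenerate (x : ι → Ω) : Prop where
  inactive : ∀ (Q : Finset ι) (j : ι), j ∉ Q → R.sol (x '' Q) ⬝ᵥ R.s (x j) ≠ R.t (x j)
  injective_label : Function.Injective fun i => R.label (x i)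

variable {R}

theorem feasSet_anti {A B : Set Ω} (h : A ⊆ B) : R.feasSet B ⊆ R.feasSet A :=
  fun _ hα => ⟨hα.1, fun ω hω => hα.2 ω (h hω)⟩

theorem isCompact_feasSet (hK : IsCompact R.K) (A : Set Ω) : IsCompact (R.feasSet A) := by
  have hclosed : IsClosed {α : Fin n → ℝ | ∀ ω ∈ A, R.t ω ≤ α ⬝ᵥ R.s ω} := by
    simp only [ofPred_forall]
    exact isClosed_biInter fun ω _ =>
      isClosed_le continuous_const (continuous_id.dotProduct continuous_const)
  exact hK.inter_right hclosed

theorem convex_feasSet (hK : Convex ℝ R.K) (A : Set Ω) : Convex ℝ (R.feasSet A) := by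
  have hconvex : Convex ℝ {α : Fin n → ℝ | ∀ ω ∈ A, R.t ω ≤ α ⬝ᵥ R.s ω} := by
    simp only [ofPred_forall]
    exact convex_iInter₂ fun ω _ =>
      convex_halfSpace_ge ((dotProductBilin ℝ ℝ).flip (R.s ω)).isLinear _
  exact hK.inter hconvex

namespace Standing

variable (hR : R.Standing)
include hR

protected theorem continuous : Continuous R.f :=
  continuousOn_univ.1 (hR.strictConvex.convexOn.continuousOn isOpen_univ)

theorem sol_spec (A : Set Ω) : R.sol A ∈ R.feasSet A ∧ IsMinOn R.f (R.feasSet A) (R.sol A) := by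
  obtain ⟨α₀, hα₀, h⟩ := hR.feasible
  exact Classical.epsilon_spec ((isCompact_feasSet hR.compact A).exists_isMinOn
    ⟨α₀, hα₀, fun ω _ => h ω⟩ hR.continuous.continuousOn)

theorem sol_mem (A : Set Ω) : R.sol A ∈ R.feasSet A := (hR.sol_spec A).1

theorem isMinOn_sol (A : Set Ω) : IsMinOn R.f (R.feasSet A) (R.sol A) := (hR.sol_spec A).2

theorem eq_sol {A : Set Ω} {α : Fin n → ℝ} (hα : α ∈ R.feasSet A)
    (hmin : IsMinOn R.f (R.feasSet A) α) : α = R.sol A :=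
  (hR.strictConvex.subset (subset_univ _) (convex_feasSet hR.convex A)).eq_of_isMinOn hmin
    (hR.isMinOn_sol A) hα (hR.sol_mem A)

theorem sol_eq_of_subset {A B : Set Ω} (h : A ⊆ B) (hmem : R.sol A ∈ R.feasSet B) :
    R.sol A = R.sol B :=
  hR.eq_sol hmem ((hR.isMinOn_sol A).on_subset (feasSet_anti h))

theorem sol_eq_of_subset_of_subset {A B C : Set Ω} (h : A ⊆ B) (h' : B ⊆ C)
    (heq : R.sol A = R.sol C) : R.sol B = R.sol C := by
  rw [← heq]
  exact (hR.sol_eq_of_subset h (heq ▸ feasSet_anti h' (hR.sol_mem C))).symm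

theorem sol_eq_of_inactive {A B : Set Ω} (h : A ⊆ B) (hfin : (B \ A).Finite)
    (hin : ∀ ω ∈ B \ A, R.t ω < R.sol B ⬝ᵥ R.s ω) : R.sol A = R.sol B := by
  have hnhds : ∀ᶠ α in nhds (R.sol B), ∀ ω ∈ B \ A, R.t ω < α ⬝ᵥ R.s ω := by
    refine (Filter.eventually_all_finite hfin).2 fun ω hω => ?_
    exact ((continuous_id.dotProduct continuous_const).tendsto _).eventually_const_lt (hin ω hω)
  have hlocal : IsLocalMinOn R.f (R.feasSet A) (R.sol B) := by
    filter_upwards [hnhds.filter_mono nhdsWithin_le_nhds, self_mem_nhdsWithin] with α hα hαA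
    refine hR.isMinOn_sol B ⟨hαA.1, fun ω hω => ?_⟩
    by_cases hωA : ω ∈ A
    · exact hαA.2 ω hωA
    · exact (hα ω ⟨hω, hωA⟩).le
  have hmem := feasSet_anti h (hR.sol_mem B)
  exact (hR.eq_sol hmem (IsMinOn.of_isLocalMinOn_of_convexOn hmem hlocal
    (hR.strictConvex.convexOn.subset (subset_univ _) (convex_feasSet hR.convex A)))).symm

theorem exists_basis (x : ι → Ω) (Q : Finset ι) :
    ∃ Q' ⊆ Q, Q'.card ≤ n ∧ R.sol (x '' Q') = R.sol (x '' Q) := by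
  have hfeas : ∀ (T : Finset ι) (α : Fin n → ℝ), α ∈ R.feasSet (x '' T) ↔
      α ∈ R.K ∧ α ∈ ⋂ j ∈ T, {α | R.t (x j) ≤ α ⬝ᵥ R.s (x j)} := fun T α => by
    simp [feasSet]
  have hbetter : Convex ℝ {α | α ∈ R.K ∧ R.f α < R.f (R.sol (x '' Q))} :=
    (hR.strictConvex.convexOn.subset (subset_univ _) hR.convex).convex_lt _
  obtain ⟨α₀, -, h₀⟩ := hR.feasible
  obtain ⟨Q', hQ', hcard, hdisj⟩ := exists_subset_card_le_finrank_disjoint (s := Q)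
    (F := fun j => {α : Fin n → ℝ | R.t (x j) ≤ α ⬝ᵥ R.s (x j)}) hbetter
    (fun j _ => convex_halfSpace_ge ((dotProductBilin ℝ ℝ).flip (R.s (x j))).isLinear _)
    ⟨α₀, mem_iInter₂.2 fun j _ => h₀ (x j)⟩
    (disjoint_left.2 fun α hα hαQ => hα.2.not_ge (hR.isMinOn_sol _ ((hfeas Q α).2 ⟨hα.1, hαQ⟩)))
  refine ⟨Q', hQ', by simpa using hcard, (hR.eq_sol (feasSet_anti (image_mono hQ')
    (hR.sol_mem _)) fun α hα => ?_).symm⟩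
  obtain ⟨hαK, hαQ'⟩ := (hfeas Q' α).1 hα
  exact not_lt.1 fun hlt => disjoint_left.1 hdisj ⟨hαK, hlt⟩ hαQ'

theorem sol_eq_of_compatible {x : ι → Ω} {I : Finset ι}
    (hI : ∀ j, j ∉ I → R.Compatible (x '' I) (x j)) : R.sol (x '' I) = R.sol (range x) := by
  refine hR.sol_eq_of_subset (image_subset_range _ _) ⟨(hR.sol_mem _).1, ?_⟩
  rintro _ ⟨j, rfl⟩
  by_cases hj : j ∈ I
  · exact (hR.sol_mem _).2 _ (mem_image_of_mem x hj)
  · exact (hI j hj).1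

end Standing

namespace Nondegenerate

variable {x : ι → Ω} (hx : R.Nondegenerate x) (hR : R.Standing)
include hx hR

theorem lt_of_notMem {Q : Finset ι} (hQ : R.sol (x '' Q) = R.sol (range x)) {j : ι} (hj : j ∉ Q) :
    R.t (x j) < R.sol (range x) ⬝ᵥ R.s (x j) :=
  lt_of_le_of_ne ((hR.sol_mem _).2 _ (mem_range_self j)) fun h =>
    hx.inactive Q j hj (by rw [hQ, h])

theorem eq_of_compatible {I I' : Finset ι} (hcard : I.card = I'.card)
    (hI : ∀ j, j ∉ I → R.Compatible (x '' I) (x j))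
    (hI' : ∀ j, j ∉ I' → R.Compatible (x '' I') (x j)) : I = I' := by
  by_contra hne
  have hsol := hR.sol_eq_of_compatible hI
  have hsol' := hR.sol_eq_of_compatible hI'
  obtain ⟨i, hi, hiI'⟩ := Finset.not_subset.1 fun h =>
    hne (Finset.eq_of_subset_of_card_le h hcard.ge)
  obtain ⟨i', hi', hi'I⟩ := Finset.not_subset.1 fun h =>
    hne (Finset.eq_of_subset_of_card_le h hcard.le).symm
  have hle : R.label (x i) ≤ R.label (x i') :=
    (hI i' hi'I).2 _ (mem_image_of_mem x hi) (hsol ▸ hx.lt_of_notMem hR hsol' hiI')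
  have hle' : R.label (x i') ≤ R.label (x i) :=
    (hI' i hiI').2 _ (mem_image_of_mem x hi') (hsol' ▸ hx.lt_of_notMem hR hsol hi'I)
  exact hiI' (hx.injective_label (le_antisymm hle hle') ▸ hi')

theorem exists_compatible [Fintype ι] (hn : n ≤ Fintype.card ι) :
    ∃ I : Finset ι, I.card = n ∧ ∀ j, j ∉ I → R.Compatible (x '' I) (x j) := by
  classical
  set A : Finset ι :=
    Finset.univ.filter fun j => R.sol (range x) ⬝ᵥ R.s (x j) = R.t (x j) with hA
  have hAcard : A.card ≤ n := by
    obtain ⟨Q, -, hQcard, hQ⟩ := hR.exists_basis x Finset.univ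
    rw [Finset.coe_univ, image_univ] at hQ
    refine (Finset.card_le_card fun j hj => ?_).trans hQcard
    by_contra hjQ
    exact (hx.lt_of_notMem hR hQ hjQ).ne' (Finset.mem_filter.1 hj).2
  have hAsol : R.sol (x '' A) = R.sol (range x) := by
    refine hR.sol_eq_of_inactive (image_subset_range _ _) ((finite_range x).sdiff) ?_
    rintro _ ⟨⟨j, rfl⟩, hj⟩
    refine lt_of_le_of_ne ((hR.sol_mem _).2 _ (mem_range_self j)) fun h => hj ?_
    exact mem_image_of_mem x (by simp [hA, h])
  obtain ⟨I, hAI, hIcard, hI⟩ := exists_lowest_superset (fun j => R.label (x j)) A hAcard hn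
  have hIsol : R.sol (x '' I) = R.sol (range x) :=
    hR.sol_eq_of_subset_of_subset (image_mono hAI) (image_subset_range _ _) hAsol
  refine ⟨I, hIcard, fun j hj => ⟨hIsol ▸ (hR.sol_mem _).2 _ (mem_range_self j), ?_⟩⟩
  rintro _ ⟨i, hi, rfl⟩ hlt
  refine hI i hi (fun hiA => ?_) j hj
  exact (hIsol ▸ hlt).ne' (Finset.mem_filter.1 hiA).2

theorem existsUnique_compatible [Fintype ι] (hn : n ≤ Fintype.card ι) :
    ∃! I : Finset ι, I.card = n ∧ ∀ j, j ∉ I → R.Compatible (x '' I) (x j) := by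
  obtain ⟨I, hIcard, hI⟩ := hx.exists_compatible hR hn
  exact ⟨I, ⟨hIcard, hI⟩, fun I' hI' =>
    hx.eq_of_compatible hR (hI'.1.trans hIcard.symm) hI'.2 hI⟩

end Nondegenerate

end RandomProgram

/-! ### Product measures -/

section Pi

variable {ι : Type*} [Fintype ι]

theorem pi_eq_zero_of_update [DecidableEq ι] {Ω : ι → Type*} [∀ i, MeasurableSpace (Ω i)]
    {μ : ∀ i, Measure (Ω i)} [∀ i, SigmaFinite (μ i)] {A : Set (∀ i, Ω i)} (hA : MeasurableSet A)
    (j : ι) (h : ∀ x : ∀ i, Ω i, μ j {ω | Function.update x j ω ∈ A} = 0) :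
    Measure.pi μ A = 0 := by
  rcases isEmpty_or_nonempty (∀ i, Ω i) with hΩ | ⟨⟨x₀⟩⟩
  · rw [eq_empty_of_isEmpty A, measure_empty]
  rw [← lintegral_indicator_one hA, lintegral_eq_lmarginal_univ x₀,
    lmarginal_erase' _ (measurable_one.indicator hA) (Finset.mem_univ j)]
  have hslice : ∀ x : ∀ i, Ω i, ∫⁻ ω, A.indicator 1 (Function.update x j ω) ∂μ j = 0 := fun x => by
    rw [← h x]
    exact lintegral_indicator_one (measurable_update x hA)
  simp only [hslice]
  simp [lmarginal]

variable {Ω : Type*} [MeasurableSpace Ω] {μ : Measure Ω} [SigmaFinite μ]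

theorem measurePreserving_split {κ : Type*} [Fintype κ] {p : ι → Prop} [DecidablePred p]
    (e : κ ≃ {j // p j}) :
    MeasurePreserving (fun x : ι → Ω => ((fun i => x (e i) : κ → Ω),
        (fun j => x j : {j // ¬ p j} → Ω)))
      (Measure.pi fun _ => μ) ((Measure.pi fun _ => μ).prod (Measure.pi fun _ => μ)) :=
  ((measurePreserving_piCongrLeft (fun _ : {j // p j} => μ) e).symm.prod
    (MeasurePreserving.id (Measure.pi fun _ : {j // ¬ p j} => μ))).comp
      (measurePreserving_piEquivPiSubtypeProd (fun _ : ι => μ) p)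

theorem pi_setOf_split {κ : Type*} [Fintype κ] {p : ι → Prop}
    (e : κ ≃ {j // p j}) {D : Set (κ → Ω)} (hD : MeasurableSet D) {W : Set ((κ → Ω) × Ω)}
    (hW : MeasurableSet W) :
    Measure.pi (fun _ : ι => μ)
        {x | (fun i => x (e i)) ∈ D ∧ ∀ j, ¬ p j → ((fun i => x (e i)), x j) ∈ W} =
      ∫⁻ y in D, μ {ω | (y, ω) ∈ W} ^ (Fintype.card ι - Fintype.card κ)
        ∂(Measure.pi fun _ => μ) := by
  classical
  set T : Set ((κ → Ω) × ({j // ¬ p j} → Ω)) :=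
    {q | q.1 ∈ D ∧ ∀ j, (q.1, q.2 j) ∈ W} with hT
  have hTm : MeasurableSet T := by
    rw [hT, ofPred_and, ofPred_forall]
    exact (measurable_fst hD).inter (MeasurableSet.iInter fun j =>
      (measurable_fst.prodMk ((measurable_pi_apply j).comp measurable_snd)) hW)
  have hpre := (measurePreserving_split (μ := μ) e).measure_preimage hTm.nullMeasurableSet
  have hpreimage : (fun x : ι → Ω =>
        ((fun i => x (e i) : κ → Ω), (fun j => x j : {j // ¬ p j} → Ω))) ⁻¹' T =
      {x | (fun i => x (e i)) ∈ D ∧ ∀ j, ¬ p j → ((fun i => x (e i)), x j) ∈ W} := by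
    ext x
    simp [hT]
  rw [← hpreimage, hpre, Measure.prod_apply hTm, ← lintegral_indicator hD]
  refine lintegral_congr fun y => ?_
  by_cases hy : y ∈ D
  · have hslice : Prod.mk y ⁻¹' T = univ.pi fun _ : {j // ¬ p j} => {ω | (y, ω) ∈ W} := by
      ext z
      simp [hT, hy]
    rw [indicator_of_mem hy, hslice, Measure.pi_pi, Finset.prod_const, Finset.card_univ,
      Fintype.card_subtype_compl, ← Fintype.card_congr e]
  · have hslice : Prod.mk y ⁻¹' T = ∅ := by
      ext z
      simp [hT, hy]
    rw [indicator_of_notMem hy, hslice, measure_empty]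

end Pi

theorem sum_measure_eq_one_of_ae_existsUnique {Ω ι : Type*} [MeasurableSpace Ω] {ν : Measure Ω}
    [IsProbabilityMeasure ν] {s : Finset ι} {G : ι → Set Ω} (hG : ∀ i, MeasurableSet (G i))
    (h : ∀ᵐ x ∂ν, ∃! i, i ∈ s ∧ x ∈ G i) : ∑ i ∈ s, ν (G i) = 1 := by
  have hdisj : (s : Set ι).Pairwise (Function.onFun (AEDisjoint ν) G) := by
    intro i hi i' hi' hne
    refine measure_mono_null (fun x hx => ?_) (ae_iff.1 h)
    exact fun hunique => hne (hunique.unique ⟨hi, hx.1⟩ ⟨hi', hx.2⟩)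
  rw [← measure_biUnion_finset₀ hdisj fun i _ => (hG i).nullMeasurableSet,
    ← measure_univ (μ := ν)]
  refine measure_congr (Filter.eventuallyEq_univ.2 ?_)
  filter_upwards [h] with x ⟨i, hi, _⟩
  exact mem_biUnion hi.1 hi.2

namespace RandomProgram

variable {Ω ι : Type*} {n : ℕ} {R : RandomProgram Ω n}

theorem Standing.sol_mem_iff (hR : R.Standing) {A : Set Ω} {F : Set (Fin n → ℝ)}
    (hF : IsClosed F) : R.sol A ∈ F ↔ ∀ r : ℚ, (∃ α ∈ R.feasSet A ∩ univ, R.f α ≤ r) →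
      ∃ α ∈ R.feasSet A ∩ F, R.f α ≤ r := by
  refine ⟨fun hsol r ⟨α, hα, hαr⟩ =>
    ⟨R.sol A, ⟨hR.sol_mem A, hsol⟩, (hR.isMinOn_sol A hα.1).trans hαr⟩, fun h => ?_⟩
  have hlevel : ∀ r : ℚ, R.f (R.sol A) < r → ∃ α ∈ R.feasSet A ∩ F, R.f α ≤ r := fun r hr =>
    h r ⟨R.sol A, ⟨hR.sol_mem A, mem_univ _⟩, hr.le⟩
  obtain ⟨r₀, hr₀⟩ := exists_rat_gt (R.f (R.sol A))
  obtain ⟨α₀, hα₀, -⟩ := hlevel r₀ hr₀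
  obtain ⟨α, hα, hmin⟩ := ((isCompact_feasSet hR.compact A).inter_right hF).exists_isMinOn ⟨α₀, hα₀⟩
    hR.continuous.continuousOn
  have hle : R.f α ≤ R.f (R.sol A) := by
    by_contra! hlt
    obtain ⟨r, hr, hrα⟩ := exists_rat_btwn hlt
    obtain ⟨α', hα', hα'r⟩ := hlevel r hr
    exact (hrα.trans_le (hmin hα')).not_ge hα'r
  rw [← hR.eq_sol hα.1 fun α' hα' => hle.trans (hR.isMinOn_sol A hα')]
  exact hα.2

variable [MeasurableSpace Ω]

variable (R) in
/-- Measurability of the random data. -/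
structure IsMeasurable : Prop where
  s : Measurable R.s
  t : Measurable R.t
  label : Measurable R.label

theorem measurable_dot {β : Type*} [MeasurableSpace β] {u v : β → Fin n → ℝ} (hu : Measurable u)
    (hv : Measurable v) : Measurable fun a => u a ⬝ᵥ v a := by
  unfold dotProduct
  fun_prop

namespace Standing

variable (hR : R.Standing) (hm : R.IsMeasurable)
include hR hm

theorem measurableSet_exists_mem_feasSet (Q : Finset ι) {F : Set (Fin n → ℝ)} (hF : IsClosed F)
    (r : ℝ) : MeasurableSet {x : ι → Ω | ∃ α ∈ R.feasSet (x '' Q) ∩ F, R.f α ≤ r} := by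
  have hcompact : CompactSpace ↥(R.K ∩ F) :=
    isCompact_iff_compactSpace.1 (hR.compact.inter_right hF)
  have hclosed : IsClosed {q : ↥(R.K ∩ F) × (Q → (Fin n → ℝ) × ℝ) |
      R.f q.1 ≤ r ∧ ∀ j, (q.2 j).2 ≤ (q.1 : Fin n → ℝ) ⬝ᵥ (q.2 j).1} := by
    have hf := hR.continuous
    simp only [ofPred_and, ofPred_forall]
    refine (isClosed_le (by fun_prop) continuous_const).inter (isClosed_iInter fun j => ?_)
    exact isClosed_le (by fun_prop) (Continuous.dotProduct (by fun_prop) (by fun_prop))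
  have hdata : Measurable fun (x : ι → Ω) (j : Q) => (R.s (x j), R.t (x j)) :=
    measurable_pi_lambda _ fun j =>
      (hm.s.comp (measurable_pi_apply _)).prodMk (hm.t.comp (measurable_pi_apply _))
  convert (isClosedMap_snd_of_compactSpace _ hclosed).measurableSet.preimage hdata using 1
  ext x
  constructor
  · rintro ⟨α, ⟨⟨hK, hQ⟩, hαF⟩, hr⟩
    exact ⟨(⟨α, hK, hαF⟩, _), ⟨hr, fun j => hQ _ (mem_image_of_mem x j.2)⟩, rfl⟩
  · rintro ⟨⟨α, -⟩, ⟨hr, hQ⟩, rfl⟩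
    exact ⟨α, ⟨⟨α.2.1, forall_mem_image.2 fun j hj => hQ ⟨j, hj⟩⟩, α.2.2⟩, hr⟩

theorem measurable_sol (Q : Finset ι) : Measurable fun x : ι → Ω => R.sol (x '' Q) := by
  refine measurable_of_isClosed fun F hF => ?_
  simp only [preimage, hR.sol_mem_iff hF, imp_iff_not_or, ofPred_forall, ofPred_or]
  exact MeasurableSet.iInter fun r =>
    (hR.measurableSet_exists_mem_feasSet hm Q isClosed_univ r).compl.union
      (hR.measurableSet_exists_mem_feasSet hm Q hF r)

theorem measurableSet_compatible (Q : Finset ι) :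
    MeasurableSet {p : (ι → Ω) × Ω | R.Compatible (p.1 '' Q) p.2} := by
  have hsol : Measurable fun p : (ι → Ω) × Ω => R.sol (p.1 '' Q) :=
    (hR.measurable_sol hm Q).comp measurable_fst
  have hx : ∀ i, Measurable fun p : (ι → Ω) × Ω => p.1 i := fun i =>
    (measurable_pi_apply i).comp measurable_fst
  simp only [Compatible, forall_mem_image, Finset.mem_coe, ofPred_and, ofPred_forall]
  refine (measurableSet_le (hm.t.comp measurable_snd)
    (measurable_dot hsol (hm.s.comp measurable_snd))).inter ?_
  refine Finset.measurableSet_biInter Q fun i _ => ?_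
  simp only [imp_iff_not_or, ofPred_or]
  exact (measurableSet_lt (hm.t.comp (hx i))
    (measurable_dot hsol (hm.s.comp (hx i)))).compl.union
      (measurableSet_le (hm.label.comp (hx i)) (hm.label.comp measurable_snd))

theorem measurableSet_forall_compatible [Finite ι] (I : Finset ι) :
    MeasurableSet {x : ι → Ω | ∀ j, j ∉ I → R.Compatible (x '' I) (x j)} := by
  simp only [ofPred_forall]
  exact MeasurableSet.iInter fun j => MeasurableSet.iInter fun _ =>
    (measurable_id.prodMk (measurable_pi_apply j)) (hR.measurableSet_compatible hm I)

end Standing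

variable {μ : Measure Ω} [IsProbabilityMeasure μ] [Fintype ι]

theorem Standing.ae_sol_dotProduct_ne (hR : R.Standing) (hm : R.IsMeasurable)
    (hnd : ∀ α : Fin n → ℝ, μ {ω | α ⬝ᵥ R.s ω = R.t ω} = 0) {Q : Finset ι} {j : ι} (hj : j ∉ Q) :
    ∀ᵐ x ∂Measure.pi fun _ : ι => μ, R.sol (x '' Q) ⬝ᵥ R.s (x j) ≠ R.t (x j) := by
  classical
  rw [ae_iff]
  simp only [ne_eq, not_not]
  refine pi_eq_zero_of_update (measurableSet_eq_fun
    (measurable_dot (hR.measurable_sol hm Q) (hm.s.comp (measurable_pi_apply j)))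
    (hm.t.comp (measurable_pi_apply j))) j fun x => ?_
  have himage : ∀ ω, Function.update x j ω '' Q = x '' Q := fun ω =>
    image_congr fun i hi => Function.update_of_ne (ne_of_mem_of_not_mem hi hj) _ _
  simp only [mem_ofPred_eq, himage, Function.update_self]
  exact hnd _

theorem IsMeasurable.ae_label_ne (hm : R.IsMeasurable) (hlab : ∀ r, μ {ω | R.label ω = r} = 0)
    {i j : ι} (hij : i ≠ j) :
    ∀ᵐ x ∂Measure.pi fun _ : ι => μ, R.label (x i) ≠ R.label (x j) := by
  classical
  rw [ae_iff]
  simp only [ne_eq, not_not]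
  refine pi_eq_zero_of_update (measurableSet_eq_fun (hm.label.comp (measurable_pi_apply i))
    (hm.label.comp (measurable_pi_apply j))) i fun x => ?_
  simp only [mem_ofPred_eq, Function.update_self, Function.update_of_ne hij.symm]
  exact hlab _

theorem Standing.ae_nondegenerate (hR : R.Standing) (hm : R.IsMeasurable)
    (hnd : ∀ α : Fin n → ℝ, μ {ω | α ⬝ᵥ R.s ω = R.t ω} = 0)
    (hlab : ∀ r, μ {ω | R.label ω = r} = 0) :
    ∀ᵐ x ∂Measure.pi fun _ : ι => μ, R.Nondegenerate x := by
  have hinactive : ∀ᵐ x ∂Measure.pi fun _ : ι => μ, ∀ (Q : Finset ι) (j : ι), j ∉ Q →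
      R.sol (x '' Q) ⬝ᵥ R.s (x j) ≠ R.t (x j) := by
    simp only [ae_all_iff]
    exact fun Q j hj => hR.ae_sol_dotProduct_ne hm hnd hj
  have hlabel : ∀ᵐ x ∂Measure.pi fun _ : ι => μ, ∀ i j, i ≠ j →
      R.label (x i) ≠ R.label (x j) := by
    simp only [ae_all_iff]
    exact fun i j hij => hm.ae_label_ne hlab hij
  filter_upwards [hinactive, hlabel] with x hx hx'
  exact ⟨hx, fun i j h => not_imp_comm.1 (hx' i j) (not_not.2 h)⟩

/-! ### The violation probability in general position -/

variable {Ω ι : Type*} {n : ℕ} {R : RandomProgram Ω n} [MeasurableSpace Ω] {μ : Measure Ω}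

variable (R μ) in
/-- The probability that a random constraint is compatible with the `n` constraints `y`. -/
noncomputable def compatProb (y : Fin n → Ω) : ℝ := μ.real {ω | R.Compatible (range y) ω}

variable (R μ) in
/-- The law of `compatProb` for `n` independent constraints. -/
noncomputable def compatLaw : Measure ℝ :=
  (Measure.pi fun _ : Fin n => μ).map (R.compatProb μ)

theorem Standing.measurableSet_compatible_range (hR : R.Standing) (hm : R.IsMeasurable) :
    MeasurableSet {p : (Fin n → Ω) × Ω | R.Compatible (range p.1) p.2} := by
  simpa using hR.measurableSet_compatible hm (Finset.univ : Finset (Fin n))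

variable [IsProbabilityMeasure μ]

theorem compatProb_mem_Icc (y : Fin n → Ω) : R.compatProb μ y ∈ Icc (0 : ℝ) 1 :=
  ⟨measureReal_nonneg, measureReal_le_one⟩

namespace Standing

variable (hR : R.Standing) (hm : R.IsMeasurable)
include hR hm

theorem measurable_compatProb : Measurable (R.compatProb μ) :=
  (measurable_measure_prodMk_left (ν := μ) (hR.measurableSet_compatible_range hm)).ennreal_toReal

theorem isProbabilityMeasure_compatLaw : IsProbabilityMeasure (R.compatLaw μ) :=
  Measure.isProbabilityMeasure_map (hR.measurable_compatProb hm).aemeasurable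

theorem ae_compatLaw_mem_Icc : ∀ᵐ u ∂(R.compatLaw μ), u ∈ Icc (0 : ℝ) 1 :=
  (ae_map_iff (hR.measurable_compatProb hm).aemeasurable measurableSet_Icc).2
    (Filter.Eventually.of_forall compatProb_mem_Icc)

theorem setLIntegral_compatProb_pow {D : Set ℝ} (hD : MeasurableSet D) (k : ℕ) :
    ∫⁻ y in R.compatProb μ ⁻¹' D, μ {ω | R.Compatible (range y) ω} ^ k
        ∂(Measure.pi fun _ : Fin n => μ) =
      ENNReal.ofReal (∫ u in D, u ^ k ∂(R.compatLaw μ)) := by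
  have hp := hR.measurable_compatProb (μ := μ) hm
  have hnonneg : ∀ y, 0 ≤ R.compatProb μ y ^ k := fun y => pow_nonneg (compatProb_mem_Icc y).1 k
  rw [compatLaw, setIntegral_map hD (by fun_prop) hp.aemeasurable,
    ofReal_integral_eq_lintegral_ofReal _ (Filter.Eventually.of_forall hnonneg)]
  · refine lintegral_congr fun y => ?_
    rw [ENNReal.ofReal_pow (compatProb_mem_Icc y).1, compatProb, ofReal_measureReal]
  · refine Integrable.of_bound (hp.pow_const k).aestronglyMeasurable 1
      (Filter.Eventually.of_forall fun y => ?_)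
    rw [Real.norm_of_nonneg (hnonneg y)]
    exact pow_le_one₀ (compatProb_mem_Icc y).1 (compatProb_mem_Icc y).2

theorem pi_setOf_compatible [Fintype ι] {I : Finset ι} (hI : I.card = n) {D : Set ℝ}
    (hD : MeasurableSet D) :
    Measure.pi (fun _ : ι => μ) {x | μ.real {ω | R.Compatible (x '' I) ω} ∈ D ∧
        ∀ j, j ∉ I → R.Compatible (x '' I) (x j)} =
      ENNReal.ofReal (∫ u in D, u ^ (Fintype.card ι - n) ∂(R.compatLaw μ)) := by
  set e : Fin n ≃ {j // j ∈ I} := (I.equivFinOfCardEq hI).symm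
  have himage : ∀ x : ι → Ω, x '' I = range fun i => x (e i) := fun x => by
    rw [range_comp' x fun i => (e i : ι), range_comp' Subtype.val e, e.range_eq_univ, image_univ,
      Subtype.range_coe_subtype]
    rfl
  simp only [himage]
  have hsplit := pi_setOf_split (μ := μ) e (hR.measurable_compatProb (μ := μ) hm hD)
    (hR.measurableSet_compatible_range hm)
  simp only [mem_ofPred_eq, Fintype.card_fin] at hsplit
  rw [← hR.setLIntegral_compatProb_pow hm hD, ← hsplit]
  rfl

variable (hnd : ∀ α : Fin n → ℝ, μ {ω | α ⬝ᵥ R.s ω = R.t ω} = 0)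
  (hlab : ∀ r, μ {ω | R.label ω = r} = 0)
include hnd hlab

/-- Almost surely exactly one `n`-element subset of `n + k` independent constraints is compatible
with all the others, and by symmetry each subset is the one with the same probability. -/
theorem choose_mul_integral_compatLaw (k : ℕ) :
    ((n + k).choose n : ℝ) * ∫ u, u ^ k ∂(R.compatLaw μ) = 1 := by
  have hprob : ∀ I ∈ Finset.powersetCard n (Finset.univ : Finset (Fin (n + k))),
      Measure.pi (fun _ : Fin (n + k) => μ) {x | ∀ j, j ∉ I → R.Compatible (x '' I) (x j)} =
        ENNReal.ofReal (∫ u, u ^ k ∂(R.compatLaw μ)) := by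
    intro I hI
    simpa using hR.pi_setOf_compatible (μ := μ) hm (Finset.mem_powersetCard.1 hI).2 .univ
  have hsum := sum_measure_eq_one_of_ae_existsUnique
    (ν := Measure.pi fun _ : Fin (n + k) => μ) (s := Finset.powersetCard n Finset.univ)
    (fun I => hR.measurableSet_forall_compatible hm I) (by
      filter_upwards [hR.ae_nondegenerate hm hnd hlab] with x hx
      simpa [Finset.mem_powersetCard] using hx.existsUnique_compatible hR (by simp))
  rw [Finset.sum_congr rfl hprob, Finset.sum_const, Finset.card_powersetCard, Finset.card_univ,
    Fintype.card_fin, nsmul_eq_mul, ← ENNReal.ofReal_natCast,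
    ← ENNReal.ofReal_mul (Nat.cast_nonneg _), ENNReal.ofReal_eq_one] at hsum
  exact hsum

theorem ae_violation_subset [Fintype ι] (hn : n ≤ Fintype.card ι) {ε : ℝ} :
    ∀ᵐ x ∂Measure.pi fun _ : ι => μ, ε < μ.real {ω | R.sol (range x) ⬝ᵥ R.s ω < R.t ω} →
      ∃ I : Finset ι, I.card = n ∧ μ.real {ω | R.Compatible (x '' I) ω} ∈ Iio (1 - ε) ∧
        ∀ j, j ∉ I → R.Compatible (x '' I) (x j) := by
  filter_upwards [hR.ae_nondegenerate hm hnd hlab] with x hx hε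
  obtain ⟨I, hIcard, hI⟩ := hx.exists_compatible hR hn
  refine ⟨I, hIcard, ?_, hI⟩
  have hsub : {ω | R.sol (range x) ⬝ᵥ R.s ω < R.t ω} ⊆ {ω | R.Compatible (x '' I) ω}ᶜ :=
    fun ω hω hωI => ((hR.sol_eq_of_compatible hI).symm ▸ hω).not_ge hωI.1
  have hmeas : MeasurableSet {ω | R.Compatible (x '' I) ω} :=
    measurable_prodMk_left (hR.measurableSet_compatible hm I)
  have hlt := hε.trans_le (measureReal_mono (μ := μ) hsub)
  rw [probReal_compl_eq_one_sub hmeas] at hlt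
  rw [mem_Iio]
  linarith

theorem measure_violation_le_of_nondegenerate [Fintype ι] (hn : 1 ≤ n)
    (hnι : n ≤ Fintype.card ι) {ε : ℝ} (hε : 0 ≤ ε) (hε1 : ε ≤ 1) :
    Measure.pi (fun _ : ι => μ) {x | ε < μ.real {ω | R.sol (range x) ⬝ᵥ R.s ω < R.t ω}} ≤
      ENNReal.ofReal (binTail n (Fintype.card ι) ε) := by
  have := hR.isProbabilityMeasure_compatLaw (μ := μ) hm
  calc Measure.pi (fun _ : ι => μ) {x | ε < μ.real {ω | R.sol (range x) ⬝ᵥ R.s ω < R.t ω}}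
      ≤ Measure.pi (fun _ : ι => μ) (⋃ I ∈ Finset.powersetCard n (Finset.univ : Finset ι),
          {x | μ.real {ω | R.Compatible (x '' I) ω} ∈ Iio (1 - ε) ∧
            ∀ j, j ∉ I → R.Compatible (x '' I) (x j)}) := by
        refine measure_mono_ae ?_
        filter_upwards [hR.ae_violation_subset hm hnd hlab hnι (ε := ε)] with x hx hxε
        obtain ⟨I, hIcard, hI⟩ := hx hxε
        exact mem_biUnion (by simpa using hIcard) hI
    _ ≤ ∑ _I ∈ Finset.powersetCard n (Finset.univ : Finset ι),
          ENNReal.ofReal (∫ u in Iio (1 - ε), u ^ (Fintype.card ι - n) ∂(R.compatLaw μ)) := by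
        refine (measure_biUnion_finset_le _ _).trans_eq (Finset.sum_congr rfl fun _ hI => ?_)
        exact hR.pi_setOf_compatible hm (Finset.mem_powersetCard.1 hI).2 measurableSet_Iio
    _ = ENNReal.ofReal (binTail n (Fintype.card ι) ε) := by
        rw [Finset.sum_const, Finset.card_powersetCard, Finset.card_univ, nsmul_eq_mul,
          ← ENNReal.ofReal_natCast, ← ENNReal.ofReal_mul (Nat.cast_nonneg _),
          choose_mul_setIntegral_eq_binTail_of_moments (hR.ae_compatLaw_mem_Icc hm) hn
            (hR.choose_mul_integral_compatLaw hm hnd hlab) hnι hε hε1]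

end Standing

end RandomProgram

section Perturbation

open Filter Topology

/-! ### Perturbation of random programs -/

theorem eventually_lt_measure {α : Type*} [MeasurableSpace α] {ν : Measure α} {A : Set α}
    {s : ℕ → Set α} (h : ∀ a ∈ A, ∀ᶠ k in atTop, a ∈ s k) {c : ENNReal} (hc : c < ν A) :
    ∀ᶠ k in atTop, c < ν (s k) := by
  have hmono : Monotone fun m => ⋂ k ≥ m, s k := fun m m' hmm' =>
    biInter_subset_biInter_left fun k (hk : m' ≤ k) => hmm'.trans hk
  have hsub : A ⊆ ⋃ m, ⋂ k ≥ m, s k := fun a ha => by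
    obtain ⟨m, hm⟩ := eventually_atTop.1 (h a ha)
    exact mem_iUnion.2 ⟨m, mem_iInter₂.2 hm⟩
  have hsup : c < ⨆ m, ν (⋂ k ≥ m, s k) := by
    rw [← hmono.measure_iUnion]
    exact hc.trans_le (measure_mono hsub)
  obtain ⟨m, hm⟩ := lt_iSup_iff.1 hsup
  filter_upwards [eventually_ge_atTop m] with k hk
  exact hm.trans_le (measure_mono (biInter_subset_of_mem hk))

theorem measure_le_of_eventually {α : Type*} [MeasurableSpace α] {ν : Measure α} {A : Set α}
    {s : ℕ → Set α} (h : ∀ a ∈ A, ∀ᶠ k in atTop, a ∈ s k) {c : ENNReal}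
    (hc : ∀ k, ν (s k) ≤ c) : ν A ≤ c := by
  by_contra! hlt
  obtain ⟨k, hk⟩ := (eventually_lt_measure h hlt).exists
  exact (hc k).not_gt hk

theorem eventually_lt_measureReal {α : Type*} [MeasurableSpace α] {ν : Measure α}
    [IsFiniteMeasure ν] {A : Set α} {s : ℕ → Set α} (h : ∀ a ∈ A, ∀ᶠ k in atTop, a ∈ s k) {c : ℝ}
    (hc0 : 0 ≤ c) (hc : c < ν.real A) : ∀ᶠ k in atTop, c < ν.real (s k) := by
  simp only [measureReal_def, ← ENNReal.ofReal_lt_iff_lt_toReal hc0 (measure_ne_top _ _)] at hc ⊢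
  exact eventually_lt_measure h hc

theorem prod_eq_zero_of_subsingleton {α β : Type*} [MeasurableSpace α] [MeasurableSpace β]
    {μ : Measure α} {ν : Measure β} [SFinite ν] [NullSingletonClass ν] {A : Set (α × β)}
    (hA : MeasurableSet A) (h : ∀ a, (Prod.mk a ⁻¹' A).Subsingleton) : μ.prod ν A = 0 :=
  (Measure.measure_prod_null hA).2 (Eventually.of_forall fun a => (h a).measure_zero ν)

theorem tendsto_of_isMinOn {X κ : Type*} [TopologicalSpace X] {l : Filter κ} {K : Set X}
    (hK : IsCompact K) {F : κ → X → ℝ} {f : X → ℝ}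
    (hF : ∀ x, Tendsto (fun p : κ × X => F p.1 p.2) (l ×ˢ 𝓝 x) (𝓝 (f x)))
    {S : κ → Set X} {S₀ : Set X} (hsub : ∀ k, S₀ ⊆ S k)
    (hlim : ∀ x ∈ K, x ∉ S₀ → ∀ᶠ p : κ × X in l ×ˢ 𝓝 x, p.2 ∉ S p.1) {α : κ → X}
    (hαK : ∀ k, α k ∈ K) (hα : ∀ k, α k ∈ S k) (hmin : ∀ k, IsMinOn (F k) (S k) (α k)) {β : X}
    (huniq : ∀ x ∈ S₀, IsMinOn f S₀ x → x = β) : Tendsto α l (𝓝 β) := by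
  refine (tendsto_iff_ultrafilter _ _ _).2 fun U hU => ?_
  obtain ⟨x, hxK, hx⟩ := hK.ultrafilter_le_nhds' (U.map α) (Ultrafilter.mem_map.2 (univ_mem' hαK))
  have hpair : Tendsto (fun k => (k, α k)) U (l ×ˢ 𝓝 x) := Tendsto.prodMk hU hx
  suffices x = β from this ▸ hx
  refine huniq x ?_ fun y hy => ?_
  · by_contra hxS
    obtain ⟨k, hk⟩ := (hpair.eventually (hlim x hxK hxS)).exists
    exact hk (hα k)
  · have hconst : Tendsto (fun k => (k, y)) U (l ×ˢ 𝓝 y) := Tendsto.prodMk hU tendsto_const_nhds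
    exact le_of_tendsto_of_tendsto' ((hF x).comp hpair) ((hF y).comp hconst) fun k =>
      hmin k (hsub k hy)

namespace RandomProgram

variable {Ω ι : Type*} {n : ℕ}

/-- The program whose constraints are relaxed by a random amount in `[0, σ]`, which also serves as
the label. Its constraints are almost surely in general position. -/
def relax (R : RandomProgram Ω n) (σ : ℝ) : RandomProgram (Ω × unitInterval) n where
  K := R.K
  f := R.f
  s p := R.s p.1
  t p := R.t p.1 - σ * p.2
  label p := p.2

variable {R : RandomProgram Ω n}

theorem Standing.relax (hR : R.Standing) {σ : ℝ} (hσ : 0 ≤ σ) : (R.relax σ).Standing where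
  compact := hR.compact
  convex := hR.convex
  strictConvex := hR.strictConvex
  feasible := by
    obtain ⟨α, hα, h⟩ := hR.feasible
    exact ⟨α, hα, fun p => (sub_le_self _ (mul_nonneg hσ p.2.2.1)).trans (h p.1)⟩

theorem Standing.tendsto_sol_relax (hR : R.Standing) {σ : ℕ → ℝ} (hσ : ∀ k, 0 ≤ σ k)
    (hlim : Tendsto σ atTop (𝓝 0)) (x : ι → Ω × unitInterval) :
    Tendsto (fun k => (R.relax (σ k)).sol (range x)) atTop
      (𝓝 (R.sol (range fun i => (x i).1))) := by
  refine tendsto_of_isMinOn hR.compact (F := fun _ => R.f)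
    (fun α => (hR.continuous.tendsto α).comp tendsto_snd)
    (S := fun k => (R.relax (σ k)).feasSet (range x)) (fun k α hα => ⟨hα.1, ?_⟩)
    (fun α hαK hα => ?_) (fun k => ((hR.relax (hσ k)).sol_mem _).1)
    (fun k => (hR.relax (hσ k)).sol_mem _) (fun k => (hR.relax (hσ k)).isMinOn_sol _)
    fun α hα hmin => hR.eq_sol hα hmin
  · rintro _ ⟨i, rfl⟩
    exact (sub_le_self _ (mul_nonneg (hσ k) (x i).2.2.1)).trans (hα.2 _ (mem_range_self i))
  · obtain ⟨i, hi⟩ : ∃ i, α ⬝ᵥ R.s (x i).1 < R.t (x i).1 := by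
      by_contra! h
      exact hα ⟨hαK, forall_mem_range.2 h⟩
    have hoffset : Tendsto (fun k => R.t (x i).1 - σ k * (x i).2) atTop (𝓝 (R.t (x i).1)) := by
      simpa using (hlim.mul_const ((x i).2 : ℝ)).const_sub (R.t (x i).1)
    have hdot : Tendsto (fun γ : Fin n → ℝ => γ ⬝ᵥ R.s (x i).1) (𝓝 α)
        (𝓝 (α ⬝ᵥ R.s (x i).1)) := (continuous_id.dotProduct continuous_const).tendsto α
    filter_upwards [(hdot.comp tendsto_snd).eventually_lt (hoffset.comp tendsto_fst) hi]
      with p hp hmem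
    exact (hmem.2 _ (mem_range_self i)).not_gt hp

variable [MeasurableSpace Ω]

theorem IsMeasurable.relax (hm : R.IsMeasurable) (σ : ℝ) : (R.relax σ).IsMeasurable where
  s := hm.s.comp measurable_fst
  t := (hm.t.comp measurable_fst).sub ((measurable_subtype_coe.comp measurable_snd).const_mul σ)
  label := measurable_subtype_coe.comp measurable_snd

theorem IsMeasurable.measure_relax_active (hm : R.IsMeasurable) (μ : Measure Ω) {σ : ℝ}
    (hσ : σ ≠ 0) (α : Fin n → ℝ) :
    μ.prod volume {p | α ⬝ᵥ (R.relax σ).s p = (R.relax σ).t p} = 0 := by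
  refine prod_eq_zero_of_subsingleton
    (measurableSet_eq_fun (measurable_dot measurable_const (hm.relax σ).s) (hm.relax σ).t)
    fun ω u hu v hv => Subtype.ext (mul_left_cancel₀ hσ ?_)
  exact sub_right_injective (hu.symm.trans hv)

theorem IsMeasurable.measure_relax_label (hm : R.IsMeasurable) (μ : Measure Ω) (σ r : ℝ) :
    μ.prod volume {p | (R.relax σ).label p = r} = 0 :=
  prod_eq_zero_of_subsingleton ((hm.relax σ).label (measurableSet_singleton r))
    fun _ _ hu _ hv => Subtype.ext (hu.trans (Eq.symm hv))

theorem Standing.measurableSet_violation (hR : R.Standing) (hm : R.IsMeasurable) (μ : Measure Ω)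
    [SFinite μ] [Finite ι] (ε : ℝ) :
    MeasurableSet {x : ι → Ω | ε < μ.real {ω | R.sol (range x) ⬝ᵥ R.s ω < R.t ω}} := by
  have := Fintype.ofFinite ι
  have hsol : Measurable fun x : ι → Ω => R.sol (range x) := by
    simpa using hR.measurable_sol (ι := ι) hm Finset.univ
  exact measurableSet_lt measurable_const (measurable_measure_prodMk_left (ν := μ)
    (measurableSet_lt (measurable_dot (hsol.comp measurable_fst) (hm.s.comp measurable_snd))
      (hm.t.comp measurable_snd))).ennreal_toReal

variable {μ : Measure Ω} [IsProbabilityMeasure μ]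

theorem Standing.eventually_lt_violation_relax (hR : R.Standing) (hm : R.IsMeasurable)
    {σ : ℕ → ℝ} (hσ : ∀ k, 0 ≤ σ k) (hlim : Tendsto σ atTop (𝓝 0)) (x : ι → Ω × unitInterval)
    {ε : ℝ} (hε : 0 ≤ ε)
    (hx : ε < μ.real {ω | R.sol (range fun i => (x i).1) ⬝ᵥ R.s ω < R.t ω}) :
    ∀ᶠ k in atTop, ε < (μ.prod volume).real
      {p | (R.relax (σ k)).sol (range x) ⬝ᵥ (R.relax (σ k)).s p < (R.relax (σ k)).t p} := by
  have hviol : MeasurableSet {ω | R.sol (range fun i => (x i).1) ⬝ᵥ R.s ω < R.t ω} :=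
    measurableSet_lt (measurable_dot measurable_const hm.s) hm.t
  have hfst := (measurePreserving_fst (μ := μ)
    (ν := (volume : Measure unitInterval))).measureReal_preimage hviol.nullMeasurableSet
  refine eventually_lt_measureReal (fun p hp => ?_) hε (hx.trans_eq hfst.symm)
  have hdot : Tendsto (fun k => (R.relax (σ k)).sol (range x) ⬝ᵥ R.s p.1) atTop
      (𝓝 (R.sol (range fun i => (x i).1) ⬝ᵥ R.s p.1)) :=
    ((continuous_id.dotProduct continuous_const).tendsto _).comp (hR.tendsto_sol_relax hσ hlim x)
  have hoffset : Tendsto (fun k => R.t p.1 - σ k * p.2) atTop (𝓝 (R.t p.1)) := by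
    simpa using (hlim.mul_const (p.2 : ℝ)).const_sub (R.t p.1)
  exact hdot.eventually_lt hoffset hp

variable [Fintype ι]

theorem Standing.measure_violation_le (hR : R.Standing) (hm : R.IsMeasurable) (hn : 1 ≤ n)
    (hnι : n ≤ Fintype.card ι) {ε : ℝ} (hε : 0 ≤ ε) (hε1 : ε ≤ 1) :
    Measure.pi (fun _ : ι => μ) {x | ε < μ.real {ω | R.sol (range x) ⬝ᵥ R.s ω < R.t ω}} ≤
      ENNReal.ofReal (binTail n (Fintype.card ι) ε) := by
  have hσ : ∀ k : ℕ, (0 : ℝ) < 1 / ((k : ℝ) + 1) := fun k => Nat.one_div_pos_of_nat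
  have hfst : MeasurePreserving (fun (x : ι → Ω × unitInterval) i => (x i).1)
      (Measure.pi fun _ => μ.prod volume) (Measure.pi fun _ => μ) :=
    measurePreserving_pi _ _ fun _ => measurePreserving_fst
  rw [← hfst.measure_preimage (hR.measurableSet_violation hm μ ε).nullMeasurableSet]
  refine measure_le_of_eventually (fun x hx => hR.eventually_lt_violation_relax hm
    (fun k => (hσ k).le) tendsto_one_div_add_atTop_nhds_zero_nat x hε hx) fun k => ?_
  exact (hR.relax (hσ k).le).measure_violation_le_of_nondegenerate (hm.relax _)
    (hm.measure_relax_active μ (hσ k).ne') (hm.measure_relax_label μ _) hn hnι hε hε1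

end RandomProgram

theorem ae_pi_forall {ι Ω : Type*} [Fintype ι] [MeasurableSpace Ω] {μ : Measure Ω}
    [SigmaFinite μ] {p : Ω → Prop} (hp : ∀ᵐ ω ∂μ, p ω) :
    ∀ᵐ x ∂(Measure.pi fun _ : ι => μ), ∀ i, p (x i) :=
  eventually_all.2 fun _ => Measure.tendsto_eval_ae_ae.eventually (p := fun ω => p ω) hp

theorem strictConvexOn_mul_dotProduct_self {n : ℕ} {τ : ℝ} (hτ : 0 < τ) :
    StrictConvexOn ℝ univ fun α : Fin n → ℝ => τ * (α ⬝ᵥ α) := by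
  refine ⟨convex_univ, fun u _ v _ huv a b ha hb hab => ?_⟩
  have hpos : 0 < (u - v) ⬝ᵥ (u - v) := by
    have hne : (u - v) ⬝ᵥ (u - v) ≠ 0 := dotProduct_self_eq_zero.not.2 (sub_ne_zero.2 huv)
    exact (Finset.sum_nonneg fun i _ => mul_self_nonneg ((u - v) i)).lt_of_ne' hne
  have hdefect : a * (τ * (u ⬝ᵥ u)) + b * (τ * (v ⬝ᵥ v)) -
      τ * ((a • u + b • v) ⬝ᵥ (a • u + b • v)) = τ * (a * b) * ((u - v) ⬝ᵥ (u - v)) := by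
    obtain rfl : b = 1 - a := by linarith
    simp only [sub_dotProduct, dotProduct_sub, add_dotProduct, dotProduct_add, smul_dotProduct,
      dotProduct_smul, smul_eq_mul, dotProduct_comm v u]
    ring
  exact sub_pos.1 (hdefect ▸ mul_pos (mul_pos hτ (mul_pos ha hb)) hpos)

namespace RandomProgram

variable {Ω ι : Type*} {n : ℕ}

/-- The program with a quadratic regularization of the objective, in which the constraints violated
by the reference point `α₀` are relaxed so that `α₀` becomes feasible. -/
def regularize (R : RandomProgram Ω n) (τ : ℝ) (α₀ : Fin n → ℝ) : RandomProgram Ω n where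
  K := R.K
  f α := R.f α + τ * (α ⬝ᵥ α)
  s := R.s
  t ω := min (R.t ω) (α₀ ⬝ᵥ R.s ω)
  label := R.label

variable {R : RandomProgram Ω n}

theorem standing_regularize (hK : IsCompact R.K) (hKconv : Convex ℝ R.K)
    (hf : ConvexOn ℝ univ R.f) {τ : ℝ} (hτ : 0 < τ) {α₀ : Fin n → ℝ} (hα₀ : α₀ ∈ R.K) :
    (R.regularize τ α₀).Standing where
  compact := hK
  convex := hKconv
  strictConvex := hf.add_strictConvexOn (strictConvexOn_mul_dotProduct_self hτ)
  feasible := ⟨α₀, hα₀, fun _ => min_le_right _ _⟩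

theorem feasSet_regularize (τ : ℝ) {α₀ : Fin n → ℝ} {A : Set Ω}
    (hA : ∀ ω ∈ A, R.t ω ≤ α₀ ⬝ᵥ R.s ω) : (R.regularize τ α₀).feasSet A = R.feasSet A :=
  ext fun α => and_congr_right fun _ => forall₂_congr fun ω hω => by
    simp only [regularize, min_eq_left (hA ω hω)]

theorem tendsto_sol_regularize (hK : IsCompact R.K) (hKconv : Convex ℝ R.K)
    (hf : ConvexOn ℝ univ R.f) {α₀ : Fin n → ℝ} (hα₀ : α₀ ∈ R.K) {A : Set Ω}
    (hA : ∀ ω ∈ A, R.t ω ≤ α₀ ⬝ᵥ R.s ω) {τ : ℕ → ℝ} (hτ : ∀ k, 0 < τ k)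
    (hlim : Tendsto τ atTop (𝓝 0)) {β : Fin n → ℝ}
    (huniq : ∀ α ∈ R.feasSet A, IsMinOn R.f (R.feasSet A) α → α = β) :
    Tendsto (fun k => (R.regularize (τ k) α₀).sol A) atTop (𝓝 β) := by
  have hR := fun k => standing_regularize hK hKconv hf (hτ k) hα₀
  have hmem : ∀ k, (R.regularize (τ k) α₀).sol A ∈ R.feasSet A := fun k =>
    feasSet_regularize (τ k) hA ▸ (hR k).sol_mem A
  refine tendsto_of_isMinOn hK (F := fun k => (R.regularize (τ k) α₀).f) (fun α => ?_)
    (S := fun _ => R.feasSet A) (fun _ => Subset.rfl) (fun α _ hα => ?_) (fun k => (hmem k).1)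
    hmem (fun k => feasSet_regularize (τ k) hA ▸ (hR k).isMinOn_sol A) huniq
  · have hfcont : Continuous R.f := continuousOn_univ.1 (hf.continuousOn isOpen_univ)
    have hsq : Continuous fun γ : Fin n → ℝ => γ ⬝ᵥ γ := continuous_id.dotProduct continuous_id
    simpa [regularize] using ((hfcont.tendsto α).comp tendsto_snd).add
      ((hlim.comp tendsto_fst).mul ((hsq.tendsto α).comp tendsto_snd))
  · exact tendsto_snd.eventually
      ((isCompact_feasSet hK A).isClosed.isOpen_compl.mem_nhds hα)

variable [MeasurableSpace Ω]

theorem IsMeasurable.regularize (hm : R.IsMeasurable) (τ : ℝ) (α₀ : Fin n → ℝ) :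
    (R.regularize τ α₀).IsMeasurable where
  s := hm.s
  t := hm.t.min (measurable_dot measurable_const hm.s)
  label := hm.label

variable {μ : Measure Ω} [IsProbabilityMeasure μ]

theorem eventually_lt_violation_regularize (hK : IsCompact R.K) (hKconv : Convex ℝ R.K)
    (hf : ConvexOn ℝ univ R.f) {α₀ : Fin n → ℝ} (hα₀ : α₀ ∈ R.K)
    (hfeas : ∀ᵐ ω ∂μ, R.t ω ≤ α₀ ⬝ᵥ R.s ω) {A : Set Ω} (hA : ∀ ω ∈ A, R.t ω ≤ α₀ ⬝ᵥ R.s ω)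
    {τ : ℕ → ℝ} (hτ : ∀ k, 0 < τ k) (hlim : Tendsto τ atTop (𝓝 0)) {β : Fin n → ℝ}
    (huniq : ∀ α ∈ R.feasSet A, IsMinOn R.f (R.feasSet A) α → α = β) {ε : ℝ} (hε : 0 ≤ ε)
    (hviol : ε < μ.real {ω | β ⬝ᵥ R.s ω < R.t ω}) :
    ∀ᶠ k in atTop, ε < μ.real {ω | (R.regularize (τ k) α₀).sol A ⬝ᵥ
      (R.regularize (τ k) α₀).s ω < (R.regularize (τ k) α₀).t ω} := by
  have hviol' : ε < μ.real {ω | β ⬝ᵥ R.s ω < min (R.t ω) (α₀ ⬝ᵥ R.s ω)} := by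
    refine hviol.trans_eq (measureReal_congr (eventuallyEq_set.2 ?_))
    filter_upwards [hfeas] with ω hω
    simp only [min_eq_left hω]
  refine eventually_lt_measureReal (fun ω hω => ?_) hε hviol'
  exact (((continuous_id.dotProduct continuous_const).tendsto _).comp
    (tendsto_sol_regularize hK hKconv hf hα₀ hA hτ hlim huniq)).eventually_lt_const hω

variable [Fintype ι]

theorem measure_violation_le_of_ae_unique (hK : IsCompact R.K) (hKconv : Convex ℝ R.K)
    (hf : ConvexOn ℝ univ R.f) (hm : R.IsMeasurable) (hn : 1 ≤ n) (hnι : n ≤ Fintype.card ι)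
    {α₀ : Fin n → ℝ} (hα₀ : α₀ ∈ R.K) (hfeas : ∀ᵐ ω ∂μ, R.t ω ≤ α₀ ⬝ᵥ R.s ω)
    {αN : (ι → Ω) → Fin n → ℝ} (hαN : ∀ᵐ x ∂(Measure.pi fun _ : ι => μ),
      ∀ α ∈ R.feasSet (range x), IsMinOn R.f (R.feasSet (range x)) α → α = αN x)
    {ε : ℝ} (hε : 0 ≤ ε) (hε1 : ε ≤ 1) :
    Measure.pi (fun _ : ι => μ) {x | ε < μ.real {ω | αN x ⬝ᵥ R.s ω < R.t ω}} ≤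
      ENNReal.ofReal (binTail n (Fintype.card ι) ε) := by
  have hτ : ∀ k : ℕ, (0 : ℝ) < 1 / ((k : ℝ) + 1) := fun k => Nat.one_div_pos_of_nat
  have hall : ∀ᵐ x ∂(Measure.pi fun _ : ι => μ), ∀ i, R.t (x i) ≤ α₀ ⬝ᵥ R.s (x i) :=
    ae_pi_forall hfeas
  have hgood : Measure.pi (fun _ : ι => μ) ({x | ε < μ.real {ω | αN x ⬝ᵥ R.s ω < R.t ω}} ∩
      {x | (∀ α ∈ R.feasSet (range x), IsMinOn R.f (R.feasSet (range x)) α → α = αN x) ∧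
        ∀ i, R.t (x i) ≤ α₀ ⬝ᵥ R.s (x i)}) ≤
      ENNReal.ofReal (binTail n (Fintype.card ι) ε) := by
    refine measure_le_of_eventually (fun x hx =>
      eventually_lt_violation_regularize hK hKconv hf hα₀ hfeas (forall_mem_range.2 hx.2.2) hτ
        tendsto_one_div_add_atTop_nhds_zero_nat hx.2.1 hε hx.1) fun k => ?_
    exact (standing_regularize hK hKconv hf (hτ k) hα₀).measure_violation_le
      (hm.regularize _ _) hn hnι hε hε1
  refine (measure_mono_ae ?_).trans hgood
  filter_upwards [hαN, hall] with x huniq hxfeas hx using ⟨hx, huniq, hxfeas⟩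

end RandomProgram

theorem measure_setOf_le_le_of_measure_setOf_lt_le {α : Type*} [MeasurableSpace α] {ν : Measure α}
    {V : α → ℝ} {φ : ℝ → ℝ} (hφ : Continuous φ) {ε : ℝ} (hε : 0 < ε)
    (h : ∀ δ, 0 ≤ δ → δ ≤ ε → ν {x | δ < V x} ≤ ENNReal.ofReal (φ δ)) :
    ν {x | ε ≤ V x} ≤ ENNReal.ofReal (φ ε) := by
  have hlim : Tendsto (fun δ => ENNReal.ofReal (φ δ)) (𝓝[<] ε) (𝓝 (ENNReal.ofReal (φ ε))) :=
    ((ENNReal.continuous_ofReal.comp hφ).tendsto ε).mono_left nhdsWithin_le_nhds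
  refine ge_of_tendsto hlim ?_
  filter_upwards [Ioo_mem_nhdsLT hε] with δ hδ
  exact (measure_mono fun x hx => hδ.2.trans_le hx).trans (h δ hδ.1.le hδ.2.le)

end Perturbation

/-! ### The scenario program -/

theorem mul_rpow_neg_one_div_le {q x d ε : ℝ} (hx : 0 ≤ x) (hd : 0 < d) (hε : 0 < ε)
    (h : (q * ε⁻¹) ^ d ≤ x) : q * x ^ (-1 / d) ≤ ε := by
  rcases le_total q 0 with hq | hq
  · exact (mul_nonpos_of_nonpos_of_nonneg hq (Real.rpow_nonneg hx _)).trans hε.le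
  have hroot : q * ε⁻¹ ≤ x ^ d⁻¹ := (Real.le_rpow_inv_iff_of_pos (by positivity) hx hd).2 h
  rw [neg_div, one_div, Real.rpow_neg hx, ← div_eq_mul_inv]
  rw [← div_eq_mul_inv, div_le_iff₀ hε] at hroot
  exact div_le_of_le_mul₀ (Real.rpow_nonneg hx _) hε.le (hroot.trans_eq (mul_comm _ _))

section Scenario

variable {X C B Y : Type*} [NormedAddCommGroup X] [NormedSpace ℝ X]
  [AddCommGroup C] [Module ℝ C] [NormedAddCommGroup B] [NormedSpace ℝ B]
  [AddCommGroup Y] [Module ℝ Y] {P : Program X C B Y} {S : Scheme X} {n N : ℕ} {γ JLB : ℝ}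

namespace Program

theorem Admissible.inv_smul_mem_sphere (hP : P.Admissible) {y : Y} (hy : y ∈ P.Kstar)
    (hpos : 0 < P.normY y) : (P.normY y)⁻¹ • y ∈ P.sphere := by
  refine ⟨P.Kstar.smul_mem (inv_pos.2 hpos).le hy, le_antisymm ?_ ?_⟩
  · simpa only [inv_mul_cancel₀ hpos.ne'] using hP.normY_smul_le (inv_pos.2 hpos).le y
  · have h := hP.normY_smul_le hpos.le ((P.normY y)⁻¹ • y)
    rw [smul_inv_smul₀ hpos.ne'] at h
    exact (le_mul_iff_one_le_right hpos).1 h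

theorem ExtGenerates.pB_le (hext : P.ExtGenerates) {v : B} {M : ℝ}
    (h : ∀ κ ∈ P.ext, P.pB v κ ≤ M) {y : Y} (hy : y ∈ P.sphere) : P.pB v y ≤ M := by
  have hclosed : IsClosed (X := WeakBilin P.pB.flip) {y : Y | P.pB v y ≤ M} :=
    isClosed_le (WeakBilin.eval_continuous P.pB.flip v) continuous_const
  have hhull : convexHull ℝ P.ext ⊆ {y : Y | P.pB v y ≤ M} :=
    convexHull_min h (convex_halfSpace_le (P.pB v).isLinear M)
  exact closure_minimal (X := WeakBilin P.pB.flip) hhull hclosed (hext hy)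

theorem ExtGenerates.supportFun_ballY_le (hext : P.ExtGenerates) (hP : P.Admissible) {v : B}
    {θ M : ℝ} (hθ : 0 ≤ θ) (hM : 0 ≤ M) (h : ∀ κ ∈ P.ext, P.pB v κ ≤ M) :
    supportFun (P.ballY θ) (P.pB v) ≤ θ * M := by
  refine hP.supportFun_ballY_le hθ fun y hy => ?_
  rcases (hP.normY_nonneg y).eq_or_lt with hzero | hpos
  · calc P.pB v y ≤ ‖v‖ * P.normY y := hP.pB_le v y
      _ = 0 := by rw [← hzero, mul_zero]
      _ ≤ θ * M := mul_nonneg hθ hM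
  · have hunit := hext.pB_le h (hP.inv_smul_mem_sphere hy.1 hpos)
    rw [map_smul, smul_eq_mul, inv_mul_le_iff₀ hpos] at hunit
    exact hunit.trans (mul_le_mul_of_nonneg_right hy.2 hM)

theorem Admissible.pB_le_supportFun_ext (hP : P.Admissible) (v : B) {κ : Y} (hκ : κ ∈ P.ext) :
    P.pB v κ ≤ supportFun P.ext (P.pB v) := by
  refine le_csSup ⟨‖v‖, ?_⟩ ⟨κ, hκ, rfl⟩
  rintro _ ⟨y, hy, rfl⟩
  simpa only [hy.1.2, mul_one] using hP.pB_le v y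

theorem pB_sub_An (α : Fin n → ℝ) (y : Y) :
    P.pB (P.b - P.An S n α) y = P.pB P.b y - α ⬝ᵥ P.AnStar S n y := by
  rw [map_sub, LinearMap.sub_apply, pB_An]

theorem pB_le_of_mem_feasN {α : Fin n → ℝ} (hα : α ∈ P.feasN S n) {y : Y} (hy : y ∈ P.Kstar) :
    P.pB P.b y ≤ α ⬝ᵥ P.AnStar S n y := by
  have hslack : 0 ≤ P.pB (P.An S n α - P.b) y := mem_Kstar.1 hy _ hα.1
  rwa [map_sub, LinearMap.sub_apply, pB_An, sub_nonneg] at hslack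

theorem JnN_le_Jn (hR : ∀ α, S.R n α = 0 → α = 0) (hf : (P.feasN S n).Nonempty)
    {y : Fin N → Y} (hy : ∀ j, y j ∈ P.Kstar) : P.JnN S n y ≤ P.Jn S n :=
  csInf_le_csInf (Scheme.bddBelow_dotProduct hR (fun _ h => h.2) _) (hf.image _)
    (image_mono fun _ hα => ⟨fun j => pB_le_of_mem_feasN hα (hy j), hα.2⟩)

theorem IsScenarioOptimizer.JnN_eq {y : Fin N → Y} {α : Fin n → ℝ}
    (h : P.IsScenarioOptimizer S n y α) : P.JnN S n y = α ⬝ᵥ P.cvec S n :=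
  IsLeast.csInf_eq ⟨⟨α, h.1, rfl⟩, by rintro _ ⟨α', hα', rfl⟩; exact h.2 α' hα'⟩

theorem IsScenarioOptimizer.Jn_le_JnN_add {y : Fin N → Y} {α : Fin n → ℝ}
    (hα : P.IsScenarioOptimizer S n y α) (hreg : P.Regular S n γ)
    (hR : ∀ α, S.R n α = 0 → α = 0) (hP : P.Admissible) (hext : P.ExtGenerates)
    (hJ : JLB ≤ P.Jn S n) {M : ℝ} (hM : 0 ≤ M)
    (h : ∀ κ ∈ P.ext, P.pB (P.b - P.An S n α) κ ≤ M) :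
    P.Jn S n ≤ P.JnN S n y + P.θD S n γ JLB * M := by
  rw [hα.JnN_eq]
  exact (hreg.Jn_le_upperVal hR hP hJ hα.1.2).trans
    (add_le_add_right (hext.supportFun_ballY_le hP (hreg.θD_nonneg hR hJ) hM h) _)

variable [MeasurableSpace Y] {ℙ : Measure Y}

/-- The violation probability of `α`: the probability that the constraint of a random `y` fails
at `α`. -/
noncomputable def violation (P : Program X C B Y) (S : Scheme X) (ℙ : Measure Y) (n : ℕ)
    (α : Fin n → ℝ) : ℝ :=
  ℙ.real {y | α ⬝ᵥ P.AnStar S n y < P.pB P.b y}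

theorem IsTailBound.pB_le {h : (Fin n → ℝ) → ℝ → ℝ} (hh : P.IsTailBound S ℙ n h)
    (hP : P.Admissible) {ε : ℝ} (hε : ε ∈ Ico (0 : ℝ) 1) {α : Fin n → ℝ}
    (hα : P.violation S ℙ n α ≤ ε) {κ : Y} (hκ : κ ∈ P.ext) :
    P.pB (P.b - P.An S n α) κ ≤ h α ε := by
  refine (hP.pB_le_supportFun_ext _ hκ).trans ?_
  rcases le_total (supportFun P.ext (P.pB (P.b - P.An S n α))) 0 with hneg | hpos
  · exact hneg.trans (hh α ε hε).1
  · refine (hh α ε hε).2 ⟨hpos, le_trans (le_of_eq ?_) hα⟩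
    simp only [tailProb, violation, lt_add_iff_pos_left, pB_sub_An, sub_pos]

variable [IsProbabilityMeasure ℙ]

namespace IsBallLowerBound

theorem pB_le {g : ℝ → ℝ} (hg : P.IsBallLowerBound ℙ g) (hP : P.Admissible) {r : ℝ}
    (hr : 0 ≤ r) {α : Fin n → ℝ} (hα : P.violation S ℙ n α < g r) {κ : Y} (hκ : κ ∈ P.ext) :
    P.pB (P.b - P.An S n α) κ ≤ ‖P.b - P.An S n α‖ * r := by
  by_contra! hlt
  refine hα.not_ge ((hg.le κ hκ r hr).trans (measureReal_mono fun y hy => ?_))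
  rw [mem_ofPred_eq, ← sub_pos, ← pB_sub_An]
  set v := P.b - P.An S n α
  have hnear : P.pB v κ - P.pB v y ≤ ‖v‖ * P.normY (y - κ) := by
    simpa using hP.pB_le (-v) (y - κ)
  have hball : ‖v‖ * P.normY (y - κ) ≤ ‖v‖ * r :=
    mul_le_mul_of_nonneg_left (le_of_lt hy) (norm_nonneg v)
  linarith

omit [IsProbabilityMeasure ℙ] in
theorem pos_of_pos {g : ℝ → ℝ} (hg : P.IsBallLowerBound ℙ g) (hP : P.Admissible)
    (hne : P.ext.Nonempty) {r : ℝ} (hr : 0 ≤ r) (hgr : 0 < g r) : 0 < r := by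
  obtain ⟨κ, hκ⟩ := hne
  refine hr.lt_of_ne fun hzero => ?_
  have hempty : {y | P.normY (y - κ) < r} = ∅ :=
    eq_empty_of_forall_notMem fun y hy => (hP.normY_nonneg _).not_gt (hzero ▸ hy)
  have hle := hg.le κ hκ r hr
  rw [hempty, measureReal_empty] at hle
  exact hle.not_gt hgr

theorem Jn_le_JnN_add {g : ℝ → ℝ} (hg : P.IsBallLowerBound ℙ g) (hreg : P.Regular S n γ)
    (hR : ∀ α, S.R n α = 0 → α = 0) (hS : ∀ i < n, ‖S.x i‖ ≤ 1) (hP : P.Admissible)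
    (hext : P.ExtGenerates) (hJ : JLB ≤ P.Jn S n) {y : Fin N → Y} {α : Fin n → ℝ}
    (hα : P.IsScenarioOptimizer S n y α) {ε : ℝ} (hε : 0 < ε)
    (hz : 0 < P.zn S n (P.θD S n γ JLB) * ε)
    (hviol : P.violation S ℙ n α < g (P.zn S n (P.θD S n γ JLB) * ε)) :
    P.Jn S n ≤ P.JnN S n y + ε := by
  set θ := P.θD S n γ JLB
  have hradius : 0 < θ * (S.θP * S.rho n * ‖P.A‖ + ‖P.b‖) :=
    inv_pos.1 (pos_of_mul_pos_left hz hε.le)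
  refine (hα.Jn_le_JnN_add hreg hR hP hext hJ (M := ‖P.b - P.An S n α‖ * (P.zn S n θ * ε))
    (by positivity) fun κ hκ => hg.pB_le hP hz.le hviol hκ).trans (add_le_add_right ?_ _)
  calc θ * (‖P.b - P.An S n α‖ * (P.zn S n θ * ε))
      ≤ θ * ((S.θP * S.rho n * ‖P.A‖ + ‖P.b‖) * (P.zn S n θ * ε)) := by
        have hθ : 0 ≤ θ := hreg.θD_nonneg hR hJ
        gcongr
        exact norm_b_sub_An_le hR hS hreg.θP_pos hα.1.2
    _ = ε := by rw [← mul_assoc, zn, mul_inv_cancel_left₀ hradius.ne']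

end IsBallLowerBound

namespace Regular

variable {αN : (Fin N → Y) → Fin n → ℝ}

theorem measure_violation_le (hreg : P.Regular S n γ) (hR : ∀ α, S.R n α = 0 → α = 0)
    (hn : 1 ≤ n) (hmeas : ∀ v : B, Measurable fun y => P.pB v y)
    (hsupp : ∀ᵐ y ∂ℙ, y ∈ P.Kstar)
    (hαN : ∀ᵐ y ∂(Measure.pi fun _ : Fin N => ℙ),
      ∀ α, P.IsScenarioOptimizer S n y α → α = αN y) {ε : ℝ} (hε : 0 ≤ ε) (hε1 : ε ≤ 1) :
    Measure.pi (fun _ : Fin N => ℙ) {y | ε < P.violation S ℙ n (αN y)} ≤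
      ENNReal.ofReal (binTail n N ε) := by
  rcases lt_or_ge N n with hN | hN
  · rw [binTail_of_lt hN, ENNReal.ofReal_one]
    exact prob_le_one
  obtain ⟨α₀, hα₀⟩ := hreg.feasible
  let R : RandomProgram Y n :=
    { K := S.ballR n
      f := fun α => α ⬝ᵥ P.cvec S n
      s := P.AnStar S n
      t := fun y => P.pB P.b y
      label := 0 }
  have hunique : ∀ᵐ y ∂(Measure.pi fun _ : Fin N => ℙ),
      ∀ α ∈ R.feasSet (range y), IsMinOn R.f (R.feasSet (range y)) α → α = αN y := by
    filter_upwards [hαN] with y hy α hα hmin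
    exact hy α ⟨⟨forall_mem_range.1 hα.2, hα.1⟩,
      fun α' hα' => hmin ⟨hα'.2, forall_mem_range.2 hα'.1⟩⟩
  have hle := RandomProgram.measure_violation_le_of_ae_unique (R := R)
    (Scheme.isCompact_ballR hR) (S.convex_ballR n)
    (((dotProductBilin ℝ ℝ).flip (P.cvec S n)).convexOn convex_univ)
    ⟨measurable_pi_lambda _ fun i => hmeas _, hmeas P.b, measurable_const⟩ hn
    (hN.trans_eq (Fintype.card_fin N).symm) hα₀.2
    (hsupp.mono fun y hy => pB_le_of_mem_feasN hα₀ hy) hunique hε hε1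
  rw [Fintype.card_fin] at hle
  exact hle

variable {β ε : ℝ} (hreg : P.Regular S n γ)
  (hR : ∀ α, S.R n α = 0 → α = 0) (hP : P.Admissible) (hext : P.ExtGenerates)
  (hJ : JLB ≤ P.Jn S n) (hn : 1 ≤ n) (hmeas : ∀ v : B, Measurable fun y => P.pB v y)
  (hsupp : ∀ᵐ y ∂ℙ, y ∈ P.ext)
  (hαN : ∀ᵐ y ∂(Measure.pi fun _ : Fin N => ℙ), P.IsScenarioOptimizer S n y (αN y) ∧
    ∀ α, P.IsScenarioOptimizer S n y α → α = αN y)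
include hreg hR hP hext hJ hn hmeas hsupp hαN

theorem measure_Jn_notMem_Icc_le_of_isTailBound {h : (Fin n → ℝ) → ℝ → ℝ}
    (hh : P.IsTailBound S ℙ n h) (hε : ε ∈ Ico (0 : ℝ) 1) (hN : sampleBound n ε β ≤ N) :
    Measure.pi (fun _ : Fin N => ℙ) {y | P.Jn S n ∉
      Icc (P.JnN S n y) (P.JnN S n y + P.θD S n γ JLB * h (αN y) ε)} ≤ ENNReal.ofReal β := by
  refine le_trans (measure_mono_ae ?_) ((hreg.measure_violation_le hR hn hmeas
    (hsupp.mono fun _ hy => hy.1.1) (hαN.mono fun _ hy => hy.2) hε.1 hε.2.le).trans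
    (ENNReal.ofReal_le_ofReal (binTail_le_of_sampleBound_le hε.1 hε.2.le hN)))
  filter_upwards [ae_pi_forall hsupp, hαN] with y hy hα hbad
  by_contra! hviol
  exact hbad ⟨JnN_le_Jn hR hreg.feasible fun j => (hy j).1.1,
    hα.1.Jn_le_JnN_add hreg hR hP hext hJ (hh _ ε hε).1
      fun _ => hh.pB_le hP hε (not_lt.1 hviol)⟩

theorem measure_Jn_notMem_Icc_le_of_enoughSamples (hS : ∀ i < n, ‖S.x i‖ ≤ 1) (hε : 0 < ε)
    (hβ : β < 1) (hN : P.EnoughSamples S ℙ n (P.θD S n γ JLB) ε β N) :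
    Measure.pi (fun _ : Fin N => ℙ) {y | P.Jn S n ∉ Icc (P.JnN S n y) (P.JnN S n y + ε)} ≤
      ENNReal.ofReal β := by
  obtain ⟨g, hg, hgN⟩ := hN
  have hz : 0 ≤ P.zn S n (P.θD S n γ JLB) * ε := by
    obtain ⟨α₀, hα₀⟩ := hreg.feasible
    have hbound := (norm_nonneg _).trans (norm_b_sub_An_le (P := P) hR hS hreg.θP_pos hα₀.2)
    exact mul_nonneg (inv_nonneg.2 (mul_nonneg (hreg.θD_nonneg hR hJ) hbound)) hε.le
  have hgr := hg.mem _ hz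
  have htail := binTail_le_of_sampleBound_le hgr.1 hgr.2 hgN
  have hgpos : 0 < g (P.zn S n (P.θD S n γ JLB) * ε) := hgr.1.lt_of_ne fun hzero => by
    rw [← hzero, binTail_zero hn] at htail
    exact htail.not_gt hβ
  refine le_trans (measure_mono_ae ?_) ((measure_setOf_le_le_of_measure_setOf_lt_le
    (continuous_binTail n N) hgpos fun δ hδ hδg => hreg.measure_violation_le hR hn hmeas
      (hsupp.mono fun _ hy => hy.1.1) (hαN.mono fun _ hy => hy.2) hδ (hδg.trans hgr.2)).trans
    (ENNReal.ofReal_le_ofReal htail))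
  filter_upwards [ae_pi_forall hsupp, hαN] with y hy hα hbad
  by_contra! hviol
  exact hbad ⟨JnN_le_Jn hR hreg.feasible fun j => (hy j).1.1,
    hg.Jn_le_JnN_add hreg hR hS hP hext hJ hα.1 hε (hg.pos_of_pos hP hsupp.exists hz hgpos)
      (not_le.1 hviol)⟩

end Regular

end Program

end Scenario

end InfLP

theorem mainTheorem5_general {X C B Y : Type*} [NormedAddCommGroup X] [NormedSpace ℝ X]
    [AddCommGroup C] [Module ℝ C] [NormedAddCommGroup B] [NormedSpace ℝ B]
    [AddCommGroup Y] [Module ℝ Y] [MeasurableSpace Y]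
    (P : InfLP.Program X C B Y) (hP : P.Admissible) (xstar : X) (hx : P.IsOptimizer xstar)
    (S : InfLP.Scheme X) (n : ℕ) (hn : 1 ≤ n) (hS : ∀ i < n, ‖S.x i‖ ≤ 1)
    (hR : ∀ α, S.R n α = 0 → α = 0) (d D : ℝ) (hd : 0 < d) (xn : X) (hxn : xn ∈ S.ballX n)
    (hres : ‖xstar - xn‖ ≤ D * (n : ℝ) ^ (-1 / d)) (γ : ℝ) (hreg : P.Regular S n γ)
    (JLB : ℝ) (hJLB : JLB ≤ P.Jn S n) (θD : ℝ) (hθD : θD = P.θD S n γ JLB)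
    (hext : P.ExtGenerates) (ℙ : Measure Y) [IsProbabilityMeasure ℙ]
    (hmeas : ∀ v : B, Measurable (fun y => P.pB v y)) (hsupp : ∀ᵐ y ∂ℙ, y ∈ P.ext)
    (N : ℕ) (αN : (Fin N → Y) → Fin n → ℝ)
    (hαN : ∀ᵐ y ∂(Measure.pi fun _ : Fin N => ℙ), P.IsScenarioOptimizer S n y (αN y) ∧
      ∀ α, P.IsScenarioOptimizer S n y α → α = αN y)
    (prox : Y → ℝ) (hprox : ∀ y ∈ P.ballY θD, 0 ≤ prox y) (ystar : ℝ → (Fin n → ℝ) → Y)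
    (hystar : P.IsProxMaximizer S n θD prox ystar)
    (η L ϑ : ℝ) (hη : 0 < η) (hL : 0 < L) (hLip : P.LipschitzGradient S n ystar L η)
    (hϑ : 0 < ϑ) (hconv : InfLP.StronglyConvex (S.R n) Set.univ ϑ (fun α => S.R n α ^ 2 / 2))
    (w z a : ℕ → Fin n → ℝ) (hrun : P.IsRun S n ystar η L ϑ w z a) (k : ℕ)
    (β : ℝ) (hβ : β < 1) :
    (∀ h : (Fin n → ℝ) → ℝ → ℝ, P.IsTailBound S ℙ n h → ∀ ε ∈ Set.Ioo (0 : ℝ) 1,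
      InfLP.sampleBound n ε β ≤ N →
      (Measure.pi fun _ : Fin N => ℙ) {y | ¬
        (max (P.JnN S n y) (P.lowerVal S n (InfLP.yhat ystar η w k))
            - D * (P.normC + θD * ‖P.A‖) * (n : ℝ) ^ (-1 / d) ≤ P.J ∧
          P.J ≤ min (P.upperVal S n θD (a k)) (P.JnN S n y + θD * h (αN y) ε))}
        ≤ ENNReal.ofReal β) ∧
    (∀ ε : ℝ, 0 < ε → (D * (P.normC + θD * ‖P.A‖) * ε⁻¹) ^ d ≤ (n : ℝ) →
      (P.EnoughSamples S ℙ n θD ε β N ∨ S.EnoughIterations n prox ystar L ϑ ε η k) →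
      (Measure.pi fun _ : Fin N => ℙ) {y | ¬
        min |P.J - P.JnN S n y| |P.J - P.lowerVal S n (InfLP.yhat ystar η w k)| ≤ ε}
        ≤ ENNReal.ofReal β) := by
  subst hθD
  have hJ_le : P.J ≤ P.Jn S n := hx.J_le_Jn hreg.feasible
  have hJ_ge : P.Jn S n - D * (P.normC + P.θD S n γ JLB * ‖P.A‖) * (n : ℝ) ^ (-1 / d) ≤ P.J :=
    by linarith [hreg.Jn_sub_le_J hR hP hJLB hx hxn hres]
  have hlower : P.lowerVal S n (InfLP.yhat ystar η w k) ≤ P.Jn S n :=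
    hrun.lowerVal_le_Jn hP hR hreg.feasible hystar hη hL hϑ k
  have hupper : P.Jn S n ≤ P.upperVal S n (P.θD S n γ JLB) (a k) :=
    hreg.Jn_le_upperVal hR hP hJLB (hrun.stepA k).1
  refine ⟨fun h hh ε hε hN => ?_, fun ε hε hnε hor => ?_⟩
  · refine le_trans (measure_mono ?_)
      (hreg.measure_Jn_notMem_Icc_le_of_isTailBound hR hP hext hJLB hn hmeas hsupp hαN hh
        ⟨hε.1.le, hε.2⟩ hN)
    refine fun y hbad hmem => hbad ⟨?_, ?_⟩
    · exact (sub_le_sub_right (max_le hmem.1 hlower) _).trans hJ_ge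
    · exact hJ_le.trans (le_min hupper hmem.2)
  · have herror := InfLP.mul_rpow_neg_one_div_le n.cast_nonneg hd hε hnε
    rcases hor with hN | hit
    · refine le_trans (measure_mono ?_)
        (hreg.measure_Jn_notMem_Icc_le_of_enoughSamples hR hP hext hJLB hn hmeas hsupp hαN hS hε
          hβ hN)
      refine fun y hbad hmem => hbad (min_le_of_left_le ?_)
      exact abs_le.2 ⟨by linarith [hmem.1], by linarith [hmem.2]⟩
    · have hgap := hrun.upperVal_le_lowerVal_add hP hR hn hreg.θP_pos (hreg.θD_nonneg hR hJLB)
        hprox hystar hη hL hLip hϑ hconv hε hit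
      have habs : |P.J - P.lowerVal S n (InfLP.yhat ystar η w k)| ≤ ε :=
        abs_le.2 ⟨by linarith, by linarith⟩
      simp [habs]

/-- Probabilities of at least `1 - β` are expressed by bounding the (outer) probability of the
complementary event by `β`. -/
theorem mainTheorem5 {X C B Y : Type*} [NormedAddCommGroup X] [NormedSpace ℝ X]
    [AddCommGroup C] [Module ℝ C] [NormedAddCommGroup B] [NormedSpace ℝ B]
    [AddCommGroup Y] [Module ℝ Y] [MeasurableSpace Y]
    -- the infinite program and its optimizer
    (P : InfLP.Program X C B Y) (hP : P.Standing) (xstar : X) (hx : P.IsOptimizer xstar)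
    -- the basis, the norms on the spaces `ℝⁿ`, and the projection residuals
    (S : InfLP.Scheme X) (hS : S.Standing) (d D : ℝ) (hd : 0 < d) (proj : ℕ → X)
    (hproj : ∀ m : ℕ, 1 ≤ m → InfLP.IsProjection (S.ballX m) xstar (proj m))
    (hres : ∀ m : ℕ, 1 ≤ m → ‖xstar - proj m‖ ≤ D * (m : ℝ) ^ (-1 / d))
    -- semi-infinite regularity and the dual optimizer bound
    (n : ℕ) (hn : 1 ≤ n) (γ : ℝ) (hreg : P.Regular S n γ)
    (JLB : ℝ) (hJLB : JLB ≤ P.Jn S n) (θD : ℝ) (hθD : θD = P.θD S n γ JLB)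
    -- the sampling measure, supported on the extreme points
    (hext : P.ExtGenerates) (ℙ : Measure Y) [IsProbabilityMeasure ℙ]
    (hmeas : ∀ v : B, Measurable (fun y => P.pB v y)) (hsupp : ∀ᵐ y ∂ℙ, y ∈ P.ext)
    -- the scenario program and its (almost surely) unique optimizer
    (N : ℕ) (αN : (Fin N → Y) → Fin n → ℝ)
    (hαN : ∀ᵐ y ∂(Measure.pi fun _ : Fin N => ℙ), P.IsScenarioOptimizer S n y (αN y) ∧
      ∀ α, P.IsScenarioOptimizer S n y α → α = αN y)
    -- the prox-function and `k` iterations of the smoothing algorithm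
    (prox : Y → ℝ) (hprox : P.IsProxFun θD prox) (ystar : ℝ → (Fin n → ℝ) → Y)
    (hystar : P.IsProxMaximizer S n θD prox ystar)
    (η L ϑ : ℝ) (hη : 0 < η) (hL : 0 < L) (hLip : P.LipschitzGradient S n ystar L η)
    (hϑ : 0 < ϑ) (hconv : InfLP.StronglyConvex (S.R n) Set.univ ϑ (fun α => S.R n α ^ 2 / 2))
    (w z a : ℕ → Fin n → ℝ) (hrun : P.IsRun S n ystar η L ϑ w z a) (k : ℕ)
    -- the confidence level
    (β : ℝ) (hβ : β ∈ Set.Ioo (0 : ℝ) 1) :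
    -- the a posteriori bounds
    (∀ h : (Fin n → ℝ) → ℝ → ℝ, P.IsTailBound S ℙ n h → ∀ ε ∈ Set.Ioo (0 : ℝ) 1,
      InfLP.sampleBound n ε β ≤ N →
      (Measure.pi fun _ : Fin N => ℙ) {y | ¬
        (max (P.JnN S n y) (P.lowerVal S n (InfLP.yhat ystar η w k))
            - D * (P.normC + θD * ‖P.A‖) * (n : ℝ) ^ (-1 / d) ≤ P.J ∧
          P.J ≤ min (P.upperVal S n θD (a k)) (P.JnN S n y + θD * h (αN y) ε))}
        ≤ ENNReal.ofReal β) ∧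
    -- the a priori bound
    (∀ ε : ℝ, 0 < ε → (D * (P.normC + θD * ‖P.A‖) * ε⁻¹) ^ d ≤ (n : ℝ) →
      (P.EnoughSamples S ℙ n θD ε β N ∨ S.EnoughIterations n prox ystar L ϑ ε η k) →
      (Measure.pi fun _ : Fin N => ℙ) {y | ¬
        min |P.J - P.JnN S n y| |P.J - P.lowerVal S n (InfLP.yhat ystar η w k)| ≤ ε}
        ≤ ENNReal.ofReal β) :=
  mainTheorem5_general P hP.admissible xstar hx S n hn (fun i _ => (hS.normalized i).le)
    (hS.definite n) d D hd (proj n) (hproj n hn).1 (hres n hn) γ hreg JLB hJLB θD hθD hext ℙ hmeas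
    hsupp N αN hαN prox hprox.1 ystar hystar η L ϑ hη hL hLip hϑ hconv w z a hrun k β hβ.2
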